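/- **Setting.** Let $\mathsf N$ be the number of sites, $2s_1,\dots,2s_{\mathsf N}\in\mathbb N$, $\xi_1,\dots,\xi_{\mathsf N}\in\mathbb C$, and let $\eta\in\mathbb C$ be such that $q=e^\eta$ is not a root of unity. Put $\mathsf N_s=2\sum_n s_n$, $\xi_n^{(k)}=\xi_n+(s_n-k)\eta$, $$a(\lambda)=\prod_{n=1}^{\mathsf N}\sinh(\lambda-\xi_n+s_n\eta),\qquad d(\lambda)=\prod_{n=1}^{\mathsf N}\sinh(\lambda-\xi_n-s_n\eta).$$ On $V_n=\mathbb C^{2s_n+1}$ with basis $|k,n\rangle$, $0\le k\le 2s_n$, let $S_n^z|k,n\rangle=(s_n-k)|k,n\rangle$, $S_n^-|k,n\rangle=x_n(k+1)|k+1,n\rangle$, $S_n^+|k,n\rangle=x_n(k)|k-1,n\rangle$, where $x_n(k)=\sqrt{[k]_q[2s_n-k+1]_q}$ and $[j]_q=\sinh(j\eta)/\sinh\eta$. Let $$\mathsf L_n(\lambda)=\begin{pmatrix}\sinh(\lambda+\eta S_n^z)&S_n^-\sinh\eta\\ S_n^+\sinh\eta&\sinh(\lambda-\eta S_n^z)\end{pmatrix},\qquad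 \mathsf L_{\mathsf N}(\lambda-\xi_{\mathsf N})\cdots\mathsf L_1(\lambda-\xi_1)=\begin{pmatrix}\mathsf A(\lambda)&\mathsf B(\lambda)\\ \mathsf C(\lambda)&\mathsf D(\lambda)\end{pmatrix}$$ with entries acting on $\bigotimes_nV_n$, and for $\kappa\in\mathbb C\setminus\{0\}$ let $\bar{\mathsf T}^{(\kappa)}(\lambda)=\kappa^{-1}\mathsf B(\lambda)+\kappa\,\mathsf C(\lambda)$ be the $\kappa$-twisted antiperiodic transfer matrix. A function $\bar{\mathsf t}$ is an eigenvalue function of $\bar{\mathsf T}^{(\kappa)}$ if there is $v\ne0$ with $\bar{\mathsf T}^{(\kappa)}(\lambda)v=\bar{\mathsf t}(\lambda)v$ for all $\lambda\in\mathbb C$; its right (left) eigenspace is the space of all column (row) vectors $v$ with $\bar{\mathsf T}^{(\kappa)}(\lambda)v=\bar{\mathsf t}(\lambda)v$ (resp. $v\,\bar{\mathsf T}^{(\kappa)}(\lambda)=\bar{\mathsf t}(\lambda)v$) for all $\lambda$. For $\mathbf h=(h_1,\dots,h_{\mathsf N})$ with $0\le h_n\le 2s_n$ put $$\langle\mathbf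 h|=\langle\mathbf 0|\prod_{n=1}^{\mathsf N}\prod_{k=0}^{h_n-1}\frac{\mathsf C(\xi_n^{(k)})}{d(\xi_n^{(k+1)})},\qquad |\mathbf h\rangle=\prod_{n=1}^{\mathsf N}\prod_{k=0}^{h_n-1}\Big(-\frac{\mathsf B(\xi_n^{(k)})}{a(\xi_n^{(k)})}\Big)|\mathbf 0\rangle,$$ where $\langle\mathbf 0|$ and $|\mathbf 0\rangle$ are $\bigotimes_n\langle0,n|$ and $\bigotimes_n|0,n\rangle$ divided by $\prod_{i<j}\sinh(\xi_j^{(0)}-\xi_i^{(0)})^{1/2}$. **Assumption (cond-inh).** $\Xi_i\cap\Xi_j=\emptyset$ for $i\ne j$, where $\Xi_n=\{\xi_n+k\eta+m\,i\pi\mid k=-s_n,-s_n+1,\dots,s_n;\ m\in\mathbb Z\}$. **Bethe equations.** For an unordered family $\Lambda=\{\lambda_1,\dots,\lambda_{\mathsf N_s}\}$ of complex numbers, repetitions allowed, put $$\bar{\mathsf t}_\Lambda(\lambda)=-a(\lambda)\prod_{j=1}^{\mathsf N_s}\frac{\sinh\frac{\lambda-\lambda_j-\eta}2}{\sinh\frac{\lambda-\lambda_j}2}+d(\lambda)\prod_{j=1}^{\mathsf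 N_s}\frac{\sinh\frac{\lambda-\lambda_j+\eta}2}{\sinh\frac{\lambda-\lambda_j}2}.\tag{bethe-hom}$$ Let $\Sigma_{\mathrm{BAE}}$ be the set of those $\Lambda$ for which all singularities of $\bar{\mathsf t}_\Lambda$ are removable, so that it is an entire function (homogeneous Bethe equations), and for which * (i) $\operatorname{Im}\lambda_j\in[0,2\pi)$ for all $j$; * (ii) for all $k\in\{1,\dots,\mathsf N\}$: $\{\xi_k^{(0)},\xi_k^{(0)}+i\pi\}\not\subset\{\lambda_j+2i\ell\pi\mid 1\le j\le\mathsf N_s,\ \ell\in\mathbb Z\}$; * (iii) $\bar{\mathsf t}_\Lambda(\lambda+i\pi)=(-1)^{\mathsf N-1}\,\bar{\mathsf t}_\Lambda(\lambda)$ for all $\lambda$. **Statement.** Under (cond-inh), for every $\kappa\in\mathbb C\setminus\{0\}$ the map $\Lambda\mapsto\bar{\mathsf t}_\Lambda$ is a bijection from $\Sigma_{\mathrm{BAE}}$ onto the set $\Sigma_{\bar{\mathsf T}}$ of eigenvalue functions of $\bar{\mathsf T}^{(\kappa)}$ (which, therefore, does not depend on $\kappa$). For every $\Lambda\in\Sigma_{\mathrm{BAE}}$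 and every $\kappa\neq0$ the left and right eigenspaces for $\bar{\mathsf t}_\Lambda$ are one-dimensional, and they are spanned respectively by the vectors $$\sum_{\mathbf h}\prod_{j=1}^{\mathsf N}\Big\{(\epsilon_j\kappa)^{h_j}\,Q_\Lambda^{(\epsilon_j)}(\xi_j^{(h_j)})\Big\}\prod_{i<j}\sinh(\xi_j^{(h_j)}-\xi_i^{(h_i)})\,\langle\mathbf h|$$ and $$\sum_{\mathbf h}\prod_{j=1}^{\mathsf N}\Big\{(-\epsilon_j\kappa)^{-h_j}\Big(\prod_{\ell=0}^{h_j-1}\frac{a(\xi_j^{(\ell)})}{d(\xi_j^{(\ell+1)})}\Big)Q_\Lambda^{(\epsilon_j)}(\xi_j^{(h_j)})\Big\}\prod_{i<j}\sinh(\xi_j^{(h_j)}-\xi_i^{(h_i)})\,|\mathbf h\rangle,$$ where $(\epsilon_1,\dots,\epsilon_{\mathsf N})$ runs through $\{1,-1\}^{\mathsf N}$ and $$Q_\Lambda^{(\epsilon)}(\lambda)=\prod_{j=1}^{\mathsf N_s}\sinh\Big(\frac{\lambda-\lambda_j}2+\frac{1-\epsilon}4\,i\pi\Big).$$ Moreover,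 whenever $Q_\Lambda^{(\epsilon_j)}(\xi_j^{(0)})\ne0$ for all $j$, the single vectors attached to $(\epsilon_1,\dots,\epsilon_{\mathsf N})$ already span these eigenspaces; this applies in particular to constant signs $\epsilon_1=\dots=\epsilon_{\mathsf N}=\epsilon=\pm1$. -/

import Mathlib

namespace XXZ

/-- The parameters of an inhomogeneous XXZ chain with `N` sites: at site `n` the spin is
`s n = twoS n / 2` and the inhomogeneity parameter is `ξ n`; `η` is the anisotropy parameter,
`q = exp η`. -/
structure Chain where
  N : ℕ
  twoS : Fin N → ℕ
  ξ : Fin N → ℂ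
  η : ℂ

namespace Chain

noncomputable section

/-- The spin `s_n` as a complex number. -/
def s (c : Chain) (n : Fin c.N) : ℂ := (c.twoS n : ℂ) / 2

/-- `N_s = 2 ∑ s_n`. -/
def Ns (c : Chain) : ℕ := ∑ n, c.twoS n

/-- The tuples `h = (h_1, …, h_N)` with `0 ≤ h_n ≤ 2 s_n`. They index the product basis
`⊗ₙ |h_n, n⟩` of the space of states `⊗ₙ V_n`, `V_n = ℂ^(2 s_n + 1)`, which is thus realized as
`Conf → ℂ` (column vectors for the right space, row vectors for the left space). -/
abbrev Conf (c : Chain) : Type := ∀ n : Fin c.N, Fin (c.twoS n + 1)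

/-- Operators on the space of states, as matrices in the basis `⊗ₙ |h_n, n⟩`. -/
abbrev Op (c : Chain) : Type := Matrix c.Conf c.Conf ℂ

/-- The shifted inhomogeneities `ξ_n^(k) = ξ_n + (s_n - k) η`. -/
def xi (c : Chain) (n : Fin c.N) (k : ℕ) : ℂ := c.ξ n + (c.s n - k) * c.η

/-- `Ξ_n = {ξ_n + k η + m i π : k = -s_n, …, s_n; m ∈ ℤ}`. -/
def Xi (c : Chain) (n : Fin c.N) : Set ℂ :=
  {z | ∃ k : Fin (c.twoS n + 1), ∃ m : ℤ, z = c.xi n k + m * (Complex.I * Real.pi)}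

/-! ### Local operators, monodromy matrix, transfer matrix -/

/-- The `q`-integer `[z]_q = sinh (η z) / sinh η`. -/
def qInt (c : Chain) (z : ℂ) : ℂ := Complex.sinh (c.η * z) / Complex.sinh c.η

/-- `x_n(k) = ([k]_q [2 s_n - k + 1]_q)^(1/2)`. -/
def x (c : Chain) (n : Fin c.N) (k : ℕ) : ℂ :=
  (c.qInt k * c.qInt (c.twoS n - k + 1)) ^ (1 / 2 : ℂ)

/-- `f (S^z)`: `S^z |k⟩ = (s_n - k) |k⟩`. -/
def fSz (c : Chain) (n : Fin c.N) (f : ℂ → ℂ) :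
    Matrix (Fin (c.twoS n + 1)) (Fin (c.twoS n + 1)) ℂ :=
  Matrix.diagonal fun k => f (c.s n - (k : ℕ))

/-- `S^- |k⟩ = x_n(k+1) |k+1⟩`. -/
def Sminus (c : Chain) (n : Fin c.N) :
    Matrix (Fin (c.twoS n + 1)) (Fin (c.twoS n + 1)) ℂ :=
  Matrix.of fun i k => if (i : ℕ) = (k : ℕ) + 1 then c.x n ((k : ℕ) + 1) else 0

/-- `S^+ |k⟩ = x_n(k) |k-1⟩`. -/
def Splus (c : Chain) (n : Fin c.N) :
    Matrix (Fin (c.twoS n + 1)) (Fin (c.twoS n + 1)) ℂ :=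
  Matrix.of fun i k => if (k : ℕ) = (i : ℕ) + 1 then c.x n (k : ℕ) else 0

/-- The operator acting as `X` on the factor `V_n` and as the identity on the other factors. -/
def site (c : Chain) (n : Fin c.N)
    (X : Matrix (Fin (c.twoS n + 1)) (Fin (c.twoS n + 1)) ℂ) : c.Op :=
  Matrix.of fun h k => if ∀ m, m ≠ n → h m = k m then X (h n) (k n) else 0

/-- The Lax operator at site `n`, as a `2 × 2` matrix (in the auxiliary space) of operators. -/
def lax (c : Chain) (n : Fin c.N) (u : ℂ) : Matrix (Fin 2) (Fin 2) c.Op :=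
  !![c.site n (c.fSz n fun z => Complex.sinh (u + c.η * z)),
     c.site n (Complex.sinh c.η • c.Sminus n);
     c.site n (Complex.sinh c.η • c.Splus n),
     c.site n (c.fSz n fun z => Complex.sinh (u - c.η * z))]

/-- The monodromy matrix `L_N(u - ξ_N) ⋯ L_1(u - ξ_1)`, with entries `A, B; C, D`. -/
def monodromy (c : Chain) (u : ℂ) : Matrix (Fin 2) (Fin 2) c.Op :=
  ((List.finRange c.N).reverse.map fun n => c.lax n (u - c.ξ n)).prod

def B (c : Chain) (u : ℂ) : c.Op := c.monodromy u 0 1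

def C (c : Chain) (u : ℂ) : c.Op := c.monodromy u 1 0

/-- The `κ`-twisted antiperiodic transfer matrix `κ⁻¹ B(u) + κ C(u)`. -/
def T (c : Chain) (κ u : ℂ) : c.Op := κ⁻¹ • c.B u + κ • c.C u

/-- The right eigenspace of the family `T(u)`, `u ∈ ℂ`, for the eigenvalue function `t`:
the column vectors `v` with `T(u) v = t(u) v` for all `u`. -/
def rightEigenspace (c : Chain) (κ : ℂ) (t : ℂ → ℂ) : Submodule ℂ (c.Conf → ℂ) :=
  ⨅ u : ℂ, Module.End.eigenspace (c.T κ u).mulVecLin (t u)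

/-- The left eigenspace: the row vectors `v` with `v T(u) = t(u) v` for all `u`. -/
def leftEigenspace (c : Chain) (κ : ℂ) (t : ℂ → ℂ) : Submodule ℂ (c.Conf → ℂ) :=
  ⨅ u : ℂ, Module.End.eigenspace (c.T κ u).vecMulLinear (t u)

/-- The antiperiodic spectrum: the set of eigenvalue functions of the family `T(u)`, `u ∈ ℂ`. -/
def spectrum (c : Chain) (κ : ℂ) : Set (ℂ → ℂ) := {t | c.rightEigenspace κ t ≠ ⊥}

/-! ### The separation-of-variables states -/

def a (c : Chain) (u : ℂ) : ℂ := ∏ n, Complex.sinh (u - c.ξ n + c.s n * c.η)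

def d (c : Chain) (u : ℂ) : ℂ := ∏ n, Complex.sinh (u - c.ξ n - c.s n * c.η)

/-- `∏_{i<j} sinh (ξ_j^(h_j) - ξ_i^(h_i))`. -/
def sinhVandermonde (c : Chain) (h : c.Conf) : ℂ :=
  ∏ i, ∏ j ∈ Finset.Ioi i, Complex.sinh (c.xi j (h j) - c.xi i (h i))

/-- The coordinates of the reference states `⟨0|` and `|0⟩`, that is, of the product of the
highest-weight states divided by `∏_{i<j} sinh (ξ_j^(0) - ξ_i^(0))^(1/2)`. -/
def reference (c : Chain) : c.Conf → ℂ :=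
  Pi.single 0
    (∏ i, ∏ j ∈ Finset.Ioi i, Complex.sinh (c.xi j 0 - c.xi i 0) ^ (1 / 2 : ℂ))⁻¹

/-- `⟨h| = ⟨0| ∏_n ∏_{k < h_n} C(ξ_n^(k)) / d(ξ_n^(k+1))`. -/
def bra (c : Chain) (h : c.Conf) : c.Conf → ℂ :=
  Matrix.vecMul c.reference
    ((List.finRange c.N).map fun n =>
      ((List.range (h n)).map fun k => (c.d (c.xi n (k + 1)))⁻¹ • c.C (c.xi n k)).prod).prod

/-- `|h⟩ = ∏_n ∏_{k < h_n} (- B(ξ_n^(k)) / a(ξ_n^(k))) |0⟩`. -/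
def ket (c : Chain) (h : c.Conf) : c.Conf → ℂ :=
  Matrix.mulVec
    ((List.finRange c.N).map fun n =>
      ((List.range (h n)).map fun k => -((c.a (c.xi n k))⁻¹ • c.B (c.xi n k))).prod).prod
    c.reference

/-! ### Homogeneous Bethe equations -/

/-- `-a(u) ∏_j sinh ((u-λ_j-η)/2) / sinh ((u-λ_j)/2) + d(u) ∏_j sinh ((u-λ_j+η)/2) / sinh ((u-λ_j)/2)`;
meaningful at the points `u` where no denominator vanishes. -/
def betheExpr (c : Chain) (Λ : Multiset ℂ) (u : ℂ) : ℂ :=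
  -c.a u * (Λ.map fun μ => Complex.sinh ((u - μ - c.η) / 2) / Complex.sinh ((u - μ) / 2)).prod
    + c.d u * (Λ.map fun μ => Complex.sinh ((u - μ + c.η) / 2) / Complex.sinh ((u - μ) / 2)).prod

/-- `t` is entire and coincides with the above expression away from its apparent poles. -/
def IsEntireBethe (c : Chain) (Λ : Multiset ℂ) (t : ℂ → ℂ) : Prop :=
  Differentiable ℂ t ∧
    ∀ u, (∀ μ ∈ Λ, Complex.sinh ((u - μ) / 2) ≠ 0) → t u = c.betheExpr Λ u

/-- The set `Σ_BAE` of unordered families (repetitions allowed) of `N_s` Bethe roots for which the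
Bethe expression is an entire function, with the three additional conditions: normalized imaginary
parts, admissibility, `iπ`-quasi-periodicity. -/
def betheSolutions (c : Chain) : Set (Multiset ℂ) :=
  {Λ | Multiset.card Λ = c.Ns ∧
    (∀ μ ∈ Λ, μ.im ∈ Set.Ico 0 (2 * Real.pi)) ∧
    (∀ k : Fin c.N, ¬ ({c.xi k 0, c.xi k 0 + Complex.I * Real.pi} : Set ℂ) ⊆
      {z | ∃ μ ∈ Λ, ∃ l : ℤ, z = μ + 2 * Complex.I * l * Real.pi}) ∧
    ∃ t : ℂ → ℂ, c.IsEntireBethe Λ t ∧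
      ∀ u, t (u + Complex.I * Real.pi) = (-1 : ℂ) ^ ((c.N : ℤ) - 1) * t u}

end

end Chain

noncomputable section

/-- `Q^(ε)_Λ(u) = ∏_j sinh ((u - λ_j)/2 + (1-ε) iπ/4)`, `ε = ±1`. -/
def Q (Λ : Multiset ℂ) (ε : ℤˣ) (u : ℂ) : ℂ :=
  (Λ.map fun μ =>
    Complex.sinh ((u - μ) / 2 + (1 - ((ε : ℤ) : ℂ)) / 4 * (Complex.I * Real.pi))).prod

namespace Chain

/-- `∑_h ∏_j {(ε_j κ)^(h_j) Q^(ε_j)(ξ_j^(h_j))} ∏_{i<j} sinh (ξ_j^(h_j) - ξ_i^(h_i)) ⟨h|`. -/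
def leftVec (c : Chain) (κ : ℂ) (Λ : Multiset ℂ) (ε : Fin c.N → ℤˣ) : c.Conf → ℂ :=
  ∑ h : c.Conf,
    ((∏ j, (((ε j : ℤ) : ℂ) * κ) ^ (h j : ℕ) * Q Λ (ε j) (c.xi j (h j))) *
      c.sinhVandermonde h) • c.bra h

/-- `∑_h ∏_j {(-ε_j κ)^(-h_j) (∏_{l<h_j} a(ξ_j^(l)) / d(ξ_j^(l+1))) Q^(ε_j)(ξ_j^(h_j))}
∏_{i<j} sinh (ξ_j^(h_j) - ξ_i^(h_i)) |h⟩`. -/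
def rightVec (c : Chain) (κ : ℂ) (Λ : Multiset ℂ) (ε : Fin c.N → ℤˣ) : c.Conf → ℂ :=
  ∑ h : c.Conf,
    ((∏ j, (-(((ε j : ℤ) : ℂ) * κ)) ^ (-((h j : ℕ) : ℤ)) *
        (∏ l ∈ Finset.range (h j), c.a (c.xi j l) / c.d (c.xi j (l + 1))) *
        Q Λ (ε j) (c.xi j (h j))) *
      c.sinhVandermonde h) • c.ket h

end Chain

end

end XXZ

/-! Put w = exp u and σ = exp η. An eigenvalue function becomes an odd polynomial τ(w) of degree
below 2N, a Bethe family becomes a monic polynomial q of degree N_s, and the Bethe equations become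
the Baxter equation τ(w) q(w) = -A(w) q(w/σ) + D(w) q(σw) with A, D even. The theorem says that the
τ coming from eigenvectors are exactly those for which a polynomial q exists.

Operator side. The Yang–Baxter relations and the quantum determinant show that one off-diagonal
monodromy entry moves the joint eigenvectors of the diagonal entry D one step along the strings
ξ_n^(k), and the other moves them back (`Separated`). In this basis the components of an eigenvector
obey a three-term discrete Baxter equation at each site, and all of them follow from the component
at the reference state (`functional_eq_zero`), so eigenspaces are at most one-dimensional.
Conversely, a product of discrete solutions times the Vandermonde factor is an eigenvector
(`separated_eigenvector`): the transfer matrix has N free coefficients, and Lagrange interpolation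
reduces its action to the string points.

Completeness: from discrete solutions to a polynomial q. Since σ is not a root of unity, the Baxter
equation has a unique normalized solution q among formal power series. Because τ is odd, q(-w)
solves it for -τ, and the discrete Wronskians W_j of q(w) and q(-w) obey a three-term recursion in
j. W_0 vanishes and W_1 solves a first-order equation, which makes it an explicit polynomial. The
recursion divides by a dilate of D, and the discrete solutions on the strings are what makes this
division exact (`wronskian_numerator_eval`). So every W_j is a polynomial of degree at most 2 N_s.
For k > N_s a Vandermonde argument over odd j isolates q_k² in the coefficient of w^(2k), hence q_k
= 0 and q is a polynomial (`exists_isSolution`).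

The explicit nonzero W_1 also shows that q does not vanish at both square roots of the top of a
string, which is admissibility; admissibility in turn provides signs for which the separated vector
is nonzero. Injectivity is uniqueness of monic solutions (`IsSolution.eq_of_monic`). -/

namespace XXZ

/-! ### Formal power series solutions of the Baxter equation and their Wronskians -/

/-- The data of the polynomial form of the homogeneous Baxter equation: `σ = exp η` and, for each
site, the squared exponential `δ` of the top of its string and the number `m` of its steps. -/
structure BaxterData (ι : Type*) where
  σ : ℂ
  δ : ι → ℂ
  m : ι → ℕ
  pow_ne_one : ∀ k, 0 < k → σ ^ k ≠ 1
  σ_ne_zero : σ ≠ 0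
  δ_ne_zero : ∀ n, δ n ≠ 0
  strings_disjoint : ∀ n n', n ≠ n' → ∀ k ≤ m n, ∀ k' ≤ m n',
    δ n * (σ⁻¹ ^ 2) ^ k ≠ δ n' * (σ⁻¹ ^ 2) ^ k'

open PowerSeries in
theorem coeff_mul_of_forall_lt_eq_zero {R : Type*} [CommRing R] {f g : PowerSeries R} {n : ℕ}
    (h : ∀ j < n, coeff j f = 0) : coeff n (g * f) = coeff 0 g * coeff n f := by
  rw [mul_comm g f, coeff_mul, Finset.Nat.sum_antidiagonal_eq_sum_range_succ_mk,
    Finset.sum_range_succ, Finset.sum_eq_zero]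
  · simp [mul_comm]
  · intro j hj
    simp [h j (Finset.mem_range.1 hj)]

/-- The solution with initial value `1` of a linear recursion involving all previous terms. -/
noncomputable def linearRecSolution (G : ℕ → ℕ → ℂ) : ℕ → ℂ
  | 0 => 1
  | n + 1 => ∑ j : Fin (n + 1), G n j * linearRecSolution G j
decreasing_by exact j.2

namespace BaxterData

variable {ι : Type*} (b : BaxterData ι)

theorem pow_ne_inv_pow {k : ℕ} (hk : 0 < k) : b.σ ^ k ≠ b.σ⁻¹ ^ k := by
  intro h
  have h0 := b.σ_ne_zero
  have : b.σ ^ (2 * k) = 1 := by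
    rw [two_mul, pow_add]
    nth_rw 2 [h]
    rw [← mul_pow, mul_inv_cancel₀ h0, one_pow]
  exact b.pow_ne_one _ (by omega) this

theorem pow_injective : Function.Injective fun k : ℕ => b.σ ^ k := by
  intro i j h
  wlog hij : i ≤ j generalizing i j
  · exact (this h.symm (by omega)).symm
  obtain ⟨k, rfl⟩ := Nat.exists_eq_add_of_le hij
  simp only [pow_add] at h
  have h1 : b.σ ^ k = 1 := by
    have := pow_ne_zero i b.σ_ne_zero
    exact (mul_left_cancel₀ this (by rw [mul_one]; exact h)).symm
  by_contra hk
  exact b.pow_ne_one k (by omega) h1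

section Formal

open PowerSeries

variable {b} {τ A D : PowerSeries ℂ}

/-- The Baxter equation for formal power series in `w = exp u`. -/
def IsFormalSolution (b : BaxterData ι) (τ A D q : PowerSeries ℂ) : Prop :=
  τ * q = -(A * rescale b.σ⁻¹ q) + D * rescale b.σ q

/-- At the lowest order n the equation reads D(0) (σ^n - σ^(-n)) q_n = 0, because τ(0) = 0 and A(0)
= D(0); for n > 0 the bracket is nonzero as σ is not a root of unity. -/
theorem IsFormalSolution.eq_zero {q : PowerSeries ℂ} (hτ : coeff 0 τ = 0)
    (hAD : coeff 0 A = coeff 0 D) (hD : coeff 0 D ≠ 0)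
    (hq : b.IsFormalSolution τ A D q) (h0 : coeff 0 q = 0) : q = 0 := by
  have key : ∀ n, coeff n q = 0 := by
    intro n
    induction n using Nat.strong_induction_on with
    | _ n ih =>
      rcases Nat.eq_zero_or_pos n with rfl | hn
      · exact h0
      · have h1 := congrArg (coeff n) hq
        rw [map_add, map_neg, coeff_mul_of_forall_lt_eq_zero ih,
          coeff_mul_of_forall_lt_eq_zero (fun j hj => by rw [coeff_rescale, ih j hj, mul_zero]),
          coeff_mul_of_forall_lt_eq_zero (fun j hj => by rw [coeff_rescale, ih j hj, mul_zero]),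
          hτ, hAD, coeff_rescale, coeff_rescale] at h1
        have h2 : coeff 0 D * (b.σ ^ n - b.σ⁻¹ ^ n) * coeff n q = 0 := by
          linear_combination -h1
        rcases mul_eq_zero.1 h2 with h3 | h3
        · rcases mul_eq_zero.1 h3 with h4 | h4
          · exact absurd h4 hD
          · exact absurd (sub_eq_zero.1 h4) (b.pow_ne_inv_pow hn)
        · exact h3
  ext n
  simp [key n]

/-- The same coefficient D(0) (σ^n - σ^(-n)) can be inverted for n > 0, so the equation determines
q_n from the earlier coefficients; order 0 is automatic. -/
theorem exists_isFormalSolution (b : BaxterData ι) (hτ : coeff 0 τ = 0)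
    (hAD : coeff 0 A = coeff 0 D) (hD : coeff 0 D ≠ 0) :
    ∃ q, coeff 0 q = 1 ∧ b.IsFormalSolution τ A D q := by
  let G : ℕ → ℕ → ℂ := fun n j => (coeff 0 D * (b.σ ^ (n + 1) - b.σ⁻¹ ^ (n + 1)))⁻¹ *
    (coeff (n + 1 - j) τ + b.σ⁻¹ ^ j * coeff (n + 1 - j) A - b.σ ^ j * coeff (n + 1 - j) D)
  refine ⟨PowerSeries.mk (linearRecSolution G), by simp [linearRecSolution], ?_⟩
  unfold IsFormalSolution
  ext n
  rw [mul_comm τ, mul_comm A, mul_comm D, map_add, map_neg, coeff_mul, coeff_mul, coeff_mul]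
  simp only [Finset.Nat.sum_antidiagonal_eq_sum_range_succ_mk, coeff_rescale, coeff_mk]
  rcases n with _ | n
  · simp only [Finset.sum_range_one, pow_zero, Nat.sub_self, hτ, hAD]
    ring
  · rw [Finset.sum_range_succ, Finset.sum_range_succ _ (n + 1), Finset.sum_range_succ _ (n + 1)]
    simp only [Nat.sub_self, hτ, hAD]
    have h1 : linearRecSolution G (n + 1) * (coeff 0 D * (b.σ ^ (n + 1) - b.σ⁻¹ ^ (n + 1))) =
        ∑ j ∈ Finset.range (n + 1), (coeff (n + 1 - j) τ + b.σ⁻¹ ^ j * coeff (n + 1 - j) A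
          - b.σ ^ j * coeff (n + 1 - j) D) * linearRecSolution G j := by
      have hne : coeff 0 D * (b.σ ^ (n + 1) - b.σ⁻¹ ^ (n + 1)) ≠ 0 :=
        mul_ne_zero hD (sub_ne_zero.2 (b.pow_ne_inv_pow (by omega)))
      rw [linearRecSolution, ← Finset.sum_range (fun j => G n j * linearRecSolution G j),
        Finset.sum_mul]
      refine Finset.sum_congr rfl fun j _ => ?_
      rw [mul_right_comm, mul_comm (G n j), ← mul_assoc, mul_inv_cancel₀ hne, one_mul]
    have h2 : ∑ j ∈ Finset.range (n + 1), (coeff (n + 1 - j) τ + b.σ⁻¹ ^ j * coeff (n + 1 - j) A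
          - b.σ ^ j * coeff (n + 1 - j) D) * linearRecSolution G j =
        ∑ j ∈ Finset.range (n + 1), linearRecSolution G j * coeff (n + 1 - j) τ
        + ∑ j ∈ Finset.range (n + 1), b.σ⁻¹ ^ j * linearRecSolution G j * coeff (n + 1 - j) A
        - ∑ j ∈ Finset.range (n + 1), b.σ ^ j * linearRecSolution G j * coeff (n + 1 - j) D := by
      rw [← Finset.sum_add_distrib, ← Finset.sum_sub_distrib]
      exact Finset.sum_congr rfl fun j _ => by ring
    linear_combination -h1 - h2

/-- The discrete Wronskian of `q(w)` and `q(-w)`, between `w` and `σ^j w`. -/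
noncomputable def wronskian (b : BaxterData ι) (q : PowerSeries ℂ) (j : ℕ) : PowerSeries ℂ :=
  rescale (b.σ ^ j) q * rescale (-1) q - (-1) ^ j * (rescale (b.σ ^ j) (rescale (-1) q) * q)

theorem wronskian_zero (q : PowerSeries ℂ) : b.wronskian q 0 = 0 := by
  simp [wronskian, rescale_one]
  ring

theorem IsFormalSolution.rescale_neg {q : PowerSeries ℂ} (hq : b.IsFormalSolution τ A D q)
    (hτ : rescale (-1) τ = -τ) (hA : rescale (-1) A = A) (hD : rescale (-1) D = D) :
    -τ * rescale (-1) q =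
      -(A * rescale b.σ⁻¹ (rescale (-1) q)) + D * rescale b.σ (rescale (-1) q) := by
  have h := congrArg (rescale (-1 : ℂ)) hq
  simp only [map_mul, map_add, map_neg, hτ, hA, hD] at h
  rw [rescale_rescale, rescale_rescale, mul_comm b.σ⁻¹, mul_comm b.σ] at h
  rw [rescale_rescale, rescale_rescale]
  linear_combination h

/-- The equations for q(w) and q(-w) are taken at σ^(j+1) w and combined. They carry τ and -τ, and
the factor (-1)^j in the Wronskian compensates this alternating sign. -/
theorem IsFormalSolution.wronskian_succ {q : PowerSeries ℂ} (hq : b.IsFormalSolution τ A D q)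
    (hτ : rescale (-1) τ = -τ) (hA : rescale (-1) A = A) (hD : rescale (-1) D = D) (j : ℕ) :
    rescale (b.σ ^ (j + 1)) D * b.wronskian q (j + 2) =
      rescale (b.σ ^ (j + 1)) τ * b.wronskian q (j + 1)
        + rescale (b.σ ^ (j + 1)) A * b.wronskian q j := by
  have hp := hq.rescale_neg hτ hA hD
  have hσ := b.σ_ne_zero
  have e1 : b.σ⁻¹ * b.σ ^ (j + 1) = b.σ ^ j := by
    rw [pow_succ', inv_mul_cancel_left₀ hσ]
  have e2 : b.σ * b.σ ^ (j + 1) = b.σ ^ (j + 2) := by ring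
  have h1 := congrArg (rescale (b.σ ^ (j + 1))) hq
  have h2 := congrArg (rescale (b.σ ^ (j + 1))) hp
  simp only [map_mul, map_add, map_neg] at h1 h2
  rw [rescale_rescale, rescale_rescale, e1, e2] at h1
  rw [rescale_rescale q, rescale_rescale (rescale (-1) q),
    rescale_rescale (rescale (-1) q)] at h2
  simp only [e1, e2] at h2
  simp only [wronskian, rescale_rescale] at h1 h2 ⊢
  linear_combination (-(rescale (-1) q)) * h1 + (-1) ^ j * q * h2

/-- Multiplying the equation for q by q(-w), the one for q(-w) by q, and adding cancels the τ-terms,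
which leaves a first-order equation free of τ. -/
theorem IsFormalSolution.wronskian_one {q : PowerSeries ℂ} (hq : b.IsFormalSolution τ A D q)
    (hτ : rescale (-1) τ = -τ) (hA : rescale (-1) A = A) (hD : rescale (-1) D = D) :
    D * b.wronskian q 1 = A * rescale b.σ⁻¹ (b.wronskian q 1) := by
  have hp := hq.rescale_neg hτ hA hD
  have hσ := b.σ_ne_zero
  unfold IsFormalSolution at hq
  have e : rescale b.σ⁻¹ (b.wronskian q 1) =
      q * rescale b.σ⁻¹ (rescale (-1) q) + rescale (-1) q * rescale b.σ⁻¹ q := by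
    simp only [wronskian, map_sub, map_mul, rescale_rescale, pow_one, map_neg, map_one]
    rw [mul_assoc, mul_comm b.σ, ← mul_assoc]
    simp only [inv_mul_cancel₀ hσ, rescale_one, mul_one, neg_one_mul,
      RingHom.id_apply]
    ring
  rw [e, wronskian, pow_one, pow_one]
  linear_combination (-(rescale (-1) q)) * hq - q * hp

/-- The difference V of two solutions satisfies D(0) (1 - σ^(-n)) V_n = 0 at its lowest order n, so
the constant term fixes the solution. -/
theorem eq_of_wronskian_equation {W W' : PowerSeries ℂ} (hAD : coeff 0 A = coeff 0 D)
    (hD : coeff 0 D ≠ 0) (hW : D * W = A * rescale b.σ⁻¹ W)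
    (hW' : D * W' = A * rescale b.σ⁻¹ W') (h0 : coeff 0 W = coeff 0 W') : W = W' := by
  rw [← sub_eq_zero]
  have hV : D * (W - W') = A * rescale b.σ⁻¹ (W - W') := by
    rw [map_sub, mul_sub, mul_sub, hW, hW']
  have hV0 : coeff 0 (W - W') = 0 := by rw [map_sub, h0, sub_self]
  generalize W - W' = V at hV hV0
  have key : ∀ n, coeff n V = 0 := by
    intro n
    induction n using Nat.strong_induction_on with
    | _ n ih =>
      rcases Nat.eq_zero_or_pos n with rfl | hn
      · exact hV0
      · have h1 := congrArg (coeff n) hV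
        rw [coeff_mul_of_forall_lt_eq_zero ih,
          coeff_mul_of_forall_lt_eq_zero (fun j hj => by rw [coeff_rescale, ih j hj, mul_zero]),
          hAD, coeff_rescale] at h1
        have h2 : coeff 0 D * (1 - b.σ⁻¹ ^ n) * coeff n V = 0 := by
          linear_combination h1
        rcases mul_eq_zero.1 h2 with h3 | h3
        · rcases mul_eq_zero.1 h3 with h4 | h4
          · exact absurd h4 hD
          · rw [inv_pow, sub_eq_zero, eq_comm, inv_eq_one] at h4
            exact absurd h4 (b.pow_ne_one n hn)
        · exact h3
  ext n
  simp [key n]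

/-- If the Wronskians with odd shifts have no terms of degree above `2 M`, then neither has the
solution above degree `M`. -/
theorem coeff_eq_zero_of_wronskian {q : PowerSeries ℂ} {M : ℕ}
    (h : ∀ i k, M < k → coeff (2 * k) (b.wronskian q (2 * i + 1)) = 0) {k : ℕ} (hk : M < k) :
    coeff k q = 0 := by
  have h1 : ∀ i : ℕ, ∑ l ∈ Finset.range (2 * k + 1),
      (b.σ ^ 2) ^ (l * i) * (b.σ ^ l * (-1) ^ l * coeff l q * coeff (2 * k - l) q) = 0 := by
    intro i
    have h2 := h i k hk
    rw [wronskian, map_sub, Odd.neg_one_pow (by simp : Odd (2 * i + 1)), neg_one_mul, map_neg,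
      coeff_mul, coeff_mul, Finset.Nat.sum_antidiagonal_eq_sum_range_succ_mk,
      Finset.Nat.sum_antidiagonal_eq_sum_range_succ_mk, sub_neg_eq_add,
      ← Finset.sum_add_distrib] at h2
    have h3 : ∑ l ∈ Finset.range (2 * k + 1),
      (b.σ ^ 2) ^ (l * i) * (b.σ ^ l * (-1) ^ l * coeff l q * coeff (2 * k - l) q) * 2 = 0 := by
      rw [← h2]
      refine Finset.sum_congr rfl fun l hl => ?_
      have hl : l ≤ 2 * k := by simpa [Nat.lt_succ_iff] using hl
      have hs : (-1 : ℂ) ^ (2 * k - l) = (-1) ^ l := by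
        have : (-1 : ℂ) ^ (2 * k - l) * (-1) ^ l = 1 := by
          rw [← pow_add, Nat.sub_add_cancel hl, pow_mul]; simp
        have h4 : (-1 : ℂ) ^ l * (-1) ^ l = 1 := by
          rw [← mul_pow]; simp
        exact mul_right_cancel₀ (pow_ne_zero l (by norm_num : (-1 : ℂ) ≠ 0)) (this.trans h4.symm)
      simp only [coeff_rescale, hs]
      ring
    rw [← Finset.sum_mul] at h3
    simpa using h3
  -- The vanishing for all i is a Vandermonde system with the distinct nodes σ^(2l), so each summand
  -- vanishes separately.
  have h2 : (fun l : Fin (2 * k + 1) =>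
      b.σ ^ (l : ℕ) * (-1) ^ (l : ℕ) * coeff (l : ℕ) q * coeff (2 * k - l) q) = 0 := by
    apply Matrix.eq_zero_of_forall_pow_sum_mul_pow_eq_zero (f := fun l => (b.σ ^ 2) ^ (l : ℕ))
    · intro l l' hl
      simp only [← pow_mul] at hl
      have := b.pow_injective hl
      ext; omega
    · intro i
      have := h1 i
      rw [Finset.sum_range] at this
      rw [← this]
      refine Finset.sum_congr rfl fun l _ => ?_
      rw [← pow_mul]
      ring
  -- The middle summand l = k is a nonzero multiple of the square of the k-th coefficient.
  have h3 := congrFun h2 ⟨k, by omega⟩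
  have h4 : 2 * k - k = k := by omega
  simp only [Pi.zero_apply, h4] at h3
  have hσ := b.σ_ne_zero
  simpa [hσ] using h3

end Formal

end BaxterData

end XXZ

/-! ### Polynomial solutions of the Baxter equation -/

namespace XXZ

open Polynomial

/-- The polynomial `p (s w)`. -/
noncomputable def dilate (s : ℂ) (p : ℂ[X]) : ℂ[X] := p.comp (C s * X)

theorem coe_dilate (s : ℂ) (p : ℂ[X]) :
    ((dilate s p : ℂ[X]) : PowerSeries ℂ) = PowerSeries.rescale s (p : PowerSeries ℂ) := by
  ext n
  rw [coeff_coe, PowerSeries.coeff_rescale, coeff_coe, dilate, comp_C_mul_X_coeff, mul_comm]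

theorem eval_dilate (s x : ℂ) (p : ℂ[X]) : (dilate s p).eval x = p.eval (s * x) := by
  simp [dilate, eval_comp]

theorem natDegree_dilate {s : ℂ} (hs : s ≠ 0) (p : ℂ[X]) :
    (dilate s p).natDegree = p.natDegree := by
  rw [dilate, natDegree_comp, natDegree_C_mul_X s hs, mul_one]

theorem dilate_mul (s : ℂ) (p r : ℂ[X]) : dilate s (p * r) = dilate s p * dilate s r := mul_comp ..

/-- A downward three-term recursion which starts from zero vanishes. -/
theorem eq_zero_of_recursion_down {T A D E : ℕ → ℂ} {m : ℕ} (hA : A m = 0)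
    (hD : ∀ k, 1 ≤ k → k ≤ m → D k ≠ 0)
    (hE : ∀ k, k + 1 ≤ m → D (k + 1) * E k = T (k + 1) * E (k + 1) + A (k + 1) * E (k + 2))
    (h0 : E m = 0) : ∀ k ≤ m, E k = 0 := by
  have key : ∀ j k, k ≤ m → m ≤ k + j → E k = 0 := by
    intro j
    induction j using Nat.strong_induction_on with
    | _ j ih =>
      intro k hk hkj
      rcases Nat.eq_or_lt_of_le hk with rfl | hk'
      · exact h0
      · have h1 : E (k + 1) = 0 := ih (m - (k + 1)) (by omega) _ (by omega) (by omega)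
        -- For k + 1 = m the value E (m + 1) lies outside the string, but its coefficient A m is
        -- zero.
        have h2 : A (k + 1) * E (k + 2) = 0 := by
          rcases Nat.eq_or_lt_of_le (show k + 1 ≤ m by omega) with h | h
          · rw [h, hA, zero_mul]
          · rw [ih (m - (k + 2)) (by omega) _ (by omega) (by omega), mul_zero]
        have h3 := hE k hk'
        rw [h1, h2, mul_zero, add_zero] at h3
        exact (mul_eq_zero.1 h3).resolve_left (hD _ (by omega) hk')
  exact fun k hk => key m k hk (by omega)

/-- The recursion for k ≥ 1 has a one-dimensional solution space, parametrized by the value at the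
bottom m. Hence z is proportional to the kernel vector g, and inherits from g the one remaining
equation, at 0. Nonvanishing of g 0 forces g m ≠ 0. -/
theorem recursion_at_zero_of_kernel {T A D g z : ℕ → ℂ} {m : ℕ} (hA : A m = 0) (hD0 : D 0 = 0)
    (hD : ∀ k, 1 ≤ k → k ≤ m → D k ≠ 0) (hg0 : g 0 ≠ 0)
    (hg : ∀ k ≤ m, T k * g k = -(A k * g (k + 1)) + D k * g (k - 1))
    (hz : ∀ k, k + 1 ≤ m → D (k + 1) * z k = T (k + 1) * z (k + 1) + A (k + 1) * z (k + 2)) :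
    T 0 * z 0 + A 0 * z 1 = 0 := by
  have hg' : ∀ k, k + 1 ≤ m →
      D (k + 1) * g k = T (k + 1) * g (k + 1) + A (k + 1) * g (k + 2) := by
    intro k hk
    have := hg (k + 1) hk
    rw [Nat.add_sub_cancel] at this
    linear_combination -this
  have hgm : g m ≠ 0 := fun h => hg0 (eq_zero_of_recursion_down hA hD hg' h 0 (Nat.zero_le _))
  have hE := eq_zero_of_recursion_down (E := fun k => z k * g m - z m * g k) (T := T) hA hD
    (fun k hk => by linear_combination g m * hz k hk - z m * hg' k hk) (by ring)
  have h0 : z 0 * g m - z m * g 0 = 0 := hE 0 (Nat.zero_le _)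
  have h1 : A 0 * (z 1 * g m - z m * g 1) = 0 := by
    rcases Nat.eq_zero_or_pos m with rfl | hm
    · rw [hA, zero_mul]
    · rw [hE 1 hm, mul_zero]
  have h2 := hg 0 (Nat.zero_le _)
  rw [hD0, zero_mul] at h2
  have h3 : (T 0 * z 0 + A 0 * z 1) * g m = 0 := by
    linear_combination T 0 * h0 + h1 + z m * h2
  exact (mul_eq_zero.1 h3).resolve_right hgm

theorem sub_mul_add_dvd {F : ℂ[X]} {v : ℂ} (hv : v ≠ 0) (h1 : F.eval v = 0)
    (h2 : F.eval (-v) = 0) : X ^ 2 - C (v ^ 2) ∣ F := by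
  have e : (X ^ 2 - C (v ^ 2) : ℂ[X]) = (X - C v) * (X - C (-v)) := by
    rw [C_neg, C_pow]; ring
  rw [e]
  refine IsCoprime.mul_dvd ?_ (dvd_iff_isRoot.2 h1) (dvd_iff_isRoot.2 h2)
  apply isCoprime_X_sub_C_of_isUnit_sub
  rw [sub_neg_eq_add, ← two_mul]
  exact (mul_ne_zero two_ne_zero hv).isUnit

namespace BaxterData

variable {ι : Type*} [Fintype ι] (b : BaxterData ι)

/-- The number `N_s` of steps of all strings. -/
def M : ℕ := ∑ n, b.m n

/-- The polynomial form of `a`. -/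
noncomputable def polyA : ℂ[X] :=
  C (b.σ ^ b.M) * ∏ n, (X ^ 2 - C (b.δ n * (b.σ⁻¹ ^ 2) ^ b.m n))

/-- The polynomial form of `d`. -/
noncomputable def polyD : ℂ[X] := C (b.σ⁻¹ ^ b.M) * ∏ n, (X ^ 2 - C (b.δ n))

/-- The Baxter equation for polynomials in `w = exp u`. -/
def IsSolution (τ q : ℂ[X]) : Prop :=
  τ * q = -(b.polyA * dilate b.σ⁻¹ q) + b.polyD * dilate b.σ q

/-- Up to a factor, the discrete Wronskian. -/
noncomputable def polyW : ℂ[X] :=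
  ∏ n, ∏ k ∈ Finset.range (b.m n), (X ^ 2 - C (b.δ n * (b.σ⁻¹ ^ 2) ^ (k + 1)))

omit [Fintype ι] in
theorem inv_sq_pow_injective : Function.Injective fun k : ℕ => (b.σ⁻¹ ^ 2) ^ k := by
  intro i j h
  simp only [← pow_mul, inv_pow, inv_inj] at h
  have := b.pow_injective h
  omega

variable {b} in
theorem IsSolution.isFormalSolution {τ q : ℂ[X]} (h : b.IsSolution τ q) :
    b.IsFormalSolution (τ : PowerSeries ℂ) b.polyA b.polyD q := by
  have := congrArg (fun p : ℂ[X] => (p : PowerSeries ℂ)) h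
  unfold IsFormalSolution
  simpa [coe_dilate] using this

/-- Dilating by 1/σ moves each string up by one step. At each site the factors telescope:
multiplying by the top factor on one side, or by the bottom factor on the other, gives the product
over the whole string. -/
theorem polyW_equation : b.polyD * b.polyW = b.polyA * dilate b.σ⁻¹ b.polyW := by
  have hσ := b.σ_ne_zero
  have e : dilate b.σ⁻¹ b.polyW = C ((b.σ⁻¹ ^ 2) ^ b.M) *
      ∏ n, ∏ k ∈ Finset.range (b.m n), (X ^ 2 - C (b.δ n * (b.σ⁻¹ ^ 2) ^ k)) := by
    rw [M, ← Finset.prod_pow_eq_pow_sum, map_prod, ← Finset.prod_mul_distrib, dilate, polyW,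
      prod_comp]
    refine Finset.prod_congr rfl fun n _ => ?_
    rw [prod_comp, ← Finset.card_range (b.m n), ← Finset.prod_const, map_prod,
      Finset.card_range, ← Finset.prod_mul_distrib]
    refine Finset.prod_congr rfl fun k _ => ?_
    rw [sub_comp, X_pow_comp, C_comp, pow_succ _ k, ← mul_assoc, C_mul, mul_pow, ← C_pow]
    ring
  have c1 : b.σ ^ b.M * (b.σ⁻¹ ^ 2) ^ b.M = b.σ⁻¹ ^ b.M := by
    rw [← mul_pow, pow_two, mul_inv_cancel_left₀ hσ]
  rw [e, polyD, polyA, polyW, mul_mul_mul_comm, ← C_mul, c1, mul_assoc,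
    ← Finset.prod_mul_distrib, ← Finset.prod_mul_distrib]
  congr 1
  refine Finset.prod_congr rfl fun n _ => ?_
  rw [mul_comm, mul_comm (X ^ 2 - C (b.δ n * (b.σ⁻¹ ^ 2) ^ b.m n)), ← Finset.prod_range_succ,
    Finset.prod_range_succ', pow_zero, mul_one]

theorem coeff_zero_polyD : b.polyD.coeff 0 ≠ 0 := by
  rw [coeff_zero_eq_eval_zero, polyD, eval_mul, eval_C, eval_prod]
  refine mul_ne_zero (pow_ne_zero _ (inv_ne_zero b.σ_ne_zero)) (Finset.prod_ne_zero_iff.2 ?_)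
  intro n _
  simpa using b.δ_ne_zero n

theorem coeff_zero_polyA : b.polyA.coeff 0 = b.polyD.coeff 0 := by
  have h := congrArg (fun p : ℂ[X] => p.coeff 0) b.polyW_equation
  simp only [mul_coeff_zero, dilate, comp_C_mul_X_coeff, pow_zero, mul_one] at h
  refine (mul_right_cancel₀ ?_ h).symm
  rw [coeff_zero_eq_eval_zero, polyW, eval_prod]
  refine Finset.prod_ne_zero_iff.2 fun n _ => ?_
  rw [eval_prod]
  refine Finset.prod_ne_zero_iff.2 fun k _ => ?_
  simpa using ⟨b.δ_ne_zero n, b.σ_ne_zero⟩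

theorem dilate_neg_polyA : dilate (-1) b.polyA = b.polyA := by
  simp [dilate, polyA, mul_comp, prod_comp]

theorem dilate_neg_polyD : dilate (-1) b.polyD = b.polyD := by
  simp [dilate, polyD, mul_comp, prod_comp]

theorem monic_prod_sq_sub (c : ι → ℂ) : (∏ n, (X ^ 2 - C (c n)) : ℂ[X]).Monic :=
  monic_prod_of_monic _ _ fun _ _ => monic_X_pow_sub_C _ two_ne_zero

theorem natDegree_prod_sq_sub (c : ι → ℂ) :
    (∏ n, (X ^ 2 - C (c n)) : ℂ[X]).natDegree = 2 * Fintype.card ι := by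
  rw [natDegree_prod_of_monic _ _ fun n _ => monic_X_pow_sub_C _ two_ne_zero]
  simp [mul_comm]

theorem natDegree_polyA : b.polyA.natDegree = 2 * Fintype.card ι := by
  rw [polyA, natDegree_C_mul (pow_ne_zero _ b.σ_ne_zero), natDegree_prod_sq_sub]

theorem natDegree_polyD : b.polyD.natDegree = 2 * Fintype.card ι := by
  rw [polyD, natDegree_C_mul (pow_ne_zero _ (inv_ne_zero b.σ_ne_zero)), natDegree_prod_sq_sub]

theorem leadingCoeff_polyA : b.polyA.leadingCoeff = b.σ ^ b.M := by
  rw [polyA, leadingCoeff_mul, (monic_prod_sq_sub _).leadingCoeff, leadingCoeff_C, mul_one]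

theorem leadingCoeff_polyD : b.polyD.leadingCoeff = b.σ⁻¹ ^ b.M := by
  rw [polyD, leadingCoeff_mul, (monic_prod_sq_sub _).leadingCoeff, leadingCoeff_C, mul_one]

variable {b} in
/-- The degree of a solution of the Baxter equation is the total number of steps. -/
theorem IsSolution.natDegree_eq {τ q : ℂ[X]} (hτ : τ.degree < (2 * Fintype.card ι : ℕ))
    (h : b.IsSolution τ q) (hq : q ≠ 0) : q.natDegree = b.M := by
  have hσ := b.σ_ne_zero
  have hl : ∀ s : ℂ, (dilate s q).coeff q.natDegree = s ^ q.natDegree * q.leadingCoeff := by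
    intro s
    rw [dilate, comp_C_mul_X_coeff, mul_comm]; rfl
  have h1 := congrArg (fun p : ℂ[X] => p.coeff (2 * Fintype.card ι + q.natDegree)) h
  simp only [coeff_add, coeff_neg] at h1
  have e1 : (τ * q).coeff (2 * Fintype.card ι + q.natDegree) = 0 := by
    apply coeff_eq_zero_of_degree_lt
    rcases eq_or_ne τ 0 with rfl | h0
    · rw [zero_mul, degree_zero]; exact WithBot.bot_lt_coe _
    · rw [degree_eq_natDegree (mul_ne_zero h0 hq), natDegree_mul h0 hq]
      rw [degree_eq_natDegree h0] at hτ
      have := Nat.cast_lt.1 hτ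
      exact_mod_cast Nat.add_lt_add_right this _
  have e2 := coeff_mul_add_eq_of_natDegree_le (df := 2 * Fintype.card ι) (dg := q.natDegree)
    b.natDegree_polyA.le (natDegree_dilate (inv_ne_zero hσ) q).le
  have e3 := coeff_mul_add_eq_of_natDegree_le (df := 2 * Fintype.card ι) (dg := q.natDegree)
    b.natDegree_polyD.le (natDegree_dilate hσ q).le
  rw [e1, e2, e3, hl, hl, ← b.natDegree_polyA, coeff_natDegree, b.natDegree_polyA,
    ← b.natDegree_polyD, coeff_natDegree, leadingCoeff_polyA, leadingCoeff_polyD] at h1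
  -- The left side of the equation has no term in the top degree, so the two top coefficients on the
  -- right must cancel; this forces σ^(2M) = σ^(2 deg q).
  have h2 : b.σ ^ b.M * b.σ⁻¹ ^ q.natDegree = b.σ⁻¹ ^ b.M * b.σ ^ q.natDegree := by
    refine mul_right_cancel₀ (leadingCoeff_ne_zero.2 hq) ?_
    linear_combination h1
  have h3 : b.σ ^ (2 * b.M) = b.σ ^ (2 * q.natDegree) := by
    rw [inv_pow, inv_pow] at h2
    field_simp at h2
    rw [pow_mul', pow_mul', pow_two, pow_two, ← pow_two, ← pow_two, h2]
  have := b.pow_injective h3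
  omega

/-- The polynomial Wronskian between `w` and `σ w`. -/
noncomputable def wronskianOne (q : ℂ[X]) : ℂ[X] :=
  dilate b.σ q * dilate (-1) q + dilate b.σ (dilate (-1) q) * q

/-- Both sides solve the first-order equation of `polyW_equation`, so matching constant terms
suffices. The relation for c is recorded because it gives c ≠ 0 as soon as q(0) ≠ 0. -/
theorem wronskian_one_eq {τ q : PowerSeries ℂ} (hq : b.IsFormalSolution τ b.polyA b.polyD q)
    (hτ : PowerSeries.rescale (-1) τ = -τ) :
    ∃ c : ℂ, c * b.polyW.coeff 0 = 2 * (PowerSeries.coeff 0 q) ^ 2 ∧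
      b.wronskian q 1 = ((C c * b.polyW : ℂ[X]) : PowerSeries ℂ) := by
  have hW0 : b.polyW.coeff 0 ≠ 0 := by
    rw [coeff_zero_eq_eval_zero, polyW, eval_prod]
    refine Finset.prod_ne_zero_iff.2 fun n _ => ?_
    rw [eval_prod]
    refine Finset.prod_ne_zero_iff.2 fun k _ => ?_
    simpa using ⟨b.δ_ne_zero n, b.σ_ne_zero⟩
  refine ⟨2 * (PowerSeries.coeff 0 q) ^ 2 / b.polyW.coeff 0, by field_simp, ?_⟩
  have hA : PowerSeries.rescale (-1) (b.polyA : PowerSeries ℂ) = b.polyA := by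
    rw [← coe_dilate, dilate_neg_polyA]
  have hD : PowerSeries.rescale (-1) (b.polyD : PowerSeries ℂ) = b.polyD := by
    rw [← coe_dilate, dilate_neg_polyD]
  refine eq_of_wronskian_equation (b := b) (A := b.polyA) (D := b.polyD) ?_ ?_
    (hq.wronskian_one hτ hA hD) ?_ ?_
  · rw [coeff_coe, coeff_coe, coeff_zero_polyA]
  · rw [coeff_coe]; exact b.coeff_zero_polyD
  · rw [← coe_dilate, ← coe_mul, ← coe_mul, dilate_mul]
    have : dilate b.σ⁻¹ (C (2 * (PowerSeries.coeff 0 q) ^ 2 / b.polyW.coeff 0)) =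
      C (2 * (PowerSeries.coeff 0 q) ^ 2 / b.polyW.coeff 0) := by simp [dilate]
    rw [this, mul_left_comm, polyW_equation, mul_left_comm]
  · rw [coeff_coe, coeff_C_mul, div_mul_cancel₀ _ hW0]
    have hr : ∀ (s : ℂ) (f : PowerSeries ℂ), PowerSeries.constantCoeff (PowerSeries.rescale s f) =
        PowerSeries.constantCoeff f := by
      intro s f
      rw [← PowerSeries.coeff_zero_eq_constantCoeff_apply, PowerSeries.coeff_rescale]
      simp
    simp only [wronskian, map_sub, PowerSeries.coeff_zero_eq_constantCoeff_apply, map_mul, pow_one,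
      map_neg, map_one, hr]
    ring

variable {b} in
/-- A nonzero solution and its reflection do not vanish together at the top of a string. -/
theorem IsSolution.not_both_zero {τ q : ℂ[X]} (h : b.IsSolution τ q) (hτ : dilate (-1) τ = -τ)
    (h0 : q.coeff 0 ≠ 0) {n : ι} {w : ℂ} (hw : w ^ 2 = b.δ n) (h1 : q.eval w = 0)
    (h2 : q.eval (-w) = 0) : False := by
  obtain ⟨c, hc, hW⟩ := b.wronskian_one_eq h.isFormalSolution
    (by rw [← coe_dilate, hτ, coe_neg])
  have e : b.wronskian q 1 = (b.wronskianOne q : ℂ[X]) := by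
    simp only [wronskian, wronskianOne, coe_add, coe_mul, coe_dilate, pow_one]
    ring
  rw [e, coe_inj] at hW
  have h3 := congrArg (fun p : ℂ[X] => p.eval w) hW
  simp only [wronskianOne, eval_add, eval_mul, eval_dilate, eval_C, neg_one_mul, h1, h2, mul_zero,
    add_zero] at h3
  rw [coeff_coe] at hc
  have hc0 : c ≠ 0 := by
    rintro rfl
    rw [zero_mul] at hc
    exact mul_ne_zero two_ne_zero (pow_ne_zero 2 h0) hc.symm
  have h4 := (mul_eq_zero.1 h3.symm).resolve_left hc0
  rw [polyW, eval_prod, Finset.prod_eq_zero_iff] at h4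
  obtain ⟨n', -, h5⟩ := h4
  rw [eval_prod, Finset.prod_eq_zero_iff] at h5
  obtain ⟨k, hk, h6⟩ := h5
  rw [Finset.mem_range] at hk
  simp only [eval_sub, eval_pow, eval_X, eval_C, hw, sub_eq_zero] at h6
  -- The zeros of `polyW` start one step below the tops, so a top of a string would coincide with a
  -- lower point of its own string or with a point of another one.
  by_cases hn : n = n'
  · subst hn
    have h7 : (b.σ⁻¹ ^ 2) ^ 0 = (b.σ⁻¹ ^ 2) ^ (k + 1) := by
      refine mul_left_cancel₀ (b.δ_ne_zero n) ?_
      rw [pow_zero, mul_one]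
      exact h6
    have := b.inv_sq_pow_injective h7
    omega
  · exact b.strings_disjoint n n' hn 0 (Nat.zero_le _) (k + 1) hk (by rw [pow_zero, mul_one, h6])

/-- For each site, the values of `τ` on the string (with either sign of the square root) admit a
nonzero solution of the discrete Baxter equation. -/
def HasKernels (τ : ℂ[X]) : Prop :=
  ∀ n w, w ^ 2 = b.δ n → ∃ g : ℕ → ℂ, g 0 ≠ 0 ∧ ∀ k ≤ b.m n,
    τ.eval (w * b.σ⁻¹ ^ k) * g k = -(b.polyA.eval (w * b.σ⁻¹ ^ k) * g (k + 1))
      + b.polyD.eval (w * b.σ⁻¹ ^ k) * g (k - 1)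

omit [Fintype ι] in
theorem sq_string (w : ℂ) {n : ι} (hw : w ^ 2 = b.δ n) (k : ℕ) :
    (w * b.σ⁻¹ ^ k) ^ 2 = b.δ n * (b.σ⁻¹ ^ 2) ^ k := by
  rw [mul_pow, hw, ← pow_mul, ← pow_mul, mul_comm k]

theorem eval_polyA_bottom {n : ι} {w : ℂ} (hw : w ^ 2 = b.δ n) :
    b.polyA.eval (w * b.σ⁻¹ ^ b.m n) = 0 := by
  rw [polyA, eval_mul, eval_prod, Finset.prod_eq_zero (Finset.mem_univ n), mul_zero]
  rw [eval_sub, eval_pow, eval_X, eval_C, sq_string _ _ hw, sub_self]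

theorem eval_polyD_top {n : ι} {w : ℂ} (hw : w ^ 2 = b.δ n) : b.polyD.eval w = 0 := by
  rw [polyD, eval_mul, eval_prod, Finset.prod_eq_zero (Finset.mem_univ n), mul_zero]
  rw [eval_sub, eval_pow, eval_X, eval_C, hw, sub_self]

theorem eval_polyD_ne_zero {n : ι} {w : ℂ} (hw : w ^ 2 = b.δ n) {k : ℕ} (hk : 1 ≤ k)
    (hkm : k ≤ b.m n) : b.polyD.eval (w * b.σ⁻¹ ^ k) ≠ 0 := by
  rw [polyD, eval_mul, eval_prod, eval_C]
  refine mul_ne_zero (pow_ne_zero _ (inv_ne_zero b.σ_ne_zero)) (Finset.prod_ne_zero_iff.2 ?_)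
  intro n' _
  rw [eval_sub, eval_pow, eval_X, eval_C, sq_string _ _ hw]
  intro h
  rw [sub_eq_zero] at h
  by_cases hn : n = n'
  · subst hn
    have h7 : (b.σ⁻¹ ^ 2) ^ k = (b.σ⁻¹ ^ 2) ^ 0 := by
      refine mul_left_cancel₀ (b.δ_ne_zero n) ?_
      rw [pow_zero, mul_one]
      exact h
    have := b.inv_sq_pow_injective h7
    omega
  · exact b.strings_disjoint n n' hn k hkm 0 (Nat.zero_le _) (by rw [pow_zero, mul_one, h])

theorem eval_polyW_eq_zero {n : ι} {w : ℂ} (hw : w ^ 2 = b.δ n) {k : ℕ} (hk : k + 1 ≤ b.m n) :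
    b.polyW.eval (w * b.σ⁻¹ ^ (k + 1)) = 0 := by
  rw [polyW, eval_prod, Finset.prod_eq_zero (Finset.mem_univ n)]
  rw [eval_prod, Finset.prod_eq_zero (Finset.mem_range.2 hk)]
  rw [eval_sub, eval_pow, eval_X, eval_C, sq_string _ _ hw, sub_self]

/-- The numerator in the recursion for the Wronskians vanishes at the zeros of the denominator. -/
theorem wronskian_numerator_eval {τ : ℂ[X]} (hK : b.HasKernels τ) {y : ℕ → ℂ[X]} {c : ℂ} {J : ℕ}
    (h0 : y 0 = 0) (h1 : y 1 = C c * b.polyW)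
    (hy : ∀ i, i + 2 ≤ J + 1 → dilate (b.σ ^ (i + 1)) b.polyD * y (i + 2) =
      dilate (b.σ ^ (i + 1)) τ * y (i + 1) + dilate (b.σ ^ (i + 1)) b.polyA * y i)
    {n : ι} {w : ℂ} (hw : w ^ 2 = b.δ n) :
    (dilate (b.σ ^ (J + 1)) τ * y (J + 1) + dilate (b.σ ^ (J + 1)) b.polyA * y J).eval
      (w * b.σ⁻¹ ^ (J + 1)) = 0 := by
  have hσ := b.σ_ne_zero
  obtain ⟨g, hg0, hg⟩ := hK n w hw
  have hs : ∀ i k, i + k = J + 1 → b.σ ^ i * (w * b.σ⁻¹ ^ (J + 1)) = w * b.σ⁻¹ ^ k := by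
    intro i k h
    rw [← h, pow_add, mul_left_comm, ← mul_assoc (b.σ ^ i), ← mul_pow, mul_inv_cancel₀ hσ,
      one_pow, one_mul]
  -- With the point fixed, lowering the Wronskian index by one moves the argument of the
  -- coefficients one step down the string. So the values z k obey the homogeneous discrete Baxter
  -- recursion, and its missing equation at 0 is the claim.
  have key := recursion_at_zero_of_kernel (m := b.m n) (g := g)
    (T := fun k => τ.eval (w * b.σ⁻¹ ^ k))
    (A := fun k => b.polyA.eval (w * b.σ⁻¹ ^ k)) (D := fun k => b.polyD.eval (w * b.σ⁻¹ ^ k))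
    (z := fun k => if k ≤ J + 1 then (y (J + 1 - k)).eval (w * b.σ⁻¹ ^ (J + 1)) else 0)
    (b.eval_polyA_bottom hw) (by simpa using b.eval_polyD_top hw)
    (fun k hk hkm => b.eval_polyD_ne_zero hw hk hkm) hg0 hg ?_
  · rw [eval_add, eval_mul, eval_mul, eval_dilate, eval_dilate, hs (J + 1) 0 rfl]
    simpa using key
  · intro k hk
    rcases lt_trichotomy k J with hkJ | rfl | hkJ
    · have h2 := congrArg (fun p : ℂ[X] => p.eval (w * b.σ⁻¹ ^ (J + 1)))
        (hy (J - 1 - k) (by omega))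
      simp only [eval_add, eval_mul, eval_dilate] at h2
      rw [hs _ (k + 1) (by omega)] at h2
      rw [if_pos (by omega), if_pos (by omega), if_pos (by omega)]
      have e1 : J + 1 - k = J - 1 - k + 2 := by omega
      have e2 : J + 1 - (k + 1) = J - 1 - k + 1 := by omega
      have e3 : J + 1 - (k + 2) = J - 1 - k := by omega
      rw [e1, e2, e3]
      exact h2
    -- At the end k = J of the list of Wronskians the equation would involve an index -1. It holds
    -- with 0 there, because y 0 = 0 and y 1 vanishes at string points below the top.
    · rw [if_pos (by omega), if_pos le_rfl, if_neg (by omega), Nat.sub_self,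
        Nat.add_sub_cancel_left, h0, h1, eval_mul, b.eval_polyW_eq_zero hw hk]
      simp
    · rw [if_neg (show ¬ k + 1 ≤ J + 1 by omega), if_neg (show ¬ k + 2 ≤ J + 1 by omega)]
      by_cases hkJ' : k = J + 1
      · subst hkJ'
        simp [h0]
      · rw [if_neg (by omega)]
        simp

/-- Up to units the dilated D is a product of the quadratics w² - v_n², v_n² = δ_n σ^(-2J). They are
pairwise coprime because the tops δ_n differ, and each divides F because F vanishes at both square
roots. -/
theorem dilate_polyD_dvd {F : ℂ[X]} {J : ℕ}
    (hF : ∀ n w, w ^ 2 = b.δ n → F.eval (w * b.σ⁻¹ ^ J) = 0) :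
    dilate (b.σ ^ J) b.polyD ∣ F := by
  have hσ := b.σ_ne_zero
  have hu : IsUnit (C (b.σ⁻¹ ^ b.M) : ℂ[X]) :=
    isUnit_C.2 (pow_ne_zero _ (inv_ne_zero hσ)).isUnit
  have e : dilate (b.σ ^ J) b.polyD = C (b.σ⁻¹ ^ b.M) *
      ∏ n, (C ((b.σ ^ J) ^ 2) * X ^ 2 - C (b.δ n)) := by
    simp [dilate, polyD, mul_comp, prod_comp, mul_pow]
  rw [e, hu.mul_left_dvd]
  refine Fintype.prod_dvd_of_coprime ?_ ?_
  · intro n n' hn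
    have hd : b.δ n' - b.δ n ≠ 0 := by
      rw [sub_ne_zero]
      have := b.strings_disjoint n' n (Ne.symm hn) 0 (Nat.zero_le _) 0 (Nat.zero_le _)
      simpa using this
    -- Bézout coefficients: the two quadratics differ by the nonzero constant δ_n' - δ_n.
    refine ⟨C (b.δ n' - b.δ n)⁻¹, -C (b.δ n' - b.δ n)⁻¹, ?_⟩
    have h1 : (C (b.δ n' - b.δ n)⁻¹ : ℂ[X]) * C (b.δ n' - b.δ n) = 1 := by
      rw [← C_mul, inv_mul_cancel₀ hd, C_1]
    rw [C_sub] at h1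
    linear_combination h1
  · intro n
    obtain ⟨w, hw⟩ := IsAlgClosed.exists_pow_nat_eq (b.δ n) (show 0 < 2 by norm_num)
    have hw0 : w ≠ 0 := by
      rintro rfl
      exact b.δ_ne_zero n (by rw [← hw]; simp)
    have hv : w * b.σ⁻¹ ^ J ≠ 0 := mul_ne_zero hw0 (pow_ne_zero _ (inv_ne_zero hσ))
    have h1 : X ^ 2 - C ((w * b.σ⁻¹ ^ J) ^ 2) ∣ F := by
      refine sub_mul_add_dvd hv (hF n w hw) ?_
      rw [← neg_mul]
      exact hF n (-w) (by rw [neg_sq, hw])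
    have hu2 : IsUnit (C ((b.σ ^ J) ^ 2) : ℂ[X]) :=
      isUnit_C.2 (pow_ne_zero _ (pow_ne_zero _ hσ)).isUnit
    have e2 : (C ((b.σ ^ J) ^ 2) * X ^ 2 - C (b.δ n) : ℂ[X]) =
        C ((b.σ ^ J) ^ 2) * (X ^ 2 - C ((w * b.σ⁻¹ ^ J) ^ 2)) := by
      rw [mul_sub, ← C_mul, ← mul_pow, mul_left_comm, ← mul_pow, mul_inv_cancel₀ hσ, one_pow,
        mul_one, hw]
    rw [e2, hu2.mul_left_dvd]
    exact h1

/-- The recursion in j keeps the degree: numerator degree at most 2 card ι + 2 M, denominator degree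
exactly 2 card ι. Divisibility at each step is supplied by the kernels; the start W_1 is a multiple
of `polyW`. -/
theorem exists_wronskian_polynomial {τ : ℂ[X]} (hK : b.HasKernels τ)
    (hτ : dilate (-1) τ = -τ) (hdeg : τ.natDegree ≤ 2 * Fintype.card ι) {q : PowerSeries ℂ}
    (hq : b.IsFormalSolution τ b.polyA b.polyD q) (J : ℕ) :
    ∃ y : ℂ[X], (y : PowerSeries ℂ) = b.wronskian q J ∧ y.natDegree ≤ 2 * b.M := by
  have hσ := b.σ_ne_zero
  have hτ' : PowerSeries.rescale (-1) (τ : PowerSeries ℂ) = -τ := by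
    rw [← coe_dilate, hτ, coe_neg]
  have hA : PowerSeries.rescale (-1) (b.polyA : PowerSeries ℂ) = b.polyA := by
    rw [← coe_dilate, dilate_neg_polyA]
  have hD : PowerSeries.rescale (-1) (b.polyD : PowerSeries ℂ) = b.polyD := by
    rw [← coe_dilate, dilate_neg_polyD]
  obtain ⟨c, -, hc⟩ := b.wronskian_one_eq hq hτ'
  induction J using Nat.strong_induction_on with
  | _ J ih =>
    match J with
    | 0 => exact ⟨0, by rw [wronskian_zero, coe_zero], by simp⟩
    | 1 =>
      refine ⟨C c * b.polyW, hc.symm, (natDegree_C_mul_le _ _).trans ?_⟩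
      rw [polyW, natDegree_prod_of_monic _ _ fun n _ => monic_prod_of_monic _ _ fun k _ =>
        monic_X_pow_sub_C _ two_ne_zero, M, Finset.mul_sum]
      refine Finset.sum_le_sum fun n _ => ?_
      rw [natDegree_prod_of_monic _ _ fun k _ => monic_X_pow_sub_C _ two_ne_zero]
      rw [Finset.sum_congr rfl fun k _ => natDegree_X_pow_sub_C]
      simp [mul_comm]
    | J + 2 =>
      choose! y hy hyd using ih
      have h0 : y 0 = 0 := by
        rw [← coe_inj, hy 0 (by omega), wronskian_zero, coe_zero]
      have h1 : y 1 = C c * b.polyW := by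
        rw [← coe_inj, hy 1 (by omega), hc]
      set F := dilate (b.σ ^ (J + 1)) τ * y (J + 1) + dilate (b.σ ^ (J + 1)) b.polyA * y J with hF
      have hdvd : dilate (b.σ ^ (J + 1)) b.polyD ∣ F := by
        refine b.dilate_polyD_dvd fun n w hw => ?_
        refine b.wronskian_numerator_eval hK h0 h1 (fun i hi => ?_) hw
        rw [← coe_inj]
        simp only [coe_mul, coe_add, coe_dilate]
        rw [hy _ (by omega), hy _ (by omega), hy _ (by omega)]
        exact hq.wronskian_succ hτ' hA hD i
      obtain ⟨Y, hY⟩ := hdvd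
      have hD0 : dilate (b.σ ^ (J + 1)) b.polyD ≠ 0 := by
        intro h
        have := congrArg (fun p : ℂ[X] => p.coeff 0) h
        simp only [dilate, comp_C_mul_X_coeff, pow_zero, mul_one, coeff_zero] at this
        exact b.coeff_zero_polyD this
      refine ⟨Y, ?_, ?_⟩
      · refine mul_left_cancel₀ (a := ((dilate (b.σ ^ (J + 1)) b.polyD : ℂ[X]) : PowerSeries ℂ))
          (by rwa [Ne, coe_eq_zero_iff]) ?_
        rw [← coe_mul, ← hY, hF]
        simp only [coe_mul, coe_add, coe_dilate]
        rw [hy _ (by omega), hy _ (by omega), hq.wronskian_succ hτ' hA hD J]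
      · rcases eq_or_ne Y 0 with rfl | hY0
        · simp
        have h2 : F.natDegree ≤ 2 * Fintype.card ι + 2 * b.M := by
          refine natDegree_add_le_of_degree_le ?_ ?_
          · refine natDegree_mul_le_of_le ?_ (hyd _ (by omega))
            rwa [natDegree_dilate (pow_ne_zero _ hσ)]
          · refine natDegree_mul_le_of_le ?_ (hyd _ (by omega))
            rw [natDegree_dilate (pow_ne_zero _ hσ), natDegree_polyA]
        rw [hY, natDegree_mul hD0 hY0, natDegree_dilate (pow_ne_zero _ hσ), natDegree_polyD] at h2
        omega

/-- Existence of a polynomial solution of the Baxter equation. -/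
theorem exists_isSolution {τ : ℂ[X]} (hK : b.HasKernels τ)
    (hτ : dilate (-1) τ = -τ) (hdeg : τ.natDegree ≤ 2 * Fintype.card ι) :
    ∃ q : ℂ[X], q.coeff 0 = 1 ∧ b.IsSolution τ q := by
  have hτ0 : τ.coeff 0 = 0 := by
    have := congrArg (fun p : ℂ[X] => p.coeff 0) hτ
    simp only [dilate, comp_C_mul_X_coeff, pow_zero, mul_one, coeff_neg] at this
    exact self_eq_neg.1 this
  obtain ⟨q, hq0, hq⟩ := exists_isFormalSolution (τ := (τ : PowerSeries ℂ))
    (A := (b.polyA : PowerSeries ℂ)) (D := (b.polyD : PowerSeries ℂ)) b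
    (by rw [coeff_coe, hτ0]) (by rw [coeff_coe, coeff_coe, coeff_zero_polyA])
    (by rw [coeff_coe]; exact b.coeff_zero_polyD)
  have hz : ∀ k, b.M < k → PowerSeries.coeff k q = 0 := fun k hk =>
    coeff_eq_zero_of_wronskian (M := b.M) (fun i k hk => by
      obtain ⟨y, hy, hyd⟩ := b.exists_wronskian_polynomial hK hτ hdeg hq (2 * i + 1)
      rw [← hy, coeff_coe]
      exact coeff_eq_zero_of_natDegree_lt (by omega)) hk
  have hqp : ((PowerSeries.trunc (b.M + 1) q : ℂ[X]) : PowerSeries ℂ) = q := by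
    ext k
    rw [coeff_coe, PowerSeries.coeff_trunc]
    split_ifs with h
    · rfl
    · exact (hz k (by omega)).symm
  refine ⟨PowerSeries.trunc (b.M + 1) q, by rw [← coeff_coe, hqp, hq0], ?_⟩
  unfold IsSolution
  rw [← coe_inj]
  simp only [coe_mul, coe_add, coe_neg, coe_dilate, hqp]
  exact hq

-- An odd τ has τ(0) = 0, so formal uniqueness applies: a solution without constant term is zero.
variable {b} in
theorem IsSolution.coeff_zero_ne_zero {τ q : ℂ[X]} (hτ : dilate (-1) τ = -τ)
    (h : b.IsSolution τ q) (hq : q ≠ 0) : q.coeff 0 ≠ 0 := by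
  have hτ0 : τ.coeff 0 = 0 := by
    have := congrArg (fun p : ℂ[X] => p.coeff 0) hτ
    simp only [dilate, comp_C_mul_X_coeff, pow_zero, mul_one, coeff_neg] at this
    exact self_eq_neg.1 this
  intro h0
  refine hq ?_
  rw [← coe_eq_zero_iff]
  exact h.isFormalSolution.eq_zero (by rw [coeff_coe, hτ0])
    (by rw [coeff_coe, coeff_coe, coeff_zero_polyA]) (by rw [coeff_coe]; exact b.coeff_zero_polyD)
    (by rw [coeff_coe, h0])

variable {b} in
/-- Monic solutions of the Baxter equation are unique. -/
theorem IsSolution.eq_of_monic {τ q q' : ℂ[X]} (hτ : dilate (-1) τ = -τ)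
    (h : b.IsSolution τ q) (h' : b.IsSolution τ q') (hq : q.Monic) (hq' : q'.Monic) : q = q' := by
  -- This combination is chosen to have zero constant term, hence it vanishes and the two monic
  -- solutions are proportional.
  have hs : b.IsSolution τ (C (q.coeff 0) * q' - C (q'.coeff 0) * q) := by
    unfold IsSolution at *
    simp only [dilate, sub_comp, mul_comp, C_comp] at *
    linear_combination C (q.coeff 0) * h' - C (q'.coeff 0) * h
  have h0 : C (q.coeff 0) * q' - C (q'.coeff 0) * q = 0 := by
    by_contra hne
    exact hs.coeff_zero_ne_zero hτ hne (by simp [mul_comm])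
  rw [sub_eq_zero] at h0
  have h1 := congrArg leadingCoeff h0
  rw [leadingCoeff_mul, leadingCoeff_mul, hq.leadingCoeff, hq'.leadingCoeff, leadingCoeff_C,
    leadingCoeff_C, mul_one, mul_one] at h1
  rw [h1] at h0
  refine (mul_left_cancel₀ ?_ h0).symm
  rw [Ne, C_eq_zero, ← h1]
  exact h.coeff_zero_ne_zero hτ hq.ne_zero

end BaxterData

end XXZ

/-! ### Exchange relations, quantum determinant and the Lax operator -/

namespace XXZ

section YangBaxter

variable {R : Type*} [Ring R] [Algebra ℂ R]

/-- Diagonal weights of the six-vertex `R`-matrix. -/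
noncomputable def sixVertexDiag (η z : ℂ) (i j : Fin 2) : ℂ :=
  if i = j then Complex.sinh (z + η) else Complex.sinh z

/-- Exchange weights of the six-vertex `R`-matrix. -/
noncomputable def sixVertexExch (η : ℂ) (i j : Fin 2) : ℂ := if i = j then 0 else Complex.sinh η

theorem sixVertexExch_comm (η : ℂ) (i j : Fin 2) : sixVertexExch η i j = sixVertexExch η j i := by
  simp [sixVertexExch, eq_comm]

/-- The exchange relation `R(u-v) X₁ Y₂ = Y₂ X₁ R(u-v)` for the six-vertex `R`-matrix,
`z = u - v`. -/
def RTT (η z : ℂ) (X Y : Matrix (Fin 2) (Fin 2) R) : Prop :=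
  ∀ a b c d, sixVertexDiag η z a b • (X a c * Y b d) + sixVertexExch η a b • (X b c * Y a d) =
    sixVertexDiag η z c d • (Y b d * X a c) + sixVertexExch η c d • (Y b c * X a d)

/-- The usual train argument: since factors at different sites commute, the R-matrix is moved first
through L, L' and then through M, M'. The swap of the summation indices e, f in between accounts for
the exchange weights. -/
theorem RTT.mul {η z : ℂ} {L L' M M' : Matrix (Fin 2) (Fin 2) R} (hL : RTT η z L L')
    (hM : RTT η z M M') (h1 : ∀ i j k l, Commute (M i j) (L' k l))
    (h2 : ∀ i j k l, Commute (L i j) (M' k l)) : RTT η z (L * M) (L' * M') := by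
  have e1 : ∀ a b c d, (L * M) a c * (L' * M') b d =
      ∑ e, ∑ f, (L a e * L' b f) * (M e c * M' f d) := by
    intro a b c d
    rw [Matrix.mul_apply, Matrix.mul_apply, Finset.sum_mul_sum]
    refine Finset.sum_congr rfl fun e _ => Finset.sum_congr rfl fun f _ => ?_
    rw [mul_assoc, ← mul_assoc (M e c), (h1 e c b f).eq]
    simp only [mul_assoc]
  have e2 : ∀ a b c d, (L' * M') b d * (L * M) a c =
      ∑ e, ∑ f, (L' b f * L a e) * (M' f d * M e c) := by
    intro a b c d
    rw [Matrix.mul_apply, Matrix.mul_apply, Finset.sum_mul_sum, Finset.sum_comm]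
    refine Finset.sum_congr rfl fun e _ => Finset.sum_congr rfl fun f _ => ?_
    rw [mul_assoc, ← mul_assoc (M' f d), ← (h2 a e f d).eq]
    simp only [mul_assoc]
  intro a b c d
  rw [e1, e1, e2, e2]
  simp only [Finset.smul_sum, ← Finset.sum_add_distrib]
  have s1 : ∀ e f, sixVertexDiag η z a b • (L a e * L' b f * (M e c * M' f d)) +
      sixVertexExch η a b • (L b e * L' a f * (M e c * M' f d)) =
      sixVertexDiag η z e f • (L' b f * L a e * (M e c * M' f d)) +
      sixVertexExch η e f • (L' b e * L a f * (M e c * M' f d)) := by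
    intro e f
    have := congrArg (· * (M e c * M' f d)) (hL a b e f)
    simpa only [add_mul, smul_mul_assoc] using this
  simp only [s1]
  simp only [Finset.sum_add_distrib]
  rw [Finset.sum_comm (f := fun e f => sixVertexExch η e f • (L' b e * L a f * (M e c * M' f d)))]
  simp only [← Finset.sum_add_distrib]
  refine Finset.sum_congr rfl fun e _ => Finset.sum_congr rfl fun f _ => ?_
  have := congrArg (L' b f * L a e * ·) (hM e f c d)
  simp only [mul_add, mul_smul_comm] at this
  rw [← this, sixVertexExch_comm η f e]

theorem RTT.one (η z : ℂ) : RTT η z (1 : Matrix (Fin 2) (Fin 2) R) 1 := by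
  intro a b c d
  fin_cases a <;> fin_cases b <;> fin_cases c <;> fin_cases d <;>
    simp [sixVertexDiag, sixVertexExch]

/-- The antisymmetric sign in the quantum determinant. -/
def detSign (b a : Fin 2) : ℂ := (!![0, -1; 1, 0] : Matrix (Fin 2) (Fin 2) ℂ) b a

/-- The quantum determinant relations, for `X = T(u + η)` and `Y = T(u)`. -/
def QDet (X Y : Matrix (Fin 2) (Fin 2) R) (δ : ℂ) : Prop :=
  ∀ b a, X b 1 * Y a 0 - X b 0 * Y a 1 = (detSign b a * δ) • (1 : R)

/-- Antisymmetrizing the column indices of the product first turns the M-factors into δ' times the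
antisymmetric symbol. This symbol antisymmetrizes the columns of the L-factors, to which their own
relation applies. -/
theorem QDet.mul {L L' M M' : Matrix (Fin 2) (Fin 2) R} {δ δ' : ℂ} (hL : QDet L L' δ)
    (hM : QDet M M' δ') (h1 : ∀ i j k l, Commute (M i j) (L' k l)) :
    QDet (L * M) (L' * M') (δ * δ') := by
  have e1 : ∀ a b c d, (L * M) a c * (L' * M') b d =
      ∑ e, ∑ f, (L a e * L' b f) * (M e c * M' f d) := by
    intro a b c d
    rw [Matrix.mul_apply, Matrix.mul_apply, Finset.sum_mul_sum]
    refine Finset.sum_congr rfl fun e _ => Finset.sum_congr rfl fun f _ => ?_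
    rw [mul_assoc, ← mul_assoc (M e c), (h1 e c b f).eq]
    simp only [mul_assoc]
  intro b a
  rw [e1, e1]
  simp only [← Finset.sum_sub_distrib, ← mul_sub]
  have h2 : ∀ e f, M e 1 * M' f 0 - M e 0 * M' f 1 = (detSign e f * δ') • (1 : R) := hM
  simp only [h2, Fin.sum_univ_two, mul_smul_comm, mul_one]
  have h3 := congrArg (δ' • ·) (hL b a)
  simp only [smul_sub, smul_smul] at h3
  simp only [detSign] at h3 ⊢
  simp only [Matrix.of_apply, Matrix.cons_val_zero, Matrix.cons_val_one, zero_mul, zero_smul,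
    one_mul, neg_mul, neg_smul, zero_add, add_zero, Matrix.cons_val'] at h3 ⊢
  rw [neg_add_eq_sub, h3]
  ring_nf

theorem QDet.one : QDet (1 : Matrix (Fin 2) (Fin 2) R) 1 1 := by
  intro b a
  fin_cases a <;> fin_cases b <;> simp [detSign, Matrix.one_apply]

end YangBaxter

namespace Chain

variable (c : Chain)

/-! ### Operators at a single site -/

theorem fSz_mul (n : Fin c.N) (f g : ℂ → ℂ) :
    c.fSz n f * c.fSz n g = c.fSz n fun z => f z * g z := by
  simp [fSz]

theorem fSz_add (n : Fin c.N) (f g : ℂ → ℂ) :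
    c.fSz n f + c.fSz n g = c.fSz n fun z => f z + g z := by
  simp [fSz, Matrix.diagonal_add]

theorem smul_fSz (n : Fin c.N) (r : ℂ) (f : ℂ → ℂ) :
    r • c.fSz n f = c.fSz n fun z => r * f z := by
  rw [fSz, fSz, ← Matrix.diagonal_smul]; rfl

theorem Sminus_mul_fSz (n : Fin c.N) (f : ℂ → ℂ) :
    c.Sminus n * c.fSz n f = c.fSz n (fun z => f (z + 1)) * c.Sminus n := by
  ext i k
  simp only [fSz, Matrix.mul_diagonal, Matrix.diagonal_mul, Sminus, Matrix.of_apply]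
  split_ifs with h
  · rw [h, mul_comm]
    congr 2
    push_cast
    ring
  · simp

theorem Splus_mul_fSz (n : Fin c.N) (f : ℂ → ℂ) :
    c.Splus n * c.fSz n f = c.fSz n (fun z => f (z - 1)) * c.Splus n := by
  ext i k
  simp only [fSz, Matrix.mul_diagonal, Matrix.diagonal_mul, Splus, Matrix.of_apply]
  split_ifs with h
  · rw [h, mul_comm]
    congr 2
    push_cast
    ring
  · simp

theorem sinh_sq_mul_x_sq (hη : Complex.sinh c.η ≠ 0) (n : Fin c.N) (k : ℕ) :
    Complex.sinh c.η * Complex.sinh c.η * (c.x n k * c.x n k) =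
      Complex.sinh (c.η * k) * Complex.sinh (c.η * (c.twoS n - k + 1)) := by
  have : c.x n k * c.x n k = c.qInt k * c.qInt (c.twoS n - k + 1) := by
    rw [x, ← pow_two, one_div]
    exact Complex.cpow_ofNat_inv_pow _ 2
  rw [this, qInt, qInt]
  field_simp

theorem Sminus_mul_Splus (hη : Complex.sinh c.η ≠ 0) (n : Fin c.N) :
    (Complex.sinh c.η * Complex.sinh c.η) • (c.Sminus n * c.Splus n) =
      c.fSz n fun z => Complex.sinh (c.η * (c.s n - z)) * Complex.sinh (c.η * (c.s n + z + 1)) := by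
  ext i k
  rw [Matrix.smul_apply, Matrix.mul_apply, fSz, Matrix.diagonal_apply]
  simp only [Sminus, Splus, Matrix.of_apply]
  rcases Nat.eq_zero_or_pos (i : ℕ) with hi | hi
  · rw [Finset.sum_eq_zero, smul_zero]
    · split_ifs with h
      · simp [hi]
      · rfl
    · intro j _
      rw [if_neg (by omega), zero_mul]
  · rw [Finset.sum_eq_single ⟨(i : ℕ) - 1, by omega⟩]
    · simp only
      have e : (i : ℕ) - 1 + 1 = i := by omega
      rw [e, if_pos rfl]
      by_cases h : i = k
      · subst h
        rw [if_pos rfl, if_pos rfl, smul_eq_mul, c.sinh_sq_mul_x_sq hη]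
        congr 2
        · ring
        · simp only [s]; ring
      · rw [if_neg (fun h' => h (Fin.ext h'.symm)), if_neg h]
        simp
    · intro j _ hj
      rw [if_neg, zero_mul]
      intro h
      exact hj (Fin.ext (by simp only; omega))
    · simp

theorem Splus_mul_Sminus (hη : Complex.sinh c.η ≠ 0) (n : Fin c.N) :
    (Complex.sinh c.η * Complex.sinh c.η) • (c.Splus n * c.Sminus n) =
      c.fSz n fun z => Complex.sinh (c.η * (c.s n - z + 1)) * Complex.sinh (c.η * (c.s n + z)) := by
  ext i k
  rw [Matrix.smul_apply, Matrix.mul_apply, fSz, Matrix.diagonal_apply]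
  simp only [Sminus, Splus, Matrix.of_apply]
  rcases Nat.lt_or_ge (i : ℕ) (c.twoS n) with hi | hi
  · rw [Finset.sum_eq_single ⟨(i : ℕ) + 1, by omega⟩]
    · simp only
      rw [if_pos trivial]
      by_cases h : i = k
      · subst h
        rw [if_pos rfl, if_pos rfl, smul_eq_mul, c.sinh_sq_mul_x_sq hη]
        congr 2
        · push_cast; ring
        · simp only [s]; push_cast; ring
      · rw [if_neg (fun h' => h (Fin.ext (by omega))), if_neg h]
        simp
    · intro j _ hj
      rw [if_neg, zero_mul]
      intro h
      exact hj (Fin.ext h)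
    · simp
  · have hi' : (i : ℕ) = c.twoS n := by omega
    rw [Finset.sum_eq_zero, smul_zero]
    · split_ifs with h
      · have : c.s n + (c.s n - (i : ℕ)) = 0 := by
          rw [hi']; simp only [s]; ring
        rw [this]
        simp
      · rfl
    · intro j _
      rw [if_neg (by omega), zero_mul]

/-- The Lax matrix with entries acting on a single site. -/
noncomputable def localLax (n : Fin c.N) (u : ℂ) :
    Matrix (Fin 2) (Fin 2) (Matrix (Fin (c.twoS n + 1)) (Fin (c.twoS n + 1)) ℂ) :=
  !![c.fSz n fun z => Complex.sinh (u + c.η * z), Complex.sinh c.η • c.Sminus n;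
     Complex.sinh c.η • c.Splus n, c.fSz n fun z => Complex.sinh (u - c.η * z)]

theorem smul_Sminus_mul_fSz (n : Fin c.N) (f : ℂ → ℂ) :
    (Complex.sinh c.η • c.Sminus n) * c.fSz n f =
      c.fSz n (fun z => f (z + 1)) * (Complex.sinh c.η • c.Sminus n) := by
  rw [smul_mul_assoc, Sminus_mul_fSz, mul_smul_comm]

theorem smul_Splus_mul_fSz (n : Fin c.N) (f : ℂ → ℂ) :
    (Complex.sinh c.η • c.Splus n) * c.fSz n f =
      c.fSz n (fun z => f (z - 1)) * (Complex.sinh c.η • c.Splus n) := by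
  rw [smul_mul_assoc, Splus_mul_fSz, mul_smul_comm]

/-- Moving all functions of S^z to the left writes every entry as f(S^z), f(S^z) S^- or f(S^z) S^+.
Each of the 16 relations then becomes an identity between coefficient functions, an addition formula
for sinh. -/
theorem rtt_localLax (hη : Complex.sinh c.η ≠ 0) (n : Fin c.N) (u v : ℂ) :
    RTT c.η (u - v) (c.localLax n u) (c.localLax n v) := by
  have h1 := c.Sminus_mul_Splus hη n
  have h2 := c.Splus_mul_Sminus hη n
  have h3 := c.smul_Sminus_mul_fSz n
  have h4 := c.smul_Splus_mul_fSz n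
  rw [← smul_mul_smul_comm] at h1 h2
  unfold localLax
  generalize Complex.sinh c.η • c.Sminus n = S at *
  generalize Complex.sinh c.η • c.Splus n = S' at *
  intro a b i j
  fin_cases a <;> fin_cases b <;> fin_cases i <;> fin_cases j <;>
    simp only [Fin.zero_eta, Fin.mk_one, sixVertexDiag, sixVertexExch, Matrix.of_apply,
      Matrix.cons_val', Matrix.cons_val_zero, Matrix.cons_val_one, if_true, zero_ne_one,
      one_ne_zero, if_false, zero_smul, add_zero, fSz_mul, h1, h2, h3, h4, smul_fSz, fSz_add,
      ← smul_mul_assoc, ← add_mul]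
  all_goals
    first
    | refine congrArg (fun f => c.fSz n f * S) (funext fun z => ?_)
    | refine congrArg (fun f => c.fSz n f * S') (funext fun z => ?_)
    | refine congrArg (c.fSz n) (funext fun z => ?_)
  all_goals
    simp only [Complex.sinh, mul_add, mul_sub, mul_one, Complex.exp_neg, Complex.exp_add,
      Complex.exp_sub]
    field_simp
    try ring

theorem qdet_localLax (hη : Complex.sinh c.η ≠ 0) (n : Fin c.N) (u : ℂ) :
    QDet (c.localLax n (u + c.η)) (c.localLax n u)
      (Complex.sinh (u + c.η + c.s n * c.η) * Complex.sinh (u - c.s n * c.η)) := by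
  have h1 := c.Sminus_mul_Splus hη n
  have h2 := c.Splus_mul_Sminus hη n
  have h3 := c.smul_Sminus_mul_fSz n
  have h4 := c.smul_Splus_mul_fSz n
  rw [← smul_mul_smul_comm] at h1 h2
  unfold localLax
  generalize Complex.sinh c.η • c.Sminus n = S at *
  generalize Complex.sinh c.η • c.Splus n = S' at *
  have hone : ∀ r : ℂ, r • (1 : Matrix (Fin (c.twoS n + 1)) (Fin (c.twoS n + 1)) ℂ) =
      c.fSz n fun _ => r := by
    intro r
    rw [← Matrix.diagonal_one, ← Matrix.diagonal_smul, fSz]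
    congr 1
    funext
    simp
  have hz : ∀ r : ℂ, (c.fSz n fun _ => 0 * r) = 0 := by
    intro r
    rw [← hone, zero_mul, zero_smul]
  intro a b
  rw [hone, sub_eq_iff_eq_add]
  fin_cases a <;> fin_cases b <;>
    simp only [Fin.zero_eta, Fin.mk_one, detSign, Matrix.of_apply,
      Matrix.cons_val', Matrix.cons_val_zero, Matrix.cons_val_one, fSz_mul, h1, h2, h3, h4,
      fSz_add]
  · rw [hz, zero_add]
    refine congrArg (fun f => c.fSz n f * S) (funext fun z => ?_)
    ring_nf
  · refine congrArg (c.fSz n) (funext fun z => ?_)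
    simp only [Complex.sinh, mul_add, mul_sub, mul_one, Complex.exp_neg, Complex.exp_add,
      Complex.exp_sub]
    field_simp
    ring
  · refine congrArg (c.fSz n) (funext fun z => ?_)
    simp only [Complex.sinh, mul_add, mul_sub, mul_one, Complex.exp_neg, Complex.exp_add,
      Complex.exp_sub]
    field_simp
    ring
  · rw [hz, zero_add]
    refine congrArg (fun f => c.fSz n f * S') (funext fun z => ?_)
    ring_nf

end Chain

end XXZ

/-! ### The monodromy matrix, its reference state and commutation relations -/

namespace XXZ

section

variable {R S : Type*} [Ring R] [Algebra ℂ R] [Ring S] [Algebra ℂ S]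

theorem RTT.map {η z : ℂ} {X Y : Matrix (Fin 2) (Fin 2) R} (h : RTT η z X Y) (f : R →ₐ[ℂ] S) :
    RTT η z (X.map f) (Y.map f) := by
  intro a b c d
  have := congrArg f (h a b c d)
  simpa only [map_add, map_smul, map_mul, Matrix.map_apply] using this

theorem QDet.map {δ : ℂ} {X Y : Matrix (Fin 2) (Fin 2) R} (h : QDet X Y δ) (f : R →ₐ[ℂ] S) :
    QDet (X.map f) (Y.map f) δ := by
  intro a b
  have := congrArg f (h a b)
  simpa only [map_sub, map_smul, map_mul, map_one, Matrix.map_apply] using this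

end

namespace Chain

variable (c : Chain)

/-! ### Embedding of the local operators -/

theorem site_apply_update (n : Fin c.N) (X : Matrix (Fin (c.twoS n + 1)) (Fin (c.twoS n + 1)) ℂ)
    (h : c.Conf) (j : Fin (c.twoS n + 1)) :
    c.site n X h (Function.update h n j) = X (h n) j := by
  rw [site, Matrix.of_apply, if_pos, Function.update_self]
  intro m hm
  rw [Function.update_of_ne hm]

theorem site_mul_apply (n : Fin c.N) (X : Matrix (Fin (c.twoS n + 1)) (Fin (c.twoS n + 1)) ℂ)
    (A : c.Op) (h k : c.Conf) :
    (c.site n X * A) h k = ∑ j, X (h n) j * A (Function.update h n j) k := by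
  rw [Matrix.mul_apply]
  symm
  refine Finset.sum_of_injOn (fun j => Function.update h n j)
    ((Function.update_injective h n).injOn) (fun _ _ => Finset.mem_coe.2 (Finset.mem_univ _)) ?_ ?_
  · intro l _ hl
    rw [site, Matrix.of_apply, if_neg, zero_mul]
    intro hh
    refine hl ⟨l n, Finset.mem_coe.2 (Finset.mem_univ _), ?_⟩
    funext m
    by_cases hm : m = n
    · subst hm; simp
    · simp [hm, hh m hm]
  · intro j _
    rw [site_apply_update]

theorem site_mul (n : Fin c.N) (X Y : Matrix (Fin (c.twoS n + 1)) (Fin (c.twoS n + 1)) ℂ) :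
    c.site n (X * Y) = c.site n X * c.site n Y := by
  ext h k
  rw [site_mul_apply]
  simp only [site, Matrix.of_apply, Matrix.mul_apply]
  split_ifs with hh
  · refine Finset.sum_congr rfl fun j _ => ?_
    rw [if_pos, Function.update_self]
    intro m hm
    rw [Function.update_of_ne hm, hh m hm]
  · symm
    refine Finset.sum_eq_zero fun j _ => ?_
    rw [if_neg, mul_zero]
    intro h'
    refine hh fun m hm => ?_
    have := h' m hm
    rwa [Function.update_of_ne hm] at this

/-- The embedding of the operators at site `n`, as an algebra homomorphism. -/
noncomputable def siteHom (n : Fin c.N) :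
    Matrix (Fin (c.twoS n + 1)) (Fin (c.twoS n + 1)) ℂ →ₐ[ℂ] c.Op :=
  AlgHom.ofLinearMap
    { toFun := c.site n
      map_add' := fun X Y => by
        ext h k
        simp only [site, Matrix.of_apply, Matrix.add_apply]
        split_ifs <;> simp
      map_smul' := fun r X => by
        ext h k
        simp only [site, Matrix.of_apply, Matrix.smul_apply, RingHom.id_apply]
        split_ifs <;> simp }
    (by
      ext h k
      simp only [LinearMap.coe_mk, AddHom.coe_mk, site, Matrix.of_apply, Matrix.one_apply]
      by_cases hk : h = k
      · subst hk; simp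
      · rw [if_neg hk]
        split_ifs with h1 h2
        · refine absurd (funext fun m => ?_) hk
          by_cases hm : m = n
          · subst hm; exact h2
          · exact h1 m hm
        · rfl
        · rfl)
    (fun X Y => c.site_mul n X Y)

theorem site_mul_site_apply {n m : Fin c.N} (hnm : n ≠ m)
    (X : Matrix (Fin (c.twoS n + 1)) (Fin (c.twoS n + 1)) ℂ)
    (Y : Matrix (Fin (c.twoS m + 1)) (Fin (c.twoS m + 1)) ℂ) (h k : c.Conf) :
    (c.site n X * c.site m Y) h k =
      if ∀ l, l ≠ n → l ≠ m → h l = k l then X (h n) (k n) * Y (h m) (k m) else 0 := by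
  rw [site_mul_apply, Finset.sum_eq_single (k n)]
  · simp only [site, Matrix.of_apply, Function.update_of_ne hnm.symm]
    by_cases hh : ∀ l, l ≠ n → l ≠ m → h l = k l
    · rw [if_pos hh, if_pos]
      intro l hl
      by_cases hln : l = n
      · subst hln; simp
      · rw [Function.update_of_ne hln, hh l hln hl]
    · rw [if_neg hh, if_neg, mul_zero]
      intro h'
      refine hh fun l hln hlm => ?_
      have := h' l hlm
      rwa [Function.update_of_ne hln] at this
  · intro j _ hj
    rw [site, Matrix.of_apply, if_neg, mul_zero]
    intro h'
    have := h' n hnm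
    rw [Function.update_self] at this
    exact hj this
  · simp

theorem commute_site {n m : Fin c.N} (hnm : n ≠ m)
    (X : Matrix (Fin (c.twoS n + 1)) (Fin (c.twoS n + 1)) ℂ)
    (Y : Matrix (Fin (c.twoS m + 1)) (Fin (c.twoS m + 1)) ℂ) :
    Commute (c.site n X) (c.site m Y) := by
  ext h k
  rw [site_mul_site_apply c hnm, site_mul_site_apply c hnm.symm]
  have : (∀ l, l ≠ n → l ≠ m → h l = k l) ↔ (∀ l, l ≠ m → l ≠ n → h l = k l) :=
    ⟨fun h l h1 h2 => h l h2 h1, fun h l h1 h2 => h l h2 h1⟩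
  simp only [this, mul_comm]

theorem lax_eq_map (n : Fin c.N) (u : ℂ) : c.lax n u = (c.localLax n u).map (c.siteHom n) := by
  ext i j : 2
  fin_cases i <;> fin_cases j <;> rfl

theorem lax_apply (n : Fin c.N) (u : ℂ) (i j : Fin 2) :
    c.lax n u i j = c.site n (c.localLax n u i j) := by
  rw [lax_eq_map]; rfl

/-! ### The monodromy matrix -/

/-- The ordered product of Lax matrices over a list of sites. -/
noncomputable def partialMonodromy (l : List (Fin c.N)) (u : ℂ) : Matrix (Fin 2) (Fin 2) c.Op :=
  (l.map fun n => c.lax n (u - c.ξ n)).prod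

theorem partialMonodromy_cons (n : Fin c.N) (l : List (Fin c.N)) (u : ℂ) :
    c.partialMonodromy (n :: l) u = c.lax n (u - c.ξ n) * c.partialMonodromy l u := by
  simp [partialMonodromy]

theorem partialMonodromy_nil (u : ℂ) : c.partialMonodromy [] u = 1 := by
  simp [partialMonodromy]

theorem commute_partialMonodromy {m : Fin c.N} {l : List (Fin c.N)} (hm : m ∉ l)
    (X : Matrix (Fin (c.twoS m + 1)) (Fin (c.twoS m + 1)) ℂ) (u : ℂ) (i j : Fin 2) :
    Commute (c.site m X) (c.partialMonodromy l u i j) := by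
  induction l generalizing i j with
  | nil =>
    rw [partialMonodromy_nil, Matrix.one_apply]
    split_ifs
    · exact Commute.one_right _
    · exact Commute.zero_right _
  | cons n l ih =>
    rw [List.mem_cons, not_or] at hm
    rw [partialMonodromy_cons, Matrix.mul_apply]
    refine Commute.sum_right _ _ _ fun k _ => ?_
    rw [lax_apply]
    exact (c.commute_site hm.1 _ _).mul_right (ih hm.2 k j)

theorem rtt_partialMonodromy (hη : Complex.sinh c.η ≠ 0) {l : List (Fin c.N)} (hl : l.Nodup)
    (u v : ℂ) : RTT c.η (u - v) (c.partialMonodromy l u) (c.partialMonodromy l v) := by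
  induction l with
  | nil => rw [partialMonodromy_nil, partialMonodromy_nil]; exact RTT.one _ _
  | cons n l ih =>
    rw [List.nodup_cons] at hl
    rw [partialMonodromy_cons, partialMonodromy_cons]
    refine RTT.mul ?_ (ih hl.2) ?_ ?_
    · rw [lax_eq_map, lax_eq_map, ← sub_sub_sub_cancel_right u v (c.ξ n)]
      exact (c.rtt_localLax hη n _ _).map _
    · intro i j k m
      rw [lax_apply]
      exact (c.commute_partialMonodromy hl.1 _ _ _ _).symm
    · intro i j k m
      rw [lax_apply]
      exact c.commute_partialMonodromy hl.1 _ _ _ _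

theorem qdet_partialMonodromy (hη : Complex.sinh c.η ≠ 0) {l : List (Fin c.N)} (hl : l.Nodup)
    (u : ℂ) : QDet (c.partialMonodromy l (u + c.η)) (c.partialMonodromy l u)
      (l.map fun n => Complex.sinh (u + c.η - c.ξ n + c.s n * c.η) *
        Complex.sinh (u - c.ξ n - c.s n * c.η)).prod := by
  induction l with
  | nil => rw [partialMonodromy_nil, partialMonodromy_nil]; exact QDet.one
  | cons n l ih =>
    rw [List.nodup_cons] at hl
    rw [partialMonodromy_cons, partialMonodromy_cons, List.map_cons, List.prod_cons]
    refine QDet.mul ?_ (ih hl.2) ?_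
    · rw [lax_eq_map, lax_eq_map]
      have := (c.qdet_localLax hη n (u - c.ξ n)).map (c.siteHom n)
      rw [sub_add_eq_add_sub] at this
      exact this
    · intro i j k m
      rw [lax_apply]
      exact (c.commute_partialMonodromy hl.1 _ _ _ _).symm

theorem nodup_reverse_finRange (N : ℕ) : (List.finRange N).reverse.Nodup :=
  List.nodup_reverse.2 (List.nodup_finRange N)

theorem rtt_monodromy (hη : Complex.sinh c.η ≠ 0) (u v : ℂ) :
    RTT c.η (u - v) (c.monodromy u) (c.monodromy v) :=
  c.rtt_partialMonodromy hη (nodup_reverse_finRange _) u v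

theorem qdet_monodromy (hη : Complex.sinh c.η ≠ 0) (u : ℂ) :
    QDet (c.monodromy (u + c.η)) (c.monodromy u) (c.a (u + c.η) * c.d u) := by
  have h := c.qdet_partialMonodromy hη (nodup_reverse_finRange _) u
  rw [List.map_reverse, List.prod_reverse, ← List.ofFn_eq_map, List.prod_ofFn,
    Finset.prod_mul_distrib] at h
  exact h

/-! ### The reference state -/

theorem site_fSz (n : Fin c.N) (f : ℂ → ℂ) :
    c.site n (c.fSz n f) = Matrix.diagonal fun h : c.Conf => f (c.s n - (h n : ℕ)) := by
  ext h k
  rw [site, Matrix.of_apply, fSz, Matrix.diagonal_apply, Matrix.diagonal_apply]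
  by_cases hk : h = k
  · subst hk; simp
  · rw [if_neg hk]
    split_ifs with h1 h2
    · refine absurd (funext fun m => ?_) hk
      by_cases hm : m = n
      · subst hm; exact h2
      · exact h1 m hm
    · rfl
    · rfl

theorem lax_one_one_eq_diagonal (n : Fin c.N) (u : ℂ) :
    c.lax n u 1 1 = Matrix.diagonal fun h : c.Conf =>
      Complex.sinh (u - c.η * (c.s n - (h n : ℕ))) :=
  c.site_fSz n _

theorem commute_lax_partialMonodromy {n : Fin c.N} {l : List (Fin c.N)} (hn : n ∉ l) (u v : ℂ)
    (i j k m : Fin 2) : Commute (c.lax n u i j) (c.partialMonodromy l v k m) := by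
  rw [lax_apply]
  exact c.commute_partialMonodromy hn _ _ _ _

/-- The lower-left Lax entry annihilates the reference state and commutes with the remaining
factors, so only the product of the lower-right entries survives. Both claims are proved in one
induction along the list of sites. -/
theorem partialMonodromy_mulVec {l : List (Fin c.N)} (hl : l.Nodup) (u : ℂ) :
    (c.partialMonodromy l u 1 0).mulVec (Pi.single 0 1) = 0 ∧
    (c.partialMonodromy l u 1 1).mulVec (Pi.single 0 1) =
      (l.map fun n => Complex.sinh (u - c.ξ n - c.s n * c.η)).prod • Pi.single 0 1 := by
  induction l with
  | nil =>
    rw [partialMonodromy_nil, Matrix.one_apply_ne one_ne_zero, Matrix.one_apply_eq,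
      Matrix.zero_mulVec, Matrix.one_mulVec]
    simp
  | cons n l ih =>
    rw [List.nodup_cons] at hl
    obtain ⟨ih0, ih1⟩ := ih hl.2
    have hC : (c.lax n (u - c.ξ n) 1 0).mulVec (Pi.single 0 1) = 0 := by
      rw [Matrix.mulVec_single_one]
      ext h
      rw [lax_apply]
      simp [localLax, site, Splus]
    have hD : (c.lax n (u - c.ξ n) 1 1).mulVec (Pi.single 0 1) =
        Complex.sinh (u - c.ξ n - c.s n * c.η) • Pi.single 0 1 := by
      rw [lax_one_one_eq_diagonal, Matrix.diagonal_mulVec_single, ← Pi.single_smul']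
      simp [mul_comm]
    have hc := fun k => (c.commute_lax_partialMonodromy hl.1 (u - c.ξ n) u 1 0 0 k).eq
    constructor
    · rw [partialMonodromy_cons, Matrix.mul_apply, Fin.sum_univ_two, Matrix.add_mulVec, hc,
        ← Matrix.mulVec_mulVec, ← Matrix.mulVec_mulVec, hC, ih0, Matrix.mulVec_zero,
        Matrix.mulVec_zero, add_zero]
    · rw [partialMonodromy_cons, Matrix.mul_apply, Fin.sum_univ_two, Matrix.add_mulVec, hc,
        ← Matrix.mulVec_mulVec, ← Matrix.mulVec_mulVec, hC, ih1, Matrix.mulVec_zero,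
        Matrix.mulVec_smul, hD, zero_add, smul_smul, List.map_cons, List.prod_cons, mul_comm]

theorem vecMul_partialMonodromy {l : List (Fin c.N)} (hl : l.Nodup) (u : ℂ) :
    Matrix.vecMul (Pi.single 0 1) (c.partialMonodromy l u 0 1) = 0 ∧
    Matrix.vecMul (Pi.single 0 1) (c.partialMonodromy l u 1 1) =
      (l.map fun n => Complex.sinh (u - c.ξ n - c.s n * c.η)).prod • Pi.single 0 1 := by
  induction l with
  | nil => simp [partialMonodromy_nil]
  | cons n l ih =>
    rw [List.nodup_cons] at hl
    obtain ⟨ih0, ih1⟩ := ih hl.2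
    have hB : Matrix.vecMul (Pi.single 0 1) (c.lax n (u - c.ξ n) 0 1) = 0 := by
      rw [Matrix.single_one_vecMul]
      ext h
      rw [lax_apply]
      simp [localLax, site, Sminus]
    have hD : Matrix.vecMul (Pi.single 0 1) (c.lax n (u - c.ξ n) 1 1) =
        Complex.sinh (u - c.ξ n - c.s n * c.η) • Pi.single 0 1 := by
      rw [lax_one_one_eq_diagonal, Matrix.single_vecMul_diagonal, ← Pi.single_smul']
      simp [mul_comm]
    have hc := (c.commute_lax_partialMonodromy hl.1 (u - c.ξ n) u 1 0 0 1).eq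
    constructor
    · rw [partialMonodromy_cons, Matrix.mul_apply, Fin.sum_univ_two, Matrix.vecMul_add,
        (c.commute_lax_partialMonodromy hl.1 (u - c.ξ n) u 0 0 0 1).eq,
        ← Matrix.vecMul_vecMul, ← Matrix.vecMul_vecMul, hB, ih0, Matrix.zero_vecMul,
        Matrix.zero_vecMul, add_zero]
    · rw [partialMonodromy_cons, Matrix.mul_apply, Fin.sum_univ_two, Matrix.vecMul_add, hc,
        ← Matrix.vecMul_vecMul, ← Matrix.vecMul_vecMul, ih0, hD, Matrix.zero_vecMul, zero_add,
        Matrix.smul_vecMul, ih1, smul_smul, List.map_cons, List.prod_cons]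

/-- The `D`-entry of the monodromy matrix. -/
noncomputable def D (u : ℂ) : c.Op := c.monodromy u 1 1

/-- The `A`-entry of the monodromy matrix. -/
noncomputable def A (u : ℂ) : c.Op := c.monodromy u 0 0

theorem D_mulVec_reference (u : ℂ) : (c.D u).mulVec c.reference = c.d u • c.reference := by
  have h := (c.partialMonodromy_mulVec (nodup_reverse_finRange _) u).2
  rw [List.map_reverse, List.prod_reverse, ← List.ofFn_eq_map, List.prod_ofFn] at h
  rw [reference, ← mul_one (_⁻¹), ← smul_eq_mul, Pi.single_smul', Matrix.mulVec_smul, smul_comm]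
  congr 1

theorem reference_vecMul_D (u : ℂ) :
    Matrix.vecMul c.reference (c.D u) = c.d u • c.reference := by
  have h := (c.vecMul_partialMonodromy (nodup_reverse_finRange _) u).2
  rw [List.map_reverse, List.prod_reverse, ← List.ofFn_eq_map, List.prod_ofFn] at h
  rw [reference, ← mul_one (_⁻¹), ← smul_eq_mul, Pi.single_smul', Matrix.smul_vecMul, smul_comm]
  congr 1

/-! ### Commutation relations between the entries -/

theorem sinh_ne_zero_or (hη : Complex.sinh (2 * c.η) ≠ 0) (z : ℂ) :
    Complex.sinh (z + c.η) ≠ 0 ∨ Complex.sinh (-z + c.η) ≠ 0 := by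
  by_contra! h
  refine hη ?_
  have : 2 * c.η = (z + c.η) + (-z + c.η) := by ring
  rw [this, Complex.sinh_add, h.1, h.2]
  simp

/-- The exchange relation with equal row and equal column indices is the commutator times sinh (u -
v + η). If this factor vanishes, the relation with u and v interchanged serves, since both factors
vanish only if sinh 2η = 0. -/
theorem commute_entry (hη : Complex.sinh (2 * c.η) ≠ 0) (i j : Fin 2) (u v : ℂ) :
    Commute (c.monodromy u i j) (c.monodromy v i j) := by
  have hη' : Complex.sinh c.η ≠ 0 := by
    intro h
    rw [Complex.sinh_two_mul, h] at hη
    simp at hη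
  rcases c.sinh_ne_zero_or hη (u - v) with h | h
  · have := c.rtt_monodromy hη' u v i i j j
    simp only [sixVertexDiag, sixVertexExch, if_true, zero_smul, add_zero] at this
    exact smul_right_injective _ h this
  · have := c.rtt_monodromy hη' v u i i j j
    rw [neg_sub] at h
    simp only [sixVertexDiag, sixVertexExch, if_true, zero_smul, add_zero] at this
    exact (smul_right_injective _ h this).symm

variable {c} in
theorem D_mul_C (hη : Complex.sinh c.η ≠ 0) (u v : ℂ) :
    Complex.sinh (u - v) • (c.D u * c.C v) =
      Complex.sinh (u - v - c.η) • (c.C v * c.D u) + Complex.sinh c.η • (c.C u * c.D v) := by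
  have h := c.rtt_monodromy hη v u 1 1 0 1
  simp only [sixVertexDiag, sixVertexExch, if_true, zero_smul, add_zero, zero_ne_one, if_false,
    ← neg_sub u v, Complex.sinh_neg, neg_smul] at h
  rw [show -(u - v) + c.η = -(u - v - c.η) by ring, Complex.sinh_neg, neg_smul,
    neg_add_eq_sub, neg_eq_iff_eq_neg, neg_sub] at h
  rw [show c.C v = c.monodromy v 1 0 from rfl, show c.C u = c.monodromy u 1 0 from rfl,
    show c.D u = c.monodromy u 1 1 from rfl, show c.D v = c.monodromy v 1 1 from rfl, h,
    sub_add_cancel]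

variable {c} in
theorem D_mul_B (hη : Complex.sinh c.η ≠ 0) (u v : ℂ) :
    Complex.sinh (u - v) • (c.D u * c.B v) =
      Complex.sinh (u - v + c.η) • (c.B v * c.D u) - Complex.sinh c.η • (c.B u * c.D v) := by
  have h := c.rtt_monodromy hη u v 1 0 1 1
  simp only [sixVertexDiag, sixVertexExch, if_true, zero_smul, add_zero, one_ne_zero, if_false]
    at h
  exact eq_sub_of_add_eq h

variable {c} in
theorem C_mul_D (hη : Complex.sinh c.η ≠ 0) (u v : ℂ) :
    Complex.sinh (u - v) • (c.C v * c.D u) =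
      Complex.sinh (u - v + c.η) • (c.D u * c.C v) - Complex.sinh c.η • (c.D v * c.C u) := by
  have h := c.rtt_monodromy hη u v 1 1 1 0
  simp only [sixVertexDiag, sixVertexExch, if_true, zero_smul, add_zero, one_ne_zero, if_false]
    at h
  exact eq_sub_of_add_eq h.symm

variable {c} in
theorem B_mul_D (hη : Complex.sinh c.η ≠ 0) (u v : ℂ) :
    Complex.sinh (u - v) • (c.B v * c.D u) =
      Complex.sinh (u - v - c.η) • (c.D u * c.B v) + Complex.sinh c.η • (c.D v * c.B u) := by
  have h := c.rtt_monodromy hη v u 0 1 1 1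
  simp only [sixVertexDiag, sixVertexExch, if_true, zero_smul, add_zero, zero_ne_one, if_false,
    ← neg_sub u v, Complex.sinh_neg, neg_smul] at h
  rw [show -(u - v) + c.η = -(u - v - c.η) by ring, Complex.sinh_neg, neg_smul,
    neg_add_eq_sub, eq_neg_iff_add_eq_zero, sub_add_eq_add_sub, sub_eq_zero] at h
  rw [add_comm]
  exact h.symm

variable {c} in
theorem C_mul_B (hη : Complex.sinh c.η ≠ 0) (u : ℂ) :
    c.C (u + c.η) * c.B u = c.D (u + c.η) * c.A u - (c.a (u + c.η) * c.d u) • (1 : c.Op) := by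
  have h := c.qdet_monodromy hη u 1 0
  simp only [detSign, Matrix.of_apply, Matrix.cons_val', Matrix.cons_val_zero,
    Matrix.cons_val_one, one_mul] at h
  exact eq_sub_iff_add_eq.2 (sub_eq_iff_eq_add'.1 h).symm

variable {c} in
-- At spectral difference -η the two R-matrix weights are opposite, so the exchange relation equates
-- the antisymmetric combinations with the two spectral parameters in either order. This carries the
-- quantum determinant over to the order u, u + η.
theorem C_mul_B' (hη : Complex.sinh c.η ≠ 0) (u : ℂ) :
    c.C u * c.B (u + c.η) = c.A u * c.D (u + c.η) - (c.a (u + c.η) * c.d u) • (1 : c.Op) := by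
  have h := c.rtt_monodromy hη u (u + c.η) 0 1 0 1
  simp only [sixVertexDiag, sixVertexExch, zero_ne_one, if_false,
    sub_add_cancel_left, Complex.sinh_neg, neg_smul, neg_add_eq_sub, ← smul_sub] at h
  have h1 := smul_right_injective _ hη h
  have h2 := c.qdet_monodromy hη u 1 0
  simp only [detSign, Matrix.of_apply, Matrix.cons_val', Matrix.cons_val_zero,
    Matrix.cons_val_one, one_mul] at h2
  rw [← neg_sub, ← h1, neg_sub] at h2
  exact eq_sub_iff_add_eq.2 (sub_eq_iff_eq_add'.1 h2).symm

end Chain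

end XXZ

/-! ### Trigonometric polynomials and interpolation -/

namespace XXZ

open Polynomial

/-- Trigonometric polynomials `∑_{k<n} r_k exp ((2k + 1 - n) u)`. -/
def IsTrig (n : ℕ) (f : ℂ → ℂ) : Prop :=
  ∃ r : ℂ[X], r.degree < n ∧ ∀ u, f u = Complex.exp (u - n * u) * r.eval (Complex.exp (2 * u))

namespace IsTrig

theorem zero (n : ℕ) : IsTrig n fun _ => 0 :=
  ⟨0, by rw [degree_zero]; exact WithBot.bot_lt_coe _, by simp⟩

theorem add {n : ℕ} {f g : ℂ → ℂ} (hf : IsTrig n f) (hg : IsTrig n g) :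
    IsTrig n fun u => f u + g u := by
  obtain ⟨r, hr, hfr⟩ := hf
  obtain ⟨p, hp, hgp⟩ := hg
  refine ⟨r + p, (degree_add_le _ _).trans_lt (max_lt hr hp), fun u => ?_⟩
  beta_reduce
  rw [hfr, hgp, eval_add, mul_add]

theorem const_mul {n : ℕ} {f : ℂ → ℂ} (a : ℂ) (hf : IsTrig n f) : IsTrig n fun u => a * f u := by
  obtain ⟨r, hr, hfr⟩ := hf
  refine ⟨a • r, (degree_smul_le a r).trans_lt hr, fun u => ?_⟩
  beta_reduce
  rw [hfr, eval_smul, smul_eq_mul]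
  ring

theorem sum {n : ℕ} {ι : Type*} (s : Finset ι) {f : ι → ℂ → ℂ} (hf : ∀ i ∈ s, IsTrig n (f i)) :
    IsTrig n fun u => ∑ i ∈ s, f i u := by
  classical
  induction s using Finset.induction_on with
  | empty => simpa using zero n
  | insert i s hi ih =>
    simp only [Finset.sum_insert hi]
    exact (hf i (Finset.mem_insert_self _ _)).add
      (ih fun j hj => hf j (Finset.mem_insert_of_mem hj))

theorem mul {m n : ℕ} {f g : ℂ → ℂ} (hf : IsTrig (m + 1) f) (hg : IsTrig n g) :
    IsTrig (m + n) fun u => f u * g u := by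
  obtain ⟨r, hr, hfr⟩ := hf
  obtain ⟨p, hp, hgp⟩ := hg
  refine ⟨r * p, ?_, fun u => ?_⟩
  · rcases eq_or_ne p 0 with rfl | hp0
    · rw [mul_zero, degree_zero]; exact WithBot.bot_lt_coe _
    rcases eq_or_ne r 0 with rfl | hr0
    · rw [zero_mul, degree_zero]; exact WithBot.bot_lt_coe _
    rw [degree_eq_natDegree (mul_ne_zero hr0 hp0), natDegree_mul hr0 hp0]
    rw [degree_eq_natDegree hr0, Nat.cast_lt] at hr
    rw [degree_eq_natDegree hp0, Nat.cast_lt] at hp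
    rw [Nat.cast_lt]
    omega
  · beta_reduce
    rw [hfr, hgp, eval_mul, mul_mul_mul_comm, ← Complex.exp_add]
    congr 2
    push_cast
    ring

/-- The frequencies 2k + 1 - n have the parity of n + 1, so the class grows in steps of two;
multiplying r by X recenters the exponents. -/
theorem mono {n : ℕ} {f : ℂ → ℂ} (hf : IsTrig n f) : IsTrig (n + 2) f := by
  obtain ⟨r, hr, hfr⟩ := hf
  refine ⟨X * r, ?_, fun u => ?_⟩
  · rcases eq_or_ne r 0 with rfl | hr0
    · rw [mul_zero, degree_zero]; exact WithBot.bot_lt_coe _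
    rw [degree_eq_natDegree (mul_ne_zero X_ne_zero hr0), natDegree_X_mul hr0]
    rw [degree_eq_natDegree hr0, Nat.cast_lt] at hr
    rw [Nat.cast_lt]
    omega
  · rw [hfr, eval_mul, eval_X, ← mul_assoc, ← Complex.exp_add]
    congr 2
    push_cast
    ring

theorem const (a : ℂ) : IsTrig 1 fun _ => a := by
  refine ⟨C a, degree_C_lt, fun u => ?_⟩
  simp

theorem sinh_add (z : ℂ) : IsTrig 2 fun u => Complex.sinh (u + z) := by
  refine ⟨C (Complex.exp z / 2) * X + C (-Complex.exp (-z) / 2), ?_, fun u => ?_⟩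
  · exact lt_of_le_of_lt degree_linear_le (by norm_cast)
  · have e : Complex.sinh (u + z) = (Complex.exp (u + z) - Complex.exp (-(u + z))) / 2 := rfl
    beta_reduce
    rw [e, eval_add, eval_mul, eval_C, eval_C, eval_X, show u - (2 : ℕ) * u = -u by
      push_cast; ring, two_mul, Complex.exp_add, neg_add, Complex.exp_add,
      Complex.exp_add, Complex.exp_neg u]
    have := Complex.exp_ne_zero u
    field_simp
    ring

theorem prod_sinh {ι : Type*} (s : Finset ι) (z : ι → ℂ) :
    IsTrig (s.card + 1) fun u => ∏ i ∈ s, Complex.sinh (u - z i) := by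
  classical
  induction s using Finset.induction_on with
  | empty => simpa using const 1
  | insert i s hi ih =>
    simp only [Finset.prod_insert hi, Finset.card_insert_of_notMem hi]
    have := (sinh_add (-z i)).mul ih
    rw [add_comm] at this
    simpa only [sub_eq_add_neg] using this

theorem continuous {n : ℕ} {f : ℂ → ℂ} (hf : IsTrig n f) : Continuous f := by
  obtain ⟨r, -, hfr⟩ := hf
  rw [funext hfr]
  fun_prop

theorem eq_zero {ι : Type*} [Fintype ι] {f : ℂ → ℂ} (hf : IsTrig (Fintype.card ι) f)
    {z : ι → ℂ} (hz : Function.Injective fun i => Complex.exp (2 * z i)) (h : ∀ i, f (z i) = 0)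
    (u : ℂ) : f u = 0 := by
  classical
  obtain ⟨r, hr, hfr⟩ := hf
  have : r = 0 := by
    refine eq_zero_of_degree_lt_of_eval_finset_eq_zero
      (Finset.univ.image fun i => Complex.exp (2 * z i)) ?_ ?_
    · rw [Finset.card_image_of_injective _ hz, Finset.card_univ]
      exact hr
    · intro x hx
      obtain ⟨i, -, rfl⟩ := Finset.mem_image.1 hx
      have := h i
      rw [hfr] at this
      exact (mul_eq_zero.1 this).resolve_left (Complex.exp_ne_zero _)
  rw [hfr, this, eval_zero, mul_zero]

/-- Lagrange interpolation. -/
theorem eq_sum {ι : Type*} [Fintype ι] [DecidableEq ι] {f : ℂ → ℂ}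
    (hf : IsTrig (Fintype.card ι) f) {z : ι → ℂ}
    (hz : Function.Injective fun i => Complex.exp (2 * z i))
    (hz' : ∀ i j, i ≠ j → Complex.sinh (z i - z j) ≠ 0) (u : ℂ) :
    f u = ∑ i, (∏ j ∈ Finset.univ.erase i, Complex.sinh (u - z j)) *
      (∏ j ∈ Finset.univ.erase i, Complex.sinh (z i - z j))⁻¹ * f (z i) := by
  rw [← sub_eq_zero, sub_eq_add_neg, ← neg_one_mul]
  refine IsTrig.eq_zero (f := fun u => f u + -1 * ∑ i,
    (∏ j ∈ Finset.univ.erase i, Complex.sinh (u - z j)) *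
      (∏ j ∈ Finset.univ.erase i, Complex.sinh (z i - z j))⁻¹ * f (z i)) ?_ hz ?_ u
  · refine hf.add (const_mul _ (IsTrig.sum _ fun i _ => ?_))
    have h1 := prod_sinh (Finset.univ.erase i) z
    rw [Finset.card_erase_of_mem (Finset.mem_univ i), Finset.card_univ,
      Nat.sub_add_cancel (Fintype.card_pos_iff.2 ⟨i⟩)] at h1
    have h2 := h1.const_mul ((∏ j ∈ Finset.univ.erase i, Complex.sinh (z i - z j))⁻¹ * f (z i))
    convert h2 using 2
    ring
  · intro i
    rw [Finset.sum_eq_single i]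
    · rw [mul_inv_cancel₀]
      · ring
      · exact Finset.prod_ne_zero_iff.2 fun j hj => hz' i j (Finset.ne_of_mem_erase hj).symm
    · intro j _ hj
      rw [Finset.prod_eq_zero (Finset.mem_erase.2 ⟨hj.symm, Finset.mem_univ i⟩)]
      · ring
      · rw [sub_self, Complex.sinh_zero]
    · simp

end IsTrig

theorem exp_two_mul_eq_iff {x y : ℂ} :
    Complex.exp (2 * x) = Complex.exp (2 * y) ↔ Complex.sinh (x - y) = 0 := by
  have h : Complex.sinh (x - y) =
      (Complex.exp (2 * x) - Complex.exp (2 * y)) * (Complex.exp (-x - y) / 2) := by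
    rw [Complex.sinh, two_mul, two_mul, Complex.exp_add, Complex.exp_add, neg_sub,
      Complex.exp_sub, Complex.exp_sub, Complex.exp_sub, Complex.exp_neg]
    have := Complex.exp_ne_zero x
    have := Complex.exp_ne_zero y
    field_simp
  rw [h, mul_eq_zero, sub_eq_zero, or_iff_left]
  exact div_ne_zero (Complex.exp_ne_zero _) two_ne_zero

theorem sinh_eq_zero_iff {x : ℂ} :
    Complex.sinh x = 0 ↔ ∃ m : ℤ, x = m * (Complex.I * Real.pi) := by
  rw [← sub_zero x, ← exp_two_mul_eq_iff, Complex.exp_eq_exp_iff_exists_int]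
  refine exists_congr fun m => ?_
  rw [sub_zero]
  constructor
  · intro h
    linear_combination h / 2
  · intro h
    linear_combination 2 * h

theorem sinh_eventually_ne {v u : ℂ} : ∀ᶠ z in nhdsWithin u {u}ᶜ, Complex.sinh (z - v) ≠ 0 := by
  by_cases h : Complex.sinh (u - v) = 0
  · have h1 : HasDerivAt (fun z => Complex.sinh (z - v)) (Complex.cosh (u - v) * 1) u :=
      ((hasDerivAt_id u).sub_const v).csinh
    refine h1.eventually_ne ?_
    rw [mul_one]
    intro h2
    have := Complex.cosh_sq_sub_sinh_sq (u - v)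
    rw [h, h2] at this
    norm_num at this
  · have hc : Continuous fun z => Complex.sinh (z - v) := by fun_prop
    exact (hc.continuousAt.eventually_ne h).filter_mono nhdsWithin_le_nhds

/-- The zeros of sinh are isolated, so the factor cancels on a punctured neighbourhood of each point
and continuity extends the equality to the point. -/
theorem eq_of_sinh_mul_eq {v : ℂ} {f g : ℂ → ℂ} (hf : Continuous f) (hg : Continuous g)
    (h : ∀ u, Complex.sinh (u - v) * f u = Complex.sinh (u - v) * g u) (u : ℂ) : f u = g u := by
  have h1 : Filter.Tendsto f (nhdsWithin u {u}ᶜ) (nhds (f u)) :=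
    hf.continuousAt.mono_left nhdsWithin_le_nhds
  have h2 : Filter.Tendsto g (nhdsWithin u {u}ᶜ) (nhds (g u)) :=
    hg.continuousAt.mono_left nhdsWithin_le_nhds
  refine tendsto_nhds_unique h1 (h2.congr' ?_)
  filter_upwards [sinh_eventually_ne (v := v)] with z hz
  exact (mul_left_cancel₀ hz (h z)).symm

namespace Chain

variable (c : Chain)

theorem isTrig_lax (n : Fin c.N) (w : ℂ) (i j : Fin 2) (h k : c.Conf) :
    IsTrig (if i = j then 2 else 1) fun u => c.lax n (u - w) i j h k := by
  have e : ∀ z : ℂ, IsTrig 2 fun u => Complex.sinh (u - w + z) := by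
    intro z
    have := IsTrig.sinh_add (z - w)
    convert this using 3
    ring
  fin_cases i <;> fin_cases j <;>
    simp only [Fin.zero_eta, Fin.mk_one, lax, Matrix.of_apply, Matrix.cons_val',
      Matrix.cons_val_zero, Matrix.cons_val_one, zero_ne_one, one_ne_zero, if_false, if_true]
  · simp only [site_fSz, Matrix.diagonal_apply]
    split_ifs
    · exact e _
    · exact IsTrig.zero _
  · exact IsTrig.const _
  · exact IsTrig.const _
  · simp only [site_fSz, Matrix.diagonal_apply, sub_eq_add_neg (_ - w)]
    split_ifs
    · exact e _
    · exact IsTrig.zero _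

/-- Diagonal Lax entries raise the size by one and off-diagonal ones are constant. The off-diagonal
entries over N sites thus have only N coefficients, which makes N interpolation nodes sufficient. -/
theorem isTrig_partialMonodromy (l : List (Fin c.N)) (i j : Fin 2) (h k : c.Conf) :
    IsTrig (if i = j then l.length + 1 else l.length) fun u => c.partialMonodromy l u i j h k := by
  induction l generalizing i j h k with
  | nil =>
    simp only [partialMonodromy_nil]
    split_ifs with hij
    · exact IsTrig.const _
    · simp only [Matrix.one_apply_ne hij]
      exact IsTrig.zero _
  | cons n l ih =>
    simp only [partialMonodromy_cons, Matrix.mul_apply (M := c.lax n _), Matrix.sum_apply,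
      Matrix.mul_apply]
    refine IsTrig.sum _ fun m _ => IsTrig.sum _ fun h' _ => ?_
    have h1 := c.isTrig_lax n (c.ξ n) i m h h'
    have h2 := ih m j h' k
    rw [List.length_cons]
    by_cases him : i = m
    · subst him
      rw [if_pos rfl] at h1
      split_ifs at h2 ⊢ with hij
      · have := h1.mul h2
        rwa [add_comm] at this
      · have := h1.mul h2
        rwa [add_comm] at this
    · rw [if_neg him] at h1
      by_cases hmj : m = j
      · subst hmj
        rw [if_pos rfl] at h2
        rw [if_neg him]
        have := IsTrig.mul (m := 0) h1 h2
        rwa [zero_add] at this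
      · rw [if_neg hmj] at h2
        have hij : i = j := by omega
        rw [if_pos hij]
        have := (IsTrig.mul (m := 0) h1 h2).mono
        rwa [zero_add] at this

theorem isTrig_monodromy {i j : Fin 2} (hij : i ≠ j) (h k : c.Conf) :
    IsTrig c.N fun u => c.monodromy u i j h k := by
  have := c.isTrig_partialMonodromy (List.finRange c.N).reverse i j h k
  rwa [if_neg hij, List.length_reverse, List.length_finRange] at this

theorem continuous_monodromy (i j : Fin 2) (h k : c.Conf) :
    Continuous fun u => c.monodromy u i j h k :=
  (c.isTrig_partialMonodromy (List.finRange c.N).reverse i j h k).continuous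

end Chain

end XXZ

/-! ### Separated bases: joint eigenvectors of the operators D -/

namespace XXZ

namespace Chain

variable (c : Chain)

/-- The anisotropy is not a root of unity and the strings are pairwise disjoint. -/
structure Generic : Prop where
  exp_pow : ∀ n : ℕ, 0 < n → Complex.exp c.η ^ n ≠ 1
  disj : ∀ i j : Fin c.N, i ≠ j → Disjoint (c.Xi i) (c.Xi j)

namespace Generic

variable {c} (hc : c.Generic)
include hc

theorem sinh_mul_ne_zero {k : ℕ} (hk : k ≠ 0) : Complex.sinh (k * c.η) ≠ 0 := by
  intro h
  rw [← sub_zero ((k : ℂ) * c.η), ← exp_two_mul_eq_iff, mul_zero, Complex.exp_zero] at h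
  refine hc.exp_pow (2 * k) (by omega) ?_
  rw [← Complex.exp_nat_mul, ← h]
  congr 1
  push_cast
  ring

theorem sinh_ne_zero : Complex.sinh c.η ≠ 0 := by
  simpa using hc.sinh_mul_ne_zero one_ne_zero

theorem sinh_two_mul_ne_zero : Complex.sinh (2 * c.η) ≠ 0 := by
  simpa using hc.sinh_mul_ne_zero two_ne_zero

theorem sinh_same (n : Fin c.N) {k k' : ℕ} (hk : k ≠ k') :
    Complex.sinh (c.xi n k - c.xi n k') ≠ 0 := by
  rcases Nat.lt_or_gt_of_ne hk with h | h
  · have := hc.sinh_mul_ne_zero (k := k' - k) (by omega)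
    convert this using 2
    rw [xi, xi, Nat.cast_sub h.le]
    ring
  · have := neg_ne_zero.2 (hc.sinh_mul_ne_zero (k := k - k') (by omega))
    rw [← Complex.sinh_neg] at this
    convert this using 2
    rw [xi, xi, Nat.cast_sub h.le]
    ring

theorem sinh_sep {n m : Fin c.N} (hnm : n ≠ m) {k k' : ℕ} (hk : k ≤ c.twoS n)
    (hk' : k' ≤ c.twoS m) : Complex.sinh (c.xi n k - c.xi m k') ≠ 0 := by
  intro h
  obtain ⟨l, hl⟩ := sinh_eq_zero_iff.1 h
  have h1 : c.xi n k ∈ c.Xi n := ⟨⟨k, by omega⟩, 0, by simp⟩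
  refine Set.disjoint_left.1 (hc.disj n m hnm) h1 ⟨⟨k', by omega⟩, l, ?_⟩
  rw [← hl]
  ring

theorem sinh_site {n m : Fin c.N} {k k' : ℕ} (h : n ≠ m ∨ k ≠ k') (hk : k ≤ c.twoS n)
    (hk' : k' ≤ c.twoS m) : Complex.sinh (c.xi n k - c.xi m k') ≠ 0 := by
  by_cases hnm : n = m
  · subst hnm
    exact hc.sinh_same n (h.resolve_left (by simp))
  · exact hc.sinh_sep hnm hk hk'

end Generic

theorem xi_add_one (n : Fin c.N) (k : ℕ) : c.xi n (k + 1) + c.η = c.xi n k := by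
  rw [xi, xi]; push_cast; ring

theorem d_eq (u : ℂ) : c.d u = ∏ n, Complex.sinh (u - c.xi n 0) := by
  refine Finset.prod_congr rfl fun n _ => ?_
  rw [xi]
  congr 1
  push_cast
  ring

theorem a_eq (u : ℂ) : c.a u = ∏ n, Complex.sinh (u - c.xi n (c.twoS n)) := by
  refine Finset.prod_congr rfl fun n _ => ?_
  rw [xi, s]
  congr 1
  ring

theorem d_top (n : Fin c.N) : c.d (c.xi n 0) = 0 := by
  rw [d_eq, Finset.prod_eq_zero (Finset.mem_univ n)]
  simp

theorem a_bottom (n : Fin c.N) : c.a (c.xi n (c.twoS n)) = 0 := by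
  rw [a_eq, Finset.prod_eq_zero (Finset.mem_univ n)]
  simp

namespace Generic

variable {c} (hc : c.Generic)
include hc

theorem d_ne_zero {n : Fin c.N} {k : ℕ} (hk0 : k ≠ 0) (hk : k ≤ c.twoS n) :
    c.d (c.xi n k) ≠ 0 := by
  rw [d_eq]
  refine Finset.prod_ne_zero_iff.2 fun m _ => ?_
  by_cases hnm : n = m
  · subst hnm; exact hc.sinh_same n hk0
  · exact hc.sinh_sep hnm hk (Nat.zero_le _)

theorem a_ne_zero {n : Fin c.N} {k : ℕ} (hk : k < c.twoS n) : c.a (c.xi n k) ≠ 0 := by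
  rw [a_eq]
  refine Finset.prod_ne_zero_iff.2 fun m _ => ?_
  by_cases hnm : n = m
  · subst hnm; exact hc.sinh_same n hk.ne
  · exact hc.sinh_sep hnm hk.le le_rfl

end Generic

/-- The `D`-eigenvalue attached to a tuple of string positions. -/
noncomputable def dEig (g : Fin c.N → ℕ) (u : ℂ) : ℂ := ∏ n, Complex.sinh (u - c.xi n (g n))

/-- A configuration, as a tuple of natural numbers. -/
def conf (h : c.Conf) : Fin c.N → ℕ := fun n => h n

theorem conf_le (h : c.Conf) (n : Fin c.N) : c.conf h n ≤ c.twoS n := Nat.lt_succ_iff.1 (h n).2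

theorem conf_update (h : c.Conf) (n : Fin c.N) (k : Fin (c.twoS n + 1)) :
    c.conf (Function.update h n k) = Function.update (c.conf h) n (k : ℕ) := by
  funext m
  by_cases hm : m = n
  · subst hm; simp [conf]
  · simp [conf, hm]

theorem continuous_dEig (g : Fin c.N → ℕ) : Continuous (c.dEig g) := by
  unfold dEig
  fun_prop

theorem dEig_update (g : Fin c.N → ℕ) (n : Fin c.N) (k : ℕ) (u : ℂ) :
    c.dEig (Function.update g n k) u =
      Complex.sinh (u - c.xi n k) * ∏ m ∈ Finset.univ.erase n, Complex.sinh (u - c.xi m (g m)) := by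
  rw [dEig, ← Finset.mul_prod_erase _ _ (Finset.mem_univ n), Function.update_self]
  congr 1
  refine Finset.prod_congr rfl fun m hm => ?_
  rw [Function.update_of_ne (Finset.ne_of_mem_erase hm)]

theorem dEig_self (g : Fin c.N → ℕ) (n : Fin c.N) : c.dEig g (c.xi n (g n)) = 0 := by
  rw [dEig, Finset.prod_eq_zero (Finset.mem_univ n)]
  simp

/-- A separated representation: `X` raises and `Y` lowers the common eigenvectors of `D`. -/
structure Separated (X Y D : ℂ → (c.Conf → ℂ) →ₗ[ℂ] (c.Conf → ℂ)) (x : Fin c.N → ℕ → ℂ)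
    (vec : (Fin c.N → ℕ) → c.Conf → ℂ) : Prop where
  D_X : ∀ u v w, Complex.sinh (u - v) • D u (X v w) =
    Complex.sinh (u - v + c.η) • X v (D u w) - Complex.sinh c.η • X u (D v w)
  D_Y : ∀ u v w, Complex.sinh (u - v) • D u (Y v w) =
    Complex.sinh (u - v - c.η) • Y v (D u w) + Complex.sinh c.η • Y u (D v w)
  Y_X : ∀ u w, D (u + c.η) w = 0 → Y u (X (u + c.η) w) = -(c.a (u + c.η) * c.d u) • w
  vec_zero_ne : vec 0 ≠ 0
  D_vec_zero : ∀ u, D u (vec 0) = c.d u • vec 0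
  vec_succ : ∀ g n, vec (Function.update g n (g n + 1)) = x n (g n) • X (c.xi n (g n)) (vec g)
  x_ne : ∀ n k, k < c.twoS n → x n k ≠ 0
  trig_X : ∀ w h, IsTrig c.N fun u => X u w h
  trig_Y : ∀ w h, IsTrig c.N fun u => Y u w h
  continuous_D : ∀ w h, Continuous fun u => D u w h

namespace Separated

variable {c} {X Y D : ℂ → (c.Conf → ℂ) →ₗ[ℂ] (c.Conf → ℂ)} {x : Fin c.N → ℕ → ℂ}
  {vec : (Fin c.N → ℕ) → c.Conf → ℂ} (S : c.Separated X Y D x vec)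
include S

theorem D_eq_smul_of_sinh {v : ℂ} {w : c.Conf → ℂ} {f : ℂ → ℂ} (hf : Continuous f)
    (h : ∀ u, Complex.sinh (u - v) • D u w = (Complex.sinh (u - v) * f u) • w) (u : ℂ) :
    D u w = f u • w := by
  funext k
  refine eq_of_sinh_mul_eq (v := v) (f := fun u => D u w k) (g := fun u => (f u • w) k)
    (S.continuous_D w k) (by simp only [Pi.smul_apply, smul_eq_mul]; fun_prop) (fun u => ?_) u
  have := congrFun (h u) k
  simp only [Pi.smul_apply, smul_eq_mul] at this ⊢
  rw [this]
  ring

/-- Induction on the total height. At v = ξ_n^(g_n) the second term of the exchange relation drops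
out because D(v) kills the vector, and the first replaces the factor sinh (u - v) of the eigenvalue
by sinh (u - v + η), that is, by the next string point. Division by sinh (u - v) is by continuity.
-/
theorem D_vec (g : Fin c.N → ℕ) (u : ℂ) : D u (vec g) = c.dEig g u • vec g := by
  generalize hs : ∑ n, g n = t
  induction t generalizing g u with
  | zero =>
    have : g = 0 := by
      funext n
      exact (Finset.sum_eq_zero_iff.1 hs) n (Finset.mem_univ n)
    subst this
    rw [S.D_vec_zero, d_eq]
    rfl
  | succ t ih =>
    obtain ⟨n, -, hn⟩ : ∃ n ∈ Finset.univ, g n ≠ 0 := by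
      by_contra! h
      rw [Finset.sum_eq_zero h] at hs
      omega
    obtain ⟨k, hk⟩ := Nat.exists_eq_succ_of_ne_zero hn
    obtain ⟨g', hg', hgk⟩ : ∃ g', g = Function.update g' n (g' n + 1) ∧ g' n = k := by
      refine ⟨Function.update g n k, ?_, by simp⟩
      simp [← Nat.succ_eq_add_one, ← hk]
    have hsum : ∑ m, g' m = t := by
      have h1 : ∑ m, g m = (∑ m, g' m) + 1 := by
        rw [← Finset.add_sum_erase _ _ (Finset.mem_univ n),
          ← Finset.add_sum_erase _ g' (Finset.mem_univ n), hg', Function.update_self,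
          Finset.sum_congr rfl fun m hm => Function.update_of_ne (Finset.ne_of_mem_erase hm) _ _]
        ring
      omega
    have ih' := fun u => ih g' u hsum
    refine S.D_eq_smul_of_sinh (v := c.xi n (g' n)) (c.continuous_dEig g) (fun u => ?_) u
    rw [hg', S.vec_succ, map_smul, smul_comm, S.D_X, ih', ih', dEig_self, zero_smul, map_zero,
      smul_zero, sub_zero, map_smul, dEig_update]
    have e1 := c.dEig_update g' n (g' n) u
    rw [Function.update_eq_self] at e1
    have e2 : u - c.xi n (g' n) + c.η = u - c.xi n (g' n + 1) := by
      rw [← c.xi_add_one n (g' n)]; ring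
    rw [e1, e2, smul_smul, smul_smul, smul_smul]
    congr 1
    ring

/-- D vanishes on the vector at the string point from which X raises it, so the quantum determinant
relation turns Y after X into a scalar. -/
theorem Y_vec (g : Fin c.N → ℕ) (n : Fin c.N) :
    Y (c.xi n (g n + 1)) (vec (Function.update g n (g n + 1))) =
      (-(x n (g n) * (c.a (c.xi n (g n)) * c.d (c.xi n (g n + 1))))) • vec g := by
  rw [S.vec_succ, map_smul, ← c.xi_add_one n (g n), S.Y_X, smul_smul]
  · rw [c.xi_add_one]; congr 1; ring
  · rw [c.xi_add_one, D_vec S, dEig_self, zero_smul]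

theorem X_vec (g : Fin c.N → ℕ) (n : Fin c.N) (hn : g n < c.twoS n) :
    X (c.xi n (g n)) (vec g) = (x n (g n))⁻¹ • vec (Function.update g n (g n + 1)) := by
  rw [S.vec_succ, smul_smul, inv_mul_cancel₀ (S.x_ne n _ hn), one_smul]

variable (hc : c.Generic)
include hc

/-- Inside the strings a and d are nonzero where needed, so lowering by Y recovers a nonzero
multiple of the previous vector. -/
theorem vec_ne_zero (g : Fin c.N → ℕ) (hg : ∀ n, g n ≤ c.twoS n) : vec g ≠ 0 := by
  generalize hs : ∑ n, g n = t
  induction t generalizing g with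
  | zero =>
    have : g = 0 := by
      funext n
      exact (Finset.sum_eq_zero_iff.1 hs) n (Finset.mem_univ n)
    subst this
    exact S.vec_zero_ne
  | succ t ih =>
    obtain ⟨n, -, hn⟩ : ∃ n ∈ Finset.univ, g n ≠ 0 := by
      by_contra! h
      rw [Finset.sum_eq_zero h] at hs
      omega
    obtain ⟨k, hk⟩ := Nat.exists_eq_succ_of_ne_zero hn
    obtain ⟨g', hg', hgk⟩ :
        ∃ g', g = Function.update g' n (g' n + 1) ∧ g' = Function.update g n k := by
      refine ⟨Function.update g n k, ?_, rfl⟩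
      simp [← Nat.succ_eq_add_one, ← hk]
    have hgn : g' n = k := by rw [hgk, Function.update_self]
    have hsum : ∑ m, g' m = t := by
      have h1 : ∑ m, g m = (∑ m, g' m) + 1 := by
        rw [← Finset.add_sum_erase _ _ (Finset.mem_univ n),
          ← Finset.add_sum_erase _ g' (Finset.mem_univ n), hg', Function.update_self,
          Finset.sum_congr rfl fun m hm => Function.update_of_ne (Finset.ne_of_mem_erase hm) _ _]
        ring
      omega
    have hkn : k < c.twoS n := by have := hg n; omega
    have ih' := ih g' (fun m => by
      rw [hgk]
      by_cases hm : m = n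
      · subst hm; rw [Function.update_self]; exact hkn.le
      · rw [Function.update_of_ne hm]; exact hg m) hsum
    intro h0
    have h1 := S.Y_vec g' n
    rw [← hg', h0, map_zero, eq_comm, smul_eq_zero] at h1
    refine h1.elim ?_ ih'
    rw [hgn]
    exact neg_ne_zero.2 (mul_ne_zero (S.x_ne n k hkn)
      (mul_ne_zero (hc.a_ne_zero hkn) (hc.d_ne_zero (by omega) hkn)))

omit S in
theorem exists_dEig_separates {h k : c.Conf} (hk : h ≠ k) :
    ∃ u, c.dEig (c.conf h) u = 0 ∧ c.dEig (c.conf k) u ≠ 0 := by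
  obtain ⟨n, hn⟩ := Function.ne_iff.1 hk
  refine ⟨c.xi n (c.conf h n), c.dEig_self _ _, Finset.prod_ne_zero_iff.2 fun m _ => ?_⟩
  refine hc.sinh_site ?_ (c.conf_le h n) (c.conf_le k m)
  by_cases hnm : n = m
  · subst hnm
    exact Or.inr fun h' => hn (Fin.ext h')
  · exact Or.inl hnm

/-- Different configurations have different D-eigenvalue functions. A suitable product of operators
D(u) kills all vectors of a relation except a chosen one. -/
theorem linearIndependent : LinearIndependent ℂ fun h : c.Conf => vec (c.conf h) := by
  classical
  rw [Fintype.linearIndependent_iff]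
  intro r hr h0
  have key : ∀ (s : Finset c.Conf) (uu : c.Conf → ℂ),
      ∑ h, ((∏ k ∈ s, c.dEig (c.conf h) (uu k)) * r h) • vec (c.conf h) = 0 := by
    intro s uu
    induction s using Finset.induction_on with
    | empty => simpa using hr
    | insert k s hk ih =>
      have := congrArg (D (uu k)) ih
      rw [map_sum, map_zero] at this
      rw [← this]
      refine Finset.sum_congr rfl fun h _ => ?_
      rw [map_smul, S.D_vec, smul_smul, Finset.prod_insert hk]
      congr 1
      ring
  choose! uu huu using fun h => fun (hh : h ≠ h0) => exists_dEig_separates hc hh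
  have h1 := key (Finset.univ.erase h0) uu
  rw [Finset.sum_eq_single h0] at h1
  · rcases smul_eq_zero.1 h1 with h2 | h2
    · refine (mul_eq_zero.1 h2).resolve_left (Finset.prod_ne_zero_iff.2 fun k hk => ?_)
      exact (huu k (Finset.ne_of_mem_erase hk)).2
    · exact absurd h2 (S.vec_ne_zero hc _ (c.conf_le h0))
  · intro h _ hh
    rw [Finset.prod_eq_zero (Finset.mem_erase.2 ⟨hh, Finset.mem_univ h⟩) (huu h hh).1, zero_mul,
      zero_smul]
  · simp

/-- The basis of common eigenvectors of `D`. -/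
noncomputable def basis : Module.Basis c.Conf ℂ (c.Conf → ℂ) :=
  basisOfLinearIndependentOfCardEqFinrank (S.linearIndependent hc) (by simp)

theorem basis_apply (h : c.Conf) : S.basis hc h = vec (c.conf h) := by
  rw [basis, coe_basisOfLinearIndependentOfCardEqFinrank]

/-- Expanding in the separated basis, a coefficient can be nonzero only if μ agrees everywhere with
the corresponding D-eigenvalue. This lets vectors pushed beyond an end of a string be recognized as
zero. -/
theorem eq_zero_of_eigenvalue {w : c.Conf → ℂ} {μ : ℂ → ℂ} (hw : ∀ u, D u w = μ u • w)
    (hμ : ∀ h : c.Conf, ∃ u, c.dEig (c.conf h) u = 0 ∧ μ u ≠ 0) : w = 0 := by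
  have hrep := (S.basis hc).sum_repr w
  have h1 : ∀ u h, c.dEig (c.conf h) u * (S.basis hc).repr w h = μ u * (S.basis hc).repr w h := by
    intro u
    have h2 : ∑ h, (c.dEig (c.conf h) u * (S.basis hc).repr w h - μ u * (S.basis hc).repr w h) •
        S.basis hc h = 0 := by
      have h3 := hw u
      rw [← hrep, map_sum, Finset.smul_sum, ← sub_eq_zero, ← Finset.sum_sub_distrib] at h3
      rw [← h3]
      refine Finset.sum_congr rfl fun h _ => ?_
      rw [map_smul, basis_apply, S.D_vec, smul_smul, smul_smul, ← sub_smul]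
      congr 2
      ring
    intro h
    exact sub_eq_zero.1
      (Fintype.linearIndependent_iff.1 (S.basis hc).linearIndependent _ h2 h)
  rw [← hrep]
  refine Finset.sum_eq_zero fun h _ => ?_
  obtain ⟨u, hu1, hu2⟩ := hμ h
  have := h1 u h
  rw [hu1, zero_mul, eq_comm] at this
  rw [(mul_eq_zero.1 this).resolve_left hu2, zero_smul]

omit S in
theorem prod_erase_ne_zero (h k : c.Conf) (n : Fin c.N) :
    ∏ m ∈ Finset.univ.erase n, Complex.sinh (c.xi n (c.conf k n) - c.xi m (c.conf h m)) ≠ 0 :=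
  Finset.prod_ne_zero_iff.2 fun m hm =>
    hc.sinh_sep (Finset.ne_of_mem_erase hm).symm (c.conf_le k n) (c.conf_le h m)

/-- The vector would be a D-eigenvector with string position -1 at site n. Its eigenvalue is nonzero
at every ξ_n^(k) of the string, whereas each basis eigenvalue vanishes at one of them. -/
theorem Y_top (h : c.Conf) (n : Fin c.N) (hn : c.conf h n = 0) :
    Y (c.xi n 0) (vec (c.conf h)) = 0 := by
  refine S.eq_zero_of_eigenvalue hc (μ := fun u => Complex.sinh (u - c.xi n 0 - c.η) *
    ∏ m ∈ Finset.univ.erase n, Complex.sinh (u - c.xi m (c.conf h m))) ?_ ?_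
  · refine S.D_eq_smul_of_sinh (v := c.xi n 0) (by fun_prop) fun u => ?_
    rw [S.D_Y, S.D_vec, S.D_vec]
    have e0 := c.dEig_self (c.conf h) n
    have e1 := c.dEig_update (c.conf h) n 0 u
    rw [← hn, Function.update_eq_self, hn] at e1
    rw [hn] at e0
    rw [e0, e1, zero_smul, map_zero, smul_zero, add_zero, map_smul, smul_smul]
    congr 1
    ring
  · intro k
    refine ⟨_, c.dEig_self _ n, mul_ne_zero ?_ (prod_erase_ne_zero hc h k n)⟩
    have := neg_ne_zero.2 (hc.sinh_mul_ne_zero (k := c.conf k n + 1) (by omega))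
    rw [← Complex.sinh_neg] at this
    convert this using 2
    rw [xi, xi]
    push_cast
    ring

/-- As for `Y_top`, with the position 2s + 1 just below the string. -/
theorem X_bottom (h : c.Conf) (n : Fin c.N) (hn : c.conf h n = c.twoS n) :
    X (c.xi n (c.twoS n)) (vec (c.conf h)) = 0 := by
  refine S.eq_zero_of_eigenvalue hc (μ := fun u => Complex.sinh (u - c.xi n (c.twoS n) + c.η) *
    ∏ m ∈ Finset.univ.erase n, Complex.sinh (u - c.xi m (c.conf h m))) ?_ ?_
  · refine S.D_eq_smul_of_sinh (v := c.xi n (c.twoS n)) (by fun_prop) fun u => ?_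
    rw [S.D_X, S.D_vec, S.D_vec]
    have e0 := c.dEig_self (c.conf h) n
    have e1 := c.dEig_update (c.conf h) n (c.twoS n) u
    rw [← hn, Function.update_eq_self, hn] at e1
    rw [hn] at e0
    rw [e0, e1, zero_smul, map_zero, smul_zero, sub_zero, map_smul, smul_smul]
    congr 1
    ring
  · intro k
    refine ⟨_, c.dEig_self _ n, mul_ne_zero ?_ (prod_erase_ne_zero hc h k n)⟩
    have hk := c.conf_le k n
    have := hc.sinh_mul_ne_zero (k := c.twoS n + 1 - c.conf k n) (by omega)
    convert this using 2
    rw [xi, xi, Nat.cast_sub (by omega)]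
    push_cast
    ring

end Separated

end Chain

end XXZ

/-! ### Eigenfunctionals and separated eigenvectors -/

namespace XXZ

/-- Summation by parts on one string: after shifting the index in the raising and lowering terms,
the coefficient of each b k is the discrete equation h. The terms leaving the string vanish by `hXm`
and `hY0`. -/
theorem sum_chain_eq_zero {V : Type*} [AddCommGroup V] [Module ℂ V] {m : ℕ} {b Xb Yb : ℕ → V}
    {f t Xc Yc : ℕ → ℂ} {α β : ℂ} (hX : ∀ k < m, Xb k = Xc k • b (k + 1)) (hXm : Xb m = 0)
    (hY : ∀ k < m, Yb (k + 1) = Yc k • b k) (hY0 : Yb 0 = 0)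
    (h : ∀ k ≤ m, t k * f k = (if k = 0 then 0 else α * Xc (k - 1) * f (k - 1)) +
      (if k = m then 0 else β * Yc k * f (k + 1))) :
    ∑ k ∈ Finset.range (m + 1), f k • (α • Xb k + β • Yb k - t k • b k) = 0 := by
  have h1 : ∑ k ∈ Finset.range (m + 1), (f k * α) • Xb k =
      ∑ k ∈ Finset.range (m + 1), (if k = 0 then 0 else α * Xc (k - 1) * f (k - 1)) • b k := by
    rw [Finset.sum_range_succ, hXm, smul_zero, add_zero, Finset.sum_range_succ', if_pos rfl,
      zero_smul, add_zero]
    refine Finset.sum_congr rfl fun k hk => ?_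
    rw [hX k (Finset.mem_range.1 hk), if_neg (Nat.succ_ne_zero k), smul_smul, Nat.add_sub_cancel]
    congr 1
    ring
  have h2 : ∑ k ∈ Finset.range (m + 1), (f k * β) • Yb k =
      ∑ k ∈ Finset.range (m + 1), (if k = m then 0 else β * Yc k * f (k + 1)) • b k := by
    rw [Finset.sum_range_succ', hY0, smul_zero, add_zero, Finset.sum_range_succ, if_pos rfl,
      zero_smul, add_zero]
    refine Finset.sum_congr rfl fun k hk => ?_
    rw [Finset.mem_range] at hk
    rw [hY k hk, if_neg hk.ne, smul_smul]
    congr 1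
    ring
  have h3 : ∀ k ∈ Finset.range (m + 1), f k • (α • Xb k + β • Yb k - t k • b k) =
      (f k * α) • Xb k + (f k * β) • Yb k -
      ((if k = 0 then 0 else α * Xc (k - 1) * f (k - 1)) • b k +
        (if k = m then 0 else β * Yc k * f (k + 1)) • b k) := by
    intro k hk
    rw [← add_smul, ← h k (by simpa [Nat.lt_succ_iff] using hk)]
    module
  rw [Finset.sum_congr rfl h3, Finset.sum_sub_distrib, Finset.sum_add_distrib,
    Finset.sum_add_distrib, h1, h2, sub_self]

namespace Chain

variable {c : Chain}

theorem sum_eq_zero_of_sum_update {V : Type*} [AddCommGroup V] (n : Fin c.N) (F : c.Conf → V)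
    (h : ∀ k, ∑ j, F (Function.update k n j) = 0) : ∑ k, F k = 0 := by
  let e := Equiv.piSplitAt n fun i : Fin c.N => Fin (c.twoS i + 1)
  rw [← Equiv.sum_comp e.symm, Fintype.sum_prod_type_right]
  refine Finset.sum_eq_zero fun r _ => ?_
  rw [← h (e.symm (0, r))]
  refine Finset.sum_congr rfl fun j _ => ?_
  congr 1
  funext m
  by_cases hm : m = n
  · subst hm
    simp [e, Equiv.piSplitAt]
  · simp [e, Equiv.piSplitAt, hm]

/-- Factorization of the trigonometric Vandermonde product with respect to one variable. -/
theorem sinhVandermonde_eq (h : c.Conf) (n : Fin c.N) :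
    c.sinhVandermonde h =
      ((∏ m ∈ Finset.univ.erase n, if n < m then (-1 : ℂ) else 1) *
        ∏ i ∈ Finset.univ.erase n, ∏ j ∈ Finset.univ.erase n,
          if i < j then Complex.sinh (c.xi j (h j) - c.xi i (h i)) else 1) *
      ∏ m ∈ Finset.univ.erase n, Complex.sinh (c.xi n (h n) - c.xi m (h m)) := by
  set z : Fin c.N → ℂ := fun i => c.xi i (h i)
  have e0 : c.sinhVandermonde h =
      ∏ i, ∏ j, if i < j then Complex.sinh (z j - z i) else 1 := by
    rw [sinhVandermonde]
    refine Finset.prod_congr rfl fun i _ => ?_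
    rw [← Finset.prod_filter, Finset.filter_lt_eq_Ioi]
  rw [e0, ← Finset.mul_prod_erase _ _ (Finset.mem_univ n),
    ← Finset.mul_prod_erase _ _ (Finset.mem_univ n), if_neg (lt_irrefl n), one_mul]
  have e1 : ∀ i ∈ Finset.univ.erase n,
      (∏ j, if i < j then Complex.sinh (z j - z i) else 1) =
      (if i < n then Complex.sinh (z n - z i) else 1) *
        ∏ j ∈ Finset.univ.erase n, if i < j then Complex.sinh (z j - z i) else 1 := by
    intro i _
    rw [Finset.mul_prod_erase _ (fun j => if i < j then Complex.sinh (z j - z i) else 1)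
      (Finset.mem_univ n)]
  have e2 : (∏ m ∈ Finset.univ.erase n, if n < m then Complex.sinh (z m - z n) else 1) *
      (∏ i ∈ Finset.univ.erase n, if i < n then Complex.sinh (z n - z i) else 1) =
      (∏ m ∈ Finset.univ.erase n, if n < m then (-1 : ℂ) else 1) *
        ∏ m ∈ Finset.univ.erase n, Complex.sinh (z n - z m) := by
    rw [← Finset.prod_mul_distrib, ← Finset.prod_mul_distrib]
    refine Finset.prod_congr rfl fun m hm => ?_
    rcases lt_or_gt_of_ne (Finset.ne_of_mem_erase hm) with hlt | hlt
    · rw [if_neg hlt.not_gt, if_pos hlt, if_neg hlt.not_gt]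
    · rw [if_pos hlt, if_neg hlt.not_gt, if_pos hlt, ← neg_sub, Complex.sinh_neg]
      ring
  rw [Finset.prod_congr rfl e1, Finset.prod_mul_distrib, ← mul_assoc, e2]
  ring

theorem sinhVandermonde_ne_zero (hc : c.Generic) (h : c.Conf) : c.sinhVandermonde h ≠ 0 :=
  Finset.prod_ne_zero_iff.2 fun _ _ => Finset.prod_ne_zero_iff.2 fun _ hj =>
    hc.sinh_sep (Finset.mem_Ioi.1 hj).ne' (c.conf_le h _) (c.conf_le h _)

namespace Separated

variable {X Y D : ℂ → (c.Conf → ℂ) →ₗ[ℂ] (c.Conf → ℂ)} {x : Fin c.N → ℕ → ℂ}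
  {vec : (Fin c.N → ℕ) → c.Conf → ℂ} (S : c.Separated X Y D x vec) (hc : c.Generic)
include S hc

/-- An eigenfunctional of the transfer matrices satisfies the discrete Baxter equation at each
site. -/
theorem functional_recursion {α β : ℂ} {t : ℂ → ℂ} {ℓ : (c.Conf → ℂ) →ₗ[ℂ] ℂ}
    (hℓ : ∀ u w, ℓ (α • X u w + β • Y u w) = t u * ℓ w) (h : c.Conf) (n : Fin c.N) :
    t (c.xi n (c.conf h n)) * ℓ (vec (c.conf h)) =
      (if c.conf h n = c.twoS n then 0 else α * (x n (c.conf h n))⁻¹ *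
        ℓ (vec (Function.update (c.conf h) n (c.conf h n + 1)))) +
      (if c.conf h n = 0 then 0 else
        β * -(x n (c.conf h n - 1) * (c.a (c.xi n (c.conf h n - 1)) * c.d (c.xi n (c.conf h n)))) *
        ℓ (vec (Function.update (c.conf h) n (c.conf h n - 1)))) := by
  rw [← hℓ, map_add, map_smul, map_smul, smul_eq_mul, smul_eq_mul]
  congr 1
  · split_ifs with h1
    · rw [h1, S.X_bottom hc h n h1, map_zero, mul_zero]
    · rw [S.X_vec _ n (lt_of_le_of_ne (c.conf_le h n) h1), map_smul, smul_eq_mul, mul_assoc]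
  · split_ifs with h1
    · rw [h1, S.Y_top hc h n h1, map_zero, mul_zero]
    · have h2 := S.Y_vec (Function.update (c.conf h) n (c.conf h n - 1)) n
      rw [Function.update_self, Nat.sub_add_cancel (Nat.pos_of_ne_zero h1), Function.update_idem,
        Function.update_eq_self] at h2
      rw [h2, map_smul, smul_eq_mul, mul_assoc]

/-- In the recursion at a site, the raised component has a nonzero coefficient as long as it stays
inside the string. So all components follow from the reference one by induction on the total height.
-/
theorem functional_eq_zero {α β : ℂ} (hα : α ≠ 0) {t : ℂ → ℂ} {ℓ : (c.Conf → ℂ) →ₗ[ℂ] ℂ}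
    (hℓ : ∀ u w, ℓ (α • X u w + β • Y u w) = t u * ℓ w) (h0 : ℓ (vec 0) = 0) : ℓ = 0 := by
  have key : ∀ t', ∀ g : Fin c.N → ℕ, (∀ n, g n ≤ c.twoS n) → ∑ n, g n = t' → ℓ (vec g) = 0 := by
    intro t'
    induction t' using Nat.strong_induction_on with
    | _ t' ih =>
      intro g hg hs
      by_cases hg0 : g = 0
      · rw [hg0, h0]
      obtain ⟨n, hn⟩ := Function.ne_iff.1 hg0
      rw [Pi.zero_apply] at hn
      let h : c.Conf := fun m => ⟨if m = n then g n - 1 else g m, by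
        have := hg m; have := hg n; split_ifs with hm
        · subst hm; omega
        · omega⟩
      have hh : c.conf h = Function.update g n (g n - 1) := by
        funext m
        by_cases hm : m = n
        · subst hm; simp [conf, h]
        · simp [conf, h, hm]
      have hsum : ∀ k, ∑ m, Function.update g n k m = k + ∑ m ∈ Finset.univ.erase n, g m := by
        intro k
        rw [← Finset.add_sum_erase _ _ (Finset.mem_univ n), Function.update_self,
          Finset.sum_congr rfl fun m hm => Function.update_of_ne (Finset.ne_of_mem_erase hm) _ _]
      have hsg := hsum (g n)
      rw [Function.update_eq_self, hs] at hsg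
      have hle : ∀ k ≤ c.twoS n, ∀ m, Function.update g n k m ≤ c.twoS m := by
        intro k hk m
        by_cases hm : m = n
        · subst hm; rwa [Function.update_self]
        · rw [Function.update_of_ne hm]; exact hg m
      have hgn := hg n
      have hrec := S.functional_recursion hc hℓ h n
      have hv : c.conf h n = g n - 1 := by rw [hh, Function.update_self]
      rw [hv, hh, if_neg (by omega), Function.update_idem, Function.update_idem,
        Nat.sub_add_cancel (Nat.pos_of_ne_zero hn), Function.update_eq_self,
        ih (g n - 1 + ∑ m ∈ Finset.univ.erase n, g m) (by omega) _ (hle _ (by omega)) (hsum _),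
        mul_zero] at hrec
      have h2 : (if g n - 1 = 0 then 0 else β * -(x n (g n - 1 - 1) *
          (c.a (c.xi n (g n - 1 - 1)) * c.d (c.xi n (g n - 1)))) *
          ℓ (vec (Function.update g n (g n - 1 - 1)))) = 0 := by
        split_ifs with h3
        · rfl
        · rw [ih (g n - 1 - 1 + ∑ m ∈ Finset.univ.erase n, g m) (by omega) _
            (hle _ (by omega)) (hsum _), mul_zero]
      rw [h2, add_zero] at hrec
      exact (mul_eq_zero.1 hrec.symm).resolve_left
        (mul_ne_zero hα (inv_ne_zero (S.x_ne n _ (by omega))))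
  refine (S.basis hc).ext fun h => ?_
  rw [basis_apply, LinearMap.zero_apply]
  exact key _ _ (c.conf_le h) rfl

/-- Separated states solving the discrete Baxter equations are eigenstates. -/
theorem separated_eigenvector {α β : ℂ} {t : ℂ → ℂ} (ht : IsTrig c.N t) {f : Fin c.N → ℕ → ℂ}
    (hf : ∀ n, ∀ k ≤ c.twoS n, t (c.xi n k) * f n k =
      (if k = 0 then 0 else α * (x n (k - 1))⁻¹ * f n (k - 1)) +
      (if k = c.twoS n then 0 else
        β * -(x n k * (c.a (c.xi n k) * c.d (c.xi n (k + 1)))) * f n (k + 1))) (u : ℂ) :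
    α • X u (∑ h : c.Conf, ((∏ j, f j (h j)) * c.sinhVandermonde h) • vec (c.conf h)) +
      β • Y u (∑ h : c.Conf, ((∏ j, f j (h j)) * c.sinhVandermonde h) • vec (c.conf h)) =
      t u • ∑ h : c.Conf, ((∏ j, f j (h j)) * c.sinhVandermonde h) • vec (c.conf h) := by
  have hz' : ∀ h : c.Conf, ∀ i j, i ≠ j → Complex.sinh (c.xi i (h i) - c.xi j (h j)) ≠ 0 :=
    fun h i j hij => hc.sinh_sep hij (c.conf_le h i) (c.conf_le h j)
  have hz : ∀ h : c.Conf, Function.Injective fun i => Complex.exp (2 * c.xi i (h i)) := by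
    intro h i j hij
    by_contra hne
    exact hz' h i j hne (exp_two_mul_eq_iff.1 hij)
  set E : Fin c.N → c.Conf → c.Conf → ℂ := fun n h =>
    α • X (c.xi n (h n)) (vec (c.conf h)) + β • Y (c.xi n (h n)) (vec (c.conf h)) -
      t (c.xi n (h n)) • vec (c.conf h) with hE
  -- K is what remains of the Vandermonde product after its factors containing the node of site n
  -- cancel the Lagrange denominator; hence it does not depend on the n-th position.
  set K : Fin c.N → c.Conf → ℂ := fun n h =>
    ((∏ m ∈ Finset.univ.erase n, if n < m then (-1 : ℂ) else 1) *
        ∏ i ∈ Finset.univ.erase n, ∏ j ∈ Finset.univ.erase n,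
          if i < j then Complex.sinh (c.xi j (h j) - c.xi i (h i)) else 1) *
      (∏ j ∈ Finset.univ.erase n, Complex.sinh (u - c.xi j (h j))) with hK
  have hKu : ∀ n h k, K n (Function.update h n k) = K n h := by
    intro n h k
    simp only [hK]
    congr 1
    · congr 1
      refine Finset.prod_congr rfl fun i hi => Finset.prod_congr rfl fun j hj => ?_
      rw [Function.update_of_ne (Finset.ne_of_mem_erase hi),
        Function.update_of_ne (Finset.ne_of_mem_erase hj)]
    · refine Finset.prod_congr rfl fun j hj => ?_
      rw [Function.update_of_ne (Finset.ne_of_mem_erase hj)]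
  have hL : ∀ h : c.Conf, c.sinhVandermonde h • (α • X u (vec (c.conf h)) +
      β • Y u (vec (c.conf h)) - t u • vec (c.conf h)) = ∑ n, K n h • E n h := by
    intro h
    funext w
    have htrig : IsTrig c.N fun u => α * X u (vec (c.conf h)) w + β * Y u (vec (c.conf h)) w +
        -vec (c.conf h) w * t u :=
      (((S.trig_X _ _).const_mul α).add ((S.trig_Y _ _).const_mul β)).add (ht.const_mul _)
    have hi := IsTrig.eq_sum (ι := Fin c.N) (z := fun i => c.xi i (h i))
      (by simpa using htrig) (hz h) (hz' h) u
    simp only [Pi.smul_apply, Pi.add_apply, Pi.sub_apply, smul_eq_mul, Finset.sum_apply, hE]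
    rw [show α * X u (vec (c.conf h)) w + β * Y u (vec (c.conf h)) w - t u * vec (c.conf h) w =
      α * X u (vec (c.conf h)) w + β * Y u (vec (c.conf h)) w + -(vec (c.conf h) w * t u) by ring,
      hi, Finset.mul_sum]
    refine Finset.sum_congr rfl fun n _ => ?_
    have hne : ∏ m ∈ Finset.univ.erase n, Complex.sinh (c.xi n (h n) - c.xi m (h m)) ≠ 0 :=
      Finset.prod_ne_zero_iff.2 fun m hm => hz' h n m (Finset.ne_of_mem_erase hm).symm
    rw [sinhVandermonde_eq h n, ← mul_assoc, hK]
    field_simp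
    ring
  rw [← sub_eq_zero, map_sum, map_sum, Finset.smul_sum, Finset.smul_sum, Finset.smul_sum,
    ← Finset.sum_add_distrib, ← Finset.sum_sub_distrib]
  have h1 : ∀ h : c.Conf,
      α • X u (((∏ j, f j (h j)) * c.sinhVandermonde h) • vec (c.conf h)) +
        β • Y u (((∏ j, f j (h j)) * c.sinhVandermonde h) • vec (c.conf h)) -
        t u • ((∏ j, f j (h j)) * c.sinhVandermonde h) • vec (c.conf h) =
      ∑ n, ((∏ j, f j (h j)) * K n h) • E n h := by
    intro h
    simp only [mul_smul, ← Finset.smul_sum]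
    rw [← hL, map_smul, map_smul, map_smul, map_smul]
    module
  rw [Finset.sum_congr rfl fun h _ => h1 h, Finset.sum_comm]
  -- For fixed n only f n and E vary along the n-th string, so each partial sum is a one-site chain.
  refine Finset.sum_eq_zero fun n _ => sum_eq_zero_of_sum_update n _ fun h => ?_
  have h2 : ∀ k : Fin (c.twoS n + 1),
      ((∏ j, f j (Function.update h n k j)) * K n (Function.update h n k)) •
        E n (Function.update h n k) =
      ((∏ j ∈ Finset.univ.erase n, f j (h j)) * K n h) • (f n k • E n (Function.update h n k)) := by
    intro k
    rw [hKu, ← Finset.mul_prod_erase _ _ (Finset.mem_univ n), Function.update_self, smul_smul,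
      Finset.prod_congr rfl fun m hm => by
        rw [Function.update_of_ne (Finset.ne_of_mem_erase hm)]]
    congr 1
    ring
  rw [Finset.sum_congr rfl fun k _ => h2 k, ← Finset.smul_sum]
  have h3 := sum_chain_eq_zero (m := c.twoS n) (α := α) (β := β) (f := f n)
    (b := fun k => vec (Function.update (c.conf h) n k))
    (Xb := fun k => X (c.xi n k) (vec (Function.update (c.conf h) n k)))
    (Yb := fun k => Y (c.xi n k) (vec (Function.update (c.conf h) n k)))
    (t := fun k => t (c.xi n k)) (Xc := fun k => (x n k)⁻¹)
    (Yc := fun k => -(x n k * (c.a (c.xi n k) * c.d (c.xi n (k + 1)))))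
    (fun k hk => ?_) ?_ (fun k hk => ?_) ?_ (hf n)
  · rw [Finset.sum_range] at h3
    rw [← smul_zero ((∏ j ∈ Finset.univ.erase n, f j (h j)) * K n h), ← h3]
    congr 1
    refine Finset.sum_congr rfl fun k _ => ?_
    rw [hE]
    simp only [Function.update_self, conf_update]
  · have := S.X_vec (Function.update (c.conf h) n k) n (by rwa [Function.update_self])
    rwa [Function.update_self, Function.update_idem] at this
  · have := S.X_bottom hc (Function.update h n (Fin.last _)) n (by simp [conf])
    rwa [conf_update, Fin.val_last] at this
  · have := S.Y_vec (Function.update (c.conf h) n k) n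
    rwa [Function.update_self, Function.update_idem] at this
  · have := S.Y_top hc (Function.update h n 0) n (by simp [conf])
    rwa [conf_update, Fin.val_zero] at this

end Separated

end Chain

end XXZ

/-! ### The bra and ket bases and the eigenspaces -/

namespace XXZ

theorem prod_map_eq_mul_of_commute {ι M : Type*} [Monoid M] {l : List ι} (hl : l.Nodup) {n : ι}
    (hn : n ∈ l) {F F' : ι → M} {X : M} (h1 : F' n = F n * X) (h2 : ∀ m ≠ n, F' m = F m)
    (hX : ∀ m, Commute X (F m)) : (l.map F').prod = (l.map F).prod * X := by
  induction l with
  | nil => simp at hn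
  | cons m l ih =>
    rw [List.nodup_cons] at hl
    rw [List.map_cons, List.map_cons, List.prod_cons, List.prod_cons]
    rcases List.mem_cons.1 hn with rfl | hn'
    · have h3 : l.map F' = l.map F := List.map_congr_left fun k hk => h2 k (by
        rintro rfl; exact hl.1 hk)
      have h4 : Commute X (l.map F).prod := Commute.list_prod_right _ _ fun y hy => by
        obtain ⟨k, -, rfl⟩ := List.mem_map.1 hy
        exact hX k
      rw [h3, h1, mul_assoc, h4.eq, mul_assoc]
    · rw [ih hl.2 hn', h2 m (by rintro rfl; exact hl.1 hn'), mul_assoc]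

namespace Chain

variable (c : Chain)

/-- The row vectors `⟨h|` for arbitrary tuples of natural numbers. -/
noncomputable def braExt (g : Fin c.N → ℕ) : c.Conf → ℂ :=
  Matrix.vecMul c.reference
    ((List.finRange c.N).map fun n =>
      ((List.range (g n)).map fun k => (c.d (c.xi n (k + 1)))⁻¹ • c.C (c.xi n k)).prod).prod

/-- The column vectors `|h⟩` for arbitrary tuples of natural numbers. -/
noncomputable def ketExt (g : Fin c.N → ℕ) : c.Conf → ℂ :=
  Matrix.mulVec
    ((List.finRange c.N).map fun n =>
      ((List.range (g n)).map fun k => -((c.a (c.xi n k))⁻¹ • c.B (c.xi n k))).prod).prod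
    c.reference

theorem prod_range_update {R : Type*} [Monoid R] (F : Fin c.N → ℕ → R)
    (hF : ∀ n k m l, Commute (F n k) (F m l)) (g : Fin c.N → ℕ) (n : Fin c.N) :
    ((List.finRange c.N).map fun m =>
      ((List.range (Function.update g n (g n + 1) m)).map fun k => F m k).prod).prod =
    ((List.finRange c.N).map fun m => ((List.range (g m)).map fun k => F m k).prod).prod *
      F n (g n) := by
  refine prod_map_eq_mul_of_commute (List.nodup_finRange _) (List.mem_finRange n) ?_ ?_ ?_
  · rw [Function.update_self, List.range_succ, List.map_append, List.prod_append]
    simp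
  · intro m hm
    rw [Function.update_of_ne hm]
  · intro m
    refine Commute.list_prod_right _ _ fun y hy => ?_
    obtain ⟨k, -, rfl⟩ := List.mem_map.1 hy
    exact hF _ _ _ _

namespace Generic

variable {c} (hc : c.Generic)
include hc

theorem reference_eq : ∃ r : ℂ, r ≠ 0 ∧ c.reference = Pi.single 0 r := by
  refine ⟨_, inv_ne_zero (Finset.prod_ne_zero_iff.2 fun i _ => Finset.prod_ne_zero_iff.2
    fun j hj => ?_), rfl⟩
  rw [Ne, Complex.cpow_eq_zero_iff, not_and_or]
  exact Or.inl (hc.sinh_sep (Finset.mem_Ioi.1 hj).ne' (Nat.zero_le _) (Nat.zero_le _))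

theorem reference_ne_zero : c.reference ≠ 0 := by
  obtain ⟨r, hr, h⟩ := hc.reference_eq
  rw [h]
  simpa using hr

/-- On row vectors C raises and B lowers; the operator products appear in reversed order, which is
why the relations `C_mul_D` and `B_mul_D` enter. -/
theorem separated_bra : c.Separated (fun u => (c.C u).vecMulLinear) (fun u => (c.B u).vecMulLinear)
    (fun u => (c.D u).vecMulLinear) (fun n k => (c.d (c.xi n (k + 1)))⁻¹) c.braExt where
  D_X u v w := by
    simp only [Matrix.vecMulLinear_apply, Matrix.vecMul_vecMul]
    rw [← Matrix.vecMul_smul, C_mul_D hc.sinh_ne_zero, Matrix.vecMul_sub, Matrix.vecMul_smul,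
      Matrix.vecMul_smul]
  D_Y u v w := by
    simp only [Matrix.vecMulLinear_apply, Matrix.vecMul_vecMul]
    rw [← Matrix.vecMul_smul, B_mul_D hc.sinh_ne_zero, Matrix.vecMul_add, Matrix.vecMul_smul,
      Matrix.vecMul_smul]
  Y_X u w h := by
    simp only [Matrix.vecMulLinear_apply, Matrix.vecMul_vecMul] at h ⊢
    rw [C_mul_B hc.sinh_ne_zero, Matrix.vecMul_sub, ← Matrix.vecMul_vecMul, h, Matrix.zero_vecMul,
      Matrix.vecMul_smul, Matrix.vecMul_one, zero_sub, neg_smul]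
  vec_zero_ne := by
    have : c.braExt 0 = c.reference := by simp [braExt]
    rw [this]
    exact hc.reference_ne_zero
  D_vec_zero u := by
    have : c.braExt 0 = c.reference := by simp [braExt]
    rw [this]
    exact c.reference_vecMul_D u
  vec_succ g n := by
    rw [braExt, braExt, c.prod_range_update
      (fun n k => (c.d (c.xi n (k + 1)))⁻¹ • c.C (c.xi n k))
      fun n k m l => ((c.commute_entry hc.sinh_two_mul_ne_zero 1 0 _ _).smul_left _).smul_right _]
    rw [← Matrix.vecMul_vecMul, Matrix.vecMul_smul]
    rfl
  x_ne n k hk := inv_ne_zero (hc.d_ne_zero (by omega) hk)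
  trig_X w h := IsTrig.sum _ fun k _ => (c.isTrig_monodromy one_ne_zero k h).const_mul _
  trig_Y w h := IsTrig.sum _ fun k _ => (c.isTrig_monodromy zero_ne_one k h).const_mul _
  continuous_D w h := continuous_finsetSum _ fun k _ =>
    continuous_const.mul (c.continuous_monodromy 1 1 k h)

/-- On column vectors the roles of B and C are interchanged, and the quantum determinant is needed
in the other order, `C_mul_B'`. -/
theorem separated_ket : c.Separated (fun u => (c.B u).mulVecLin) (fun u => (c.C u).mulVecLin)
    (fun u => (c.D u).mulVecLin) (fun n k => -(c.a (c.xi n k))⁻¹) c.ketExt where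
  D_X u v w := by
    simp only [Matrix.mulVecLin_apply, Matrix.mulVec_mulVec]
    rw [← Matrix.smul_mulVec, D_mul_B hc.sinh_ne_zero, Matrix.sub_mulVec, Matrix.smul_mulVec,
      Matrix.smul_mulVec]
  D_Y u v w := by
    simp only [Matrix.mulVecLin_apply, Matrix.mulVec_mulVec]
    rw [← Matrix.smul_mulVec, D_mul_C hc.sinh_ne_zero, Matrix.add_mulVec, Matrix.smul_mulVec,
      Matrix.smul_mulVec]
  Y_X u w h := by
    simp only [Matrix.mulVecLin_apply, Matrix.mulVec_mulVec] at h ⊢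
    rw [C_mul_B' hc.sinh_ne_zero, Matrix.sub_mulVec, ← Matrix.mulVec_mulVec, h, Matrix.mulVec_zero,
      Matrix.smul_mulVec, Matrix.one_mulVec, zero_sub, neg_smul]
  vec_zero_ne := by
    have : c.ketExt 0 = c.reference := by simp [ketExt]
    rw [this]
    exact hc.reference_ne_zero
  D_vec_zero u := by
    have : c.ketExt 0 = c.reference := by simp [ketExt]
    rw [this]
    exact c.D_mulVec_reference u
  vec_succ g n := by
    have hcomm : ∀ n k m l, Commute (-((c.a (c.xi n k))⁻¹ • c.B (c.xi n k)))
        (-((c.a (c.xi m l))⁻¹ • c.B (c.xi m l))) := fun n k m l =>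
      Commute.neg_left (Commute.neg_right
        (((c.commute_entry hc.sinh_two_mul_ne_zero 0 1 _ _).smul_left _).smul_right _))
    have hX : Commute (-((c.a (c.xi n (g n)))⁻¹ • c.B (c.xi n (g n))))
      ((List.finRange c.N).map fun n =>
      ((List.range (g n)).map fun k => -((c.a (c.xi n k))⁻¹ • c.B (c.xi n k))).prod).prod := by
      refine Commute.list_prod_right _ _ fun y hy => ?_
      obtain ⟨m, -, rfl⟩ := List.mem_map.1 hy
      refine Commute.list_prod_right _ _ fun y hy => ?_
      obtain ⟨k, -, rfl⟩ := List.mem_map.1 hy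
      exact hcomm _ _ _ _
    rw [ketExt, ketExt, c.prod_range_update
      (fun n k => -((c.a (c.xi n k))⁻¹ • c.B (c.xi n k))) hcomm, ← hX.eq, ← Matrix.mulVec_mulVec,
      ← neg_smul, Matrix.smul_mulVec]
    rfl
  x_ne n k hk := neg_ne_zero.2 (inv_ne_zero (hc.a_ne_zero hk))
  trig_X w h := IsTrig.sum _ fun k _ => by
    simpa only [mul_comm, B] using (c.isTrig_monodromy zero_ne_one h k).const_mul (w k)
  trig_Y w h := IsTrig.sum _ fun k _ => by
    simpa only [mul_comm, C] using (c.isTrig_monodromy one_ne_zero h k).const_mul (w k)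
  continuous_D w h := continuous_finsetSum _ fun k _ =>
    (c.continuous_monodromy 1 1 h k).mul continuous_const

end Generic

/-! ### Eigenspaces of the transfer matrices -/

theorem mem_rightEigenspace {κ : ℂ} {t : ℂ → ℂ} {v : c.Conf → ℂ} :
    v ∈ c.rightEigenspace κ t ↔ ∀ u, (c.T κ u).mulVec v = t u • v := by
  simp [rightEigenspace, Submodule.mem_iInf]

theorem mem_leftEigenspace {κ : ℂ} {t : ℂ → ℂ} {v : c.Conf → ℂ} :
    v ∈ c.leftEigenspace κ t ↔ ∀ u, Matrix.vecMul v (c.T κ u) = t u • v := by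
  simp [leftEigenspace, Submodule.mem_iInf]

theorem T_mulVec (κ u : ℂ) (v : c.Conf → ℂ) :
    (c.T κ u).mulVec v = κ⁻¹ • (c.B u).mulVecLin v + κ • (c.C u).mulVecLin v := by
  rw [T, Matrix.add_mulVec, Matrix.smul_mulVec, Matrix.smul_mulVec]; rfl

theorem vecMul_T (κ u : ℂ) (v : c.Conf → ℂ) :
    Matrix.vecMul v (c.T κ u) = κ • (c.C u).vecMulLinear v + κ⁻¹ • (c.B u).vecMulLinear v := by
  rw [T, Matrix.vecMul_add, Matrix.vecMul_smul, Matrix.vecMul_smul, add_comm]; rfl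

/-- The entries of an eigenvalue function of the transfer matrix. -/
theorem isTrig_of_eigenvector {κ : ℂ} {t : ℂ → ℂ} {v : c.Conf → ℂ} (hv0 : v ≠ 0)
    (hv : ∀ u, (c.T κ u).mulVec v = t u • v) : IsTrig c.N t := by
  obtain ⟨k, hk⟩ := Function.ne_iff.1 hv0
  have h1 : IsTrig c.N fun u => (v k)⁻¹ * ∑ l, (κ⁻¹ * c.B u k l + κ * c.C u k l) * v l := by
    refine IsTrig.const_mul _ (IsTrig.sum _ fun l _ => ?_)
    have := (((c.isTrig_monodromy zero_ne_one k l).const_mul κ⁻¹).add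
      ((c.isTrig_monodromy one_ne_zero k l).const_mul κ)).const_mul (v l)
    simpa only [mul_comm (v l), B, C] using this
  convert h1 using 2 with u
  have h2 := congrFun (hv u) k
  rw [Pi.smul_apply, smul_eq_mul] at h2
  have h3 : (c.T κ u).mulVec v k = ∑ l, (κ⁻¹ * c.B u k l + κ * c.C u k l) * v l := rfl
  rw [← h3, h2, mul_comm, mul_assoc, mul_inv_cancel₀ hk, mul_one]

namespace Generic

variable {c} (hc : c.Generic)
include hc

omit hc in
/-- Pairing with a right eigenvector. -/
theorem pairing_right {κ : ℂ} {t : ℂ → ℂ} {v : c.Conf → ℂ}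
    (hv : v ∈ c.rightEigenspace κ t) (u : ℂ) (w : c.Conf → ℂ) :
    (dotProductBilin ℂ ℂ).flip v
      (κ • (c.C u).vecMulLinear w + κ⁻¹ • (c.B u).vecMulLinear w) =
    t u * (dotProductBilin ℂ ℂ).flip v w := by
  rw [← vecMul_T]
  change Matrix.vecMul w (c.T κ u) ⬝ᵥ v = t u * (w ⬝ᵥ v)
  rw [← Matrix.dotProduct_mulVec, (c.mem_rightEigenspace.1 hv) u, dotProduct_smul, smul_eq_mul]

omit hc in
theorem pairing_left {κ : ℂ} {t : ℂ → ℂ} {v : c.Conf → ℂ}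
    (hv : v ∈ c.leftEigenspace κ t) (u : ℂ) (w : c.Conf → ℂ) :
    dotProductBilin ℂ ℂ v
      (κ⁻¹ • (c.B u).mulVecLin w + κ • (c.C u).mulVecLin w) =
    t u * dotProductBilin ℂ ℂ v w := by
  rw [← T_mulVec]
  change v ⬝ᵥ Matrix.mulVec (c.T κ u) w = t u * (v ⬝ᵥ w)
  rw [Matrix.dotProduct_mulVec, (c.mem_leftEigenspace.1 hv) u, smul_dotProduct, smul_eq_mul]

/-- Pairing with a right eigenvector is an eigenfunctional on row vectors, so the bra recursion
determines it by its value on the reference bra. -/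
theorem right_eq_zero {κ : ℂ} (hκ : κ ≠ 0) {t : ℂ → ℂ} {v : c.Conf → ℂ}
    (hv : v ∈ c.rightEigenspace κ t) (h0 : c.braExt 0 ⬝ᵥ v = 0) : v = 0 := by
  have := hc.separated_bra.functional_eq_zero hc hκ (pairing_right hv) h0
  refine dotProduct_eq_zero_iff.1 fun w => ?_
  rw [dotProduct_comm]
  exact LinearMap.congr_fun this w

theorem left_eq_zero {κ : ℂ} (hκ : κ ≠ 0) {t : ℂ → ℂ} {v : c.Conf → ℂ}
    (hv : v ∈ c.leftEigenspace κ t) (h0 : v ⬝ᵥ c.ketExt 0 = 0) : v = 0 := by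
  have := hc.separated_ket.functional_eq_zero hc (inv_ne_zero hκ) (pairing_left hv) h0
  exact dotProduct_eq_zero_iff.1 fun w => LinearMap.congr_fun this w

omit hc in
theorem _root_.Submodule.eq_span_singleton_of_functional {V : Type*} [AddCommGroup V] [Module ℂ V]
    {W : Submodule ℂ V} {ψ : V →ₗ[ℂ] ℂ} (hψ : ∀ v ∈ W, ψ v = 0 → v = 0) {v₀ : V} (h₀ : v₀ ∈ W)
    (hv₀ : v₀ ≠ 0) : W = Submodule.span ℂ {v₀} := by
  refine le_antisymm (fun v hv => ?_) ((Submodule.span_singleton_le_iff_mem _ _).2 h₀)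
  have h1 : ψ v₀ ≠ 0 := fun h => hv₀ (hψ v₀ h₀ h)
  refine Submodule.mem_span_singleton.2 ⟨ψ v / ψ v₀, ?_⟩
  have h2 := hψ (v - (ψ v / ψ v₀) • v₀) (W.sub_mem hv (W.smul_mem _ h₀)) (by
    rw [map_sub, map_smul, smul_eq_mul, div_mul_cancel₀ _ h1, sub_self])
  exact (sub_eq_zero.1 h2).symm

theorem right_eq_span {κ : ℂ} (hκ : κ ≠ 0) {t : ℂ → ℂ} {v : c.Conf → ℂ}
    (hv : v ∈ c.rightEigenspace κ t) (hv0 : v ≠ 0) :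
    c.rightEigenspace κ t = Submodule.span ℂ {v} :=
  Submodule.eq_span_singleton_of_functional (ψ := dotProductBilin ℂ ℂ (c.braExt 0))
    (fun _ hw h0 => hc.right_eq_zero hκ hw h0) hv hv0

theorem left_eq_span {κ : ℂ} (hκ : κ ≠ 0) {t : ℂ → ℂ} {v : c.Conf → ℂ}
    (hv : v ∈ c.leftEigenspace κ t) (hv0 : v ≠ 0) :
    c.leftEigenspace κ t = Submodule.span ℂ {v} :=
  Submodule.eq_span_singleton_of_functional (ψ := (dotProductBilin ℂ ℂ).flip (c.ketExt 0))
    (fun _ hw h0 => hc.left_eq_zero hκ hw h0) hv hv0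

/-- The discrete Baxter equation along each string, for an eigenvalue function. -/
theorem exists_discrete_solution {κ : ℂ} (hκ : κ ≠ 0) {t : ℂ → ℂ} {v : c.Conf → ℂ}
    (hv : v ∈ c.rightEigenspace κ t) (hv0 : v ≠ 0) (n : Fin c.N) :
    ∃ g : ℕ → ℂ, g 0 ≠ 0 ∧ ∀ k ≤ c.twoS n, t (c.xi n k) * g k =
      -(c.a (c.xi n k) * g (k + 1)) + c.d (c.xi n k) * g (k - 1) := by
  set ψ : ℕ → ℂ := fun k => c.braExt (Function.update 0 n k) ⬝ᵥ v with hψ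
  -- A gauge factor which turns the κ-dependent recursion for the bra components into the normalized
  -- Baxter form. It satisfies a(ξ^(k)) γ_(k+1) = -κ d(ξ^(k+1)) γ_k.
  set γ : ℕ → ℂ := fun k =>
    (-κ) ^ k * ∏ l ∈ Finset.range k, (c.d (c.xi n (l + 1)) / c.a (c.xi n l)) with hγ
  have hγs : ∀ k, k < c.twoS n →
      c.a (c.xi n k) * γ (k + 1) = -κ * c.d (c.xi n (k + 1)) * γ k := by
    intro k hk
    have := hc.a_ne_zero hk
    simp only [hγ, Finset.prod_range_succ, pow_succ]
    field_simp
  refine ⟨fun k => γ k * ψ k, ?_, fun k hk => ?_⟩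
  · have h1 : γ 0 = 1 := by simp [hγ]
    have h2 : ψ 0 = c.braExt 0 ⬝ᵥ v := by
      simp only [hψ]
      congr 2
      exact Function.update_eq_self n 0
    beta_reduce
    rw [h1, one_mul, h2]
    exact fun h => hv0 (hc.right_eq_zero hκ hv h)
  · have hrec := hc.separated_bra.functional_recursion hc (pairing_right hv)
      (Function.update 0 n ⟨k, by omega⟩) n
    have h0 : c.conf 0 = 0 := rfl
    rw [conf_update, Function.update_self, Function.update_idem, Function.update_idem, h0] at hrec
    change t (c.xi n k) * ψ k = (if k = c.twoS n then 0 else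
      κ * ((c.d (c.xi n (k + 1)))⁻¹)⁻¹ * ψ (k + 1)) + (if k = 0 then 0 else
      κ⁻¹ * -((c.d (c.xi n (k - 1 + 1)))⁻¹ * (c.a (c.xi n (k - 1)) * c.d (c.xi n k))) *
        ψ (k - 1)) at hrec
    beta_reduce
    rw [mul_left_comm, hrec, mul_add]
    congr 1
    · split_ifs with h1
      · rw [h1, c.a_bottom]; ring
      · rw [inv_inv]
        linear_combination ψ (k + 1) * hγs k (lt_of_le_of_ne hk h1)
    · split_ifs with h1
      · rw [h1, c.d_top]; ring
      · obtain ⟨k, rfl⟩ := Nat.exists_eq_succ_of_ne_zero h1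
        have h2 := hγs k (by omega)
        have h3 := hc.d_ne_zero (n := n) (k := k + 1) (by omega) hk
        simp only [Nat.succ_eq_add_one, Nat.add_sub_cancel]
        field_simp
        linear_combination (-ψ k) * h2

/-- The separated left state built from solutions of the discrete Baxter equations. -/
theorem left_separated_mem {κ : ℂ} (hκ : κ ≠ 0) {t : ℂ → ℂ} (ht : IsTrig c.N t)
    {ε : Fin c.N → ℤˣ} {q : Fin c.N → ℕ → ℂ}
    (hq : ∀ n, ∀ k ≤ c.twoS n, t (c.xi n k) * q n k = ((ε n : ℤ) : ℂ) *
      (-(c.a (c.xi n k) * q n (k + 1)) + c.d (c.xi n k) * q n (k - 1))) :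
    (∑ h : c.Conf, ((∏ j, (((ε j : ℤ) : ℂ) * κ) ^ (h j : ℕ) * q j (h j)) * c.sinhVandermonde h) •
      c.bra h) ∈ c.leftEigenspace κ t := by
  have hε : ∀ n, ((ε n : ℤ) : ℂ) * ((ε n : ℤ) : ℂ) = 1 := by
    intro n
    rcases Int.units_eq_one_or (ε n) with h | h <;> simp [h]
  rw [mem_leftEigenspace]
  intro u
  rw [vecMul_T]
  refine hc.separated_bra.separated_eigenvector hc ht
    (f := fun n k => (((ε n : ℤ) : ℂ) * κ) ^ k * q n k) (fun n k hk => ?_) u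
  rw [mul_left_comm, hq n k hk, mul_add, mul_add, add_comm]
  congr 1
  · split_ifs with h1
    · rw [h1, c.d_top]; ring
    · obtain ⟨k, rfl⟩ := Nat.exists_eq_succ_of_ne_zero h1
      simp only [Nat.succ_eq_add_one, Nat.add_sub_cancel, inv_inv, pow_succ]
      linear_combination (κ * (((ε n : ℤ) : ℂ) * κ) ^ k * (c.d (c.xi n (k + 1)) * q n k)) * hε n
  · split_ifs with h1
    · rw [h1, c.a_bottom]; ring
    · have h3 := hc.d_ne_zero (n := n) (k := k + 1) (by omega) (lt_of_le_of_ne hk h1)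
      rw [pow_succ]
      field_simp

/-- The separated right state built from solutions of the discrete Baxter equations. -/
theorem right_separated_mem {κ : ℂ} (hκ : κ ≠ 0) {t : ℂ → ℂ} (ht : IsTrig c.N t)
    {ε : Fin c.N → ℤˣ} {q : Fin c.N → ℕ → ℂ}
    (hq : ∀ n, ∀ k ≤ c.twoS n, t (c.xi n k) * q n k = ((ε n : ℤ) : ℂ) *
      (-(c.a (c.xi n k) * q n (k + 1)) + c.d (c.xi n k) * q n (k - 1))) :
    (∑ h : c.Conf, ((∏ j, (-(((ε j : ℤ) : ℂ) * κ)) ^ (-((h j : ℕ) : ℤ)) *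
        (∏ l ∈ Finset.range (h j), c.a (c.xi j l) / c.d (c.xi j (l + 1))) * q j (h j)) *
        c.sinhVandermonde h) • c.ket h) ∈ c.rightEigenspace κ t := by
  have hε : ∀ n, ((ε n : ℤ) : ℂ) * ((ε n : ℤ) : ℂ) = 1 := by
    intro n
    rcases Int.units_eq_one_or (ε n) with h | h <;> simp [h]
  rw [mem_rightEigenspace]
  intro u
  rw [T_mulVec]
  refine hc.separated_ket.separated_eigenvector hc ht
    (f := fun n k => (-(((ε n : ℤ) : ℂ) * κ)) ^ (-(k : ℤ)) *
      (∏ l ∈ Finset.range k, c.a (c.xi n l) / c.d (c.xi n (l + 1))) * q n k) (fun n k hk => ?_) u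
  have hε0 : ((ε n : ℤ) : ℂ) ≠ 0 := left_ne_zero_of_mul_eq_one (hε n)
  rw [mul_left_comm, hq n k hk, mul_add, mul_add, add_comm]
  simp only [zpow_neg, zpow_natCast]
  congr 1
  · split_ifs with h1
    · rw [h1, c.d_top]; ring
    · obtain ⟨k, rfl⟩ := Nat.exists_eq_succ_of_ne_zero h1
      have h3 := hc.d_ne_zero (n := n) (k := k + 1) (by omega) hk
      have h4 := hc.a_ne_zero (n := n) (k := k) (by omega)
      simp only [Nat.succ_eq_add_one, Nat.add_sub_cancel, inv_neg, inv_inv, pow_succ,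
        Finset.prod_range_succ]
      have h5 : (-(((ε n : ℤ) : ℂ) * κ)) ^ k ≠ 0 :=
        pow_ne_zero _ (neg_ne_zero.2 (mul_ne_zero hε0 hκ))
      generalize (-(((ε n : ℤ) : ℂ) * κ)) ^ k = p at h5
      field_simp
  · split_ifs with h1
    · rw [h1, c.a_bottom]; ring
    · have h3 := hc.d_ne_zero (n := n) (k := k + 1) (by omega) (lt_of_le_of_ne hk h1)
      have h4 := hc.a_ne_zero (n := n) (k := k) (lt_of_le_of_ne hk h1)
      rw [pow_succ, Finset.prod_range_succ]
      have h5 : (-(((ε n : ℤ) : ℂ) * κ)) ^ k ≠ 0 :=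
        pow_ne_zero _ (neg_ne_zero.2 (mul_ne_zero hε0 hκ))
      generalize (-(((ε n : ℤ) : ℂ) * κ)) ^ k = p at h5
      field_simp
      rw [sq, hε n, mul_one]

end Generic

end Chain

end XXZ

/-! ### Exponential polynomials and the functions Q -/

namespace XXZ

open Polynomial

/-- The exponential misses only 0, and a factor X makes both sides agree there. -/
theorem eq_of_eval_exp {p r : ℂ[X]} (h : ∀ u, p.eval (Complex.exp u) = r.eval (Complex.exp u)) :
    p = r := by
  refine mul_left_cancel₀ X_ne_zero (Polynomial.funext fun x => ?_)
  rw [eval_mul, eval_mul, eval_X]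
  rcases eq_or_ne x 0 with rfl | hx
  · rw [zero_mul, zero_mul]
  · rw [← Complex.exp_log hx, h]

theorem eval_neg_of_odd {τ : ℂ[X]} (hτ : dilate (-1) τ = -τ) (x : ℂ) :
    τ.eval (-x) = -τ.eval x := by
  rw [← eval_neg, ← hτ, eval_dilate, neg_one_mul]

/-- The odd polynomial of degree less than `2 n` that represents a trigonometric polynomial. -/
theorem isTrig_iff_exists_odd {n : ℕ} {t : ℂ → ℂ} {κ : ℂ} (hκ : κ ≠ 0) :
    IsTrig n t ↔ ∃ τ : ℂ[X], dilate (-1) τ = -τ ∧ τ.degree < (2 * n : ℕ) ∧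
      ∀ u, t u = κ * Complex.exp (-(n * u)) * τ.eval (Complex.exp u) := by
  constructor
  · rintro ⟨r, hr, hrt⟩
    refine ⟨C κ⁻¹ * (X * r.comp (X ^ 2)), ?_, ?_, fun u => ?_⟩
    · refine Polynomial.funext fun x => ?_
      rw [eval_dilate]
      simp [eval_comp]
    · rcases eq_or_ne r 0 with rfl | hr0
      · rw [zero_comp, mul_zero, mul_zero, degree_zero]
        exact WithBot.bot_lt_coe _
      have h1 : r.natDegree < n := (natDegree_lt_iff_degree_lt hr0).2 hr
      refine degree_le_natDegree.trans_lt (Nat.cast_lt.2 ?_)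
      have h2 : (C κ⁻¹ * (X * r.comp (X ^ 2))).natDegree ≤ 1 + r.natDegree * 2 := by
        refine (natDegree_C_mul_le _ _).trans (natDegree_mul_le.trans ?_)
        rw [natDegree_X, natDegree_comp, natDegree_X_pow]
      omega
    · rw [hrt, eval_mul, eval_C, eval_mul, eval_X, eval_comp, eval_pow, eval_X,
        ← Complex.exp_nat_mul, sub_eq_add_neg, Complex.exp_add]
      push_cast
      field_simp
  · rintro ⟨τ, hτ, hdeg, hrt⟩
    have hodd : ∀ k, τ.coeff (2 * k) = 0 := by
      intro k
      have := congrArg (fun p : ℂ[X] => p.coeff (2 * k)) hτ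
      simp only [dilate, comp_C_mul_X_coeff, coeff_neg, pow_mul, neg_one_sq, one_pow,
        mul_one] at this
      exact self_eq_neg.1 this
    have e : τ = X * expand ℂ 2 (contract 2 τ.divX) := by
      ext k
      rcases k with _ | k
      · rw [coeff_X_mul_zero]
        exact hodd 0
      · rw [coeff_X_mul, coeff_expand two_pos]
        split_ifs with h
        · obtain ⟨l, rfl⟩ := h
          rw [Nat.mul_div_cancel_left _ two_pos, coeff_contract two_ne_zero, coeff_divX, mul_comm]
        · rw [show k + 1 = 2 * ((k + 1) / 2) by omega]
          exact hodd _
    refine ⟨C κ * contract 2 τ.divX, ?_, fun u => ?_⟩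
    · rw [degree_lt_iff_coeff_zero] at hdeg ⊢
      intro k hk
      rw [coeff_C_mul, coeff_contract two_ne_zero, coeff_divX, hdeg _ (by omega), mul_zero]
    · rw [hrt, e, eval_mul, eval_X, expand_eval, ← Complex.exp_nat_mul, eval_mul, eval_C,
        sub_eq_add_neg, Complex.exp_add, ← e]
      push_cast
      ring

/-- Division of an exponential polynomial by factors `exp u - exp μ`, when the quotient is
continuous. -/
theorem exists_eval_exp_of_mul_prod {F : ℂ → ℂ} (hF : Continuous F) (Λ : Multiset ℂ) {R : ℂ[X]}
    (h : ∀ u, F u * (Λ.map fun μ => X - C (Complex.exp μ)).prod.eval (Complex.exp u) =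
      R.eval (Complex.exp u)) :
    ∃ τ : ℂ[X], R = τ * (Λ.map fun μ => X - C (Complex.exp μ)).prod ∧
      ∀ u, F u = τ.eval (Complex.exp u) := by
  induction Λ using Multiset.induction_on generalizing R with
  | empty => exact ⟨R, by simp, by simpa using h⟩
  | cons μ Λ ih =>
    simp only [Multiset.map_cons, Multiset.prod_cons, eval_mul, eval_sub, eval_X, eval_C] at h ⊢
    -- At u = μ the left side vanishes, so R has the root exp μ.
    obtain ⟨R', rfl⟩ : X - C (Complex.exp μ) ∣ R := by
      rw [dvd_iff_isRoot, IsRoot, ← h]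
      simp
    obtain ⟨τ, hτ, hFτ⟩ := ih (R := R') fun u => by
      refine eq_of_sinh_mul_eq (v := μ)
        (f := fun u => F u * (Λ.map fun μ => X - C (Complex.exp μ)).prod.eval (Complex.exp u))
        (g := fun u => R'.eval (Complex.exp u)) (by fun_prop) (by fun_prop) (fun u => ?_) u
      have e : Complex.sinh (u - μ) = (Complex.exp u + Complex.exp μ) *
          Complex.exp (-(u + μ)) / 2 * (Complex.exp u - Complex.exp μ) := by
        rw [Complex.sinh, neg_sub, neg_add, Complex.exp_sub, Complex.exp_sub, Complex.exp_add,
          Complex.exp_neg, Complex.exp_neg]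
        have := Complex.exp_ne_zero u
        have := Complex.exp_ne_zero μ
        field_simp
        ring
      have h1 := h u
      rw [eval_mul, eval_sub, eval_X, eval_C] at h1
      rw [e]
      linear_combination (Complex.exp u + Complex.exp μ) * Complex.exp (-(u + μ)) / 2 * h1
    exact ⟨τ, by rw [hτ]; ring, hFτ⟩

/-! ### The functions `Q` -/

theorem Q_one (Λ : Multiset ℂ) (u : ℂ) :
    Q Λ 1 u = (Λ.map fun μ => Complex.sinh ((u - μ) / 2)).prod := by
  simp [Q]

theorem Q_neg_one (Λ : Multiset ℂ) (u : ℂ) : Q Λ (-1) u = Q Λ 1 (u + Complex.I * Real.pi) := by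
  rw [Q_one, Q]
  refine congrArg _ (Multiset.map_congr rfl fun μ _ => congrArg _ ?_)
  push_cast
  ring

theorem Q_one_eq_zero_iff {Λ : Multiset ℂ} {u : ℂ} :
    Q Λ 1 u = 0 ↔ ∃ μ ∈ Λ, ∃ l : ℤ, u = μ + 2 * Complex.I * l * Real.pi := by
  rw [Q_one, Multiset.prod_eq_zero_iff, Multiset.mem_map]
  refine exists_congr fun μ => and_congr_right fun _ => ?_
  rw [sinh_eq_zero_iff]
  refine exists_congr fun l => ?_
  constructor
  · intro h
    linear_combination 2 * h
  · intro h
    linear_combination h / 2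

/-- The monic polynomial with roots `exp μ`. -/
noncomputable def bethePoly (Λ : Multiset ℂ) : ℂ[X] := (Λ.map fun μ => X - C (Complex.exp μ)).prod

theorem bethePoly_monic (Λ : Multiset ℂ) : (bethePoly Λ).Monic :=
  monic_multiset_prod_of_monic _ _ fun _ _ => monic_X_sub_C _

theorem natDegree_bethePoly (Λ : Multiset ℂ) : (bethePoly Λ).natDegree = Multiset.card Λ := by
  rw [bethePoly, natDegree_multiset_prod_of_monic]
  · simp
  · intro p hp
    obtain ⟨μ, -, rfl⟩ := Multiset.mem_map.1 hp
    exact monic_X_sub_C _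

theorem bethePoly_eval_eq_Q (Λ : Multiset ℂ) : ∃ K : ℂ, K ≠ 0 ∧ ∀ u,
    Q Λ 1 u =
      K * Complex.exp (-(Multiset.card Λ * u / 2)) * (bethePoly Λ).eval (Complex.exp u) := by
  induction Λ using Multiset.induction_on with
  | empty => exact ⟨1, one_ne_zero, by simp [Q, bethePoly]⟩
  | cons μ Λ ih =>
    obtain ⟨K, hK, h⟩ := ih
    refine ⟨Complex.exp (-(μ / 2)) / 2 * K, mul_ne_zero (div_ne_zero (Complex.exp_ne_zero _)
      two_ne_zero) hK, fun u => ?_⟩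
    have h1 := h u
    rw [Q_one] at h1 ⊢
    have h2 : bethePoly (μ ::ₘ Λ) = (X - C (Complex.exp μ)) * bethePoly Λ := by
      rw [bethePoly, Multiset.map_cons, Multiset.prod_cons, bethePoly]
    rw [Multiset.map_cons, Multiset.prod_cons, h1, h2, Multiset.card_cons, eval_mul, eval_sub,
      eval_X, eval_C]
    have e : Complex.sinh ((u - μ) / 2) =
        Complex.exp (-(μ / 2)) / 2 * Complex.exp (-(u / 2)) * (Complex.exp u - Complex.exp μ) := by
      rw [show Complex.exp u = Complex.exp (u / 2) ^ 2 by rw [← Complex.exp_nat_mul]; congr 1; ring,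
        show Complex.exp μ = Complex.exp (μ / 2) ^ 2 by rw [← Complex.exp_nat_mul]; congr 1; ring,
        Complex.sinh, sub_div u μ 2, neg_sub, Complex.exp_sub, Complex.exp_sub, Complex.exp_neg,
        Complex.exp_neg]
      have := Complex.exp_ne_zero (u / 2)
      have := Complex.exp_ne_zero (μ / 2)
      field_simp
    rw [e, show -((Multiset.card Λ + 1 : ℕ) * u / 2) = -(u / 2) + -(Multiset.card Λ * u / 2) by
      push_cast; ring, Complex.exp_add]
    ring

theorem continuous_Q (Λ : Multiset ℂ) : Continuous (Q Λ 1) := by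
  obtain ⟨K, -, h⟩ := bethePoly_eval_eq_Q Λ
  rw [funext h]
  fun_prop

/-- Continuous functions which agree away from the zeros of `Q` are equal. -/
theorem eq_of_eq_of_sinh_ne {Λ : Multiset ℂ} {f g : ℂ → ℂ} (hf : Continuous f) (hg : Continuous g)
    (h : ∀ u, (∀ μ ∈ Λ, Complex.sinh ((u - μ) / 2) ≠ 0) → f u = g u) (u : ℂ) : f u = g u := by
  have h1 : Filter.Tendsto f (nhdsWithin u {u}ᶜ) (nhds (f u)) :=
    hf.continuousAt.mono_left nhdsWithin_le_nhds
  have h2 : Filter.Tendsto g (nhdsWithin u {u}ᶜ) (nhds (g u)) :=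
    hg.continuousAt.mono_left nhdsWithin_le_nhds
  refine tendsto_nhds_unique h1 (h2.congr' ?_)
  have h3 : ∀ᶠ z in nhdsWithin u {u}ᶜ, ∀ μ ∈ Λ.toFinset, Complex.sinh (z - μ) ≠ 0 :=
    (Filter.eventually_all_finset _).2 fun μ _ => sinh_eventually_ne
  filter_upwards [h3] with z hz
  refine (h z fun μ hμ h0 => hz μ (Multiset.mem_toFinset.2 hμ) ?_).symm
  rw [show z - μ = 2 * ((z - μ) / 2) by ring, Complex.sinh_two_mul, h0]
  ring

namespace Chain

variable {c : Chain}

theorem Q_ne_zero {Λ : Multiset ℂ} {u : ℂ} (h : ∀ μ ∈ Λ, Complex.sinh ((u - μ) / 2) ≠ 0) :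
    Q Λ 1 u ≠ 0 := by
  rw [Q_one, Ne, Multiset.prod_eq_zero_iff, Multiset.mem_map]
  rintro ⟨μ, hμ, h0⟩
  exact h μ hμ h0

theorem betheExpr_eq (Λ : Multiset ℂ) (u : ℂ) :
    c.betheExpr Λ u =
      -c.a u * (Q Λ 1 (u - c.η) / Q Λ 1 u) + c.d u * (Q Λ 1 (u + c.η) / Q Λ 1 u) := by
  simp only [betheExpr, Q_one, Multiset.prod_map_div]
  congr 6
  · funext μ
    congr 2; ring
  · funext μ
    congr 2; ring

theorem continuous_a : Continuous c.a := by unfold a; fun_prop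

theorem continuous_d : Continuous c.d := by unfold d; fun_prop

/-- The functional Baxter equation. -/
theorem isEntireBethe_iff {Λ : Multiset ℂ} {t : ℂ → ℂ} :
    c.IsEntireBethe Λ t ↔ Differentiable ℂ t ∧ ∀ u,
      t u * Q Λ 1 u = -(c.a u * Q Λ 1 (u - c.η)) + c.d u * Q Λ 1 (u + c.η) := by
  refine and_congr_right fun ht => ⟨fun h => ?_, fun h u hu => ?_⟩
  · have := continuous_Q Λ
    have := c.continuous_a
    have := c.continuous_d
    have := ht.continuous
    refine eq_of_eq_of_sinh_ne (Λ := Λ) (by fun_prop) (by fun_prop) fun u hu => ?_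
    have h0 := Q_ne_zero hu
    rw [h u hu, betheExpr_eq]
    field_simp
  · have h0 := Q_ne_zero hu
    rw [betheExpr_eq, eq_comm]
    have := h u
    field_simp
    linear_combination -this

theorem IsEntireBethe.unique {Λ : Multiset ℂ} {t t' : ℂ → ℂ} (h : c.IsEntireBethe Λ t)
    (h' : c.IsEntireBethe Λ t') : t = t' :=
  funext fun u => eq_of_eq_of_sinh_ne (Λ := Λ) h.1.continuous h'.1.continuous
    (fun u hu => (h.2 u hu).trans (h'.2 u hu).symm) u

theorem prod_sinh_add_pi (z : Fin c.N → ℂ) (u : ℂ) :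
    ∏ n, Complex.sinh (u + Complex.I * Real.pi - z n) =
      (-1) ^ c.N * ∏ n, Complex.sinh (u - z n) := by
  have h : ∀ n, Complex.sinh (u + Complex.I * Real.pi - z n) = -1 * Complex.sinh (u - z n) := by
    intro n
    rw [show u + Complex.I * Real.pi - z n = u - z n + Real.pi * Complex.I by ring,
      Complex.sinh_add_pi_mul_I, neg_one_mul]
  simp only [h, Finset.prod_mul_distrib, Finset.prod_const, Finset.card_univ, Fintype.card_fin]

/-- The Baxter equations for the two functions `Q`. -/
theorem IsEntireBethe.equation {Λ : Multiset ℂ} {t : ℂ → ℂ} (h : c.IsEntireBethe Λ t)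
    (hπ : ∀ u, t (u + Complex.I * Real.pi) = (-1 : ℂ) ^ ((c.N : ℤ) - 1) * t u) (ε : ℤˣ) (u : ℂ) :
    t u * Q Λ ε u = ((ε : ℤ) : ℂ) * (-(c.a u * Q Λ ε (u - c.η)) + c.d u * Q Λ ε (u + c.η)) := by
  have h1 := (isEntireBethe_iff.1 h).2
  rcases Int.units_eq_one_or ε with rfl | rfl
  · simpa using h1 u
  -- A shift by iπ multiplies a and d by (-1)^N but t by (-1)^(N-1); the relative sign is the factor
  -- ε = -1.
  · have h2 := h1 (u + Complex.I * Real.pi)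
    rw [hπ, a_eq, d_eq, prod_sinh_add_pi, prod_sinh_add_pi, ← a_eq, ← d_eq,
      zpow_sub_one₀ (by norm_num), zpow_natCast] at h2
    simp only [Q_neg_one]
    rw [show u - c.η + Complex.I * Real.pi = u + Complex.I * Real.pi - c.η by ring,
      show u + c.η + Complex.I * Real.pi = u + Complex.I * Real.pi + c.η by ring]
    have h3 : ((-1 : ℂ) ^ c.N) ^ 2 = 1 := by rw [← pow_mul, mul_comm, pow_mul, neg_one_sq, one_pow]
    set y := Complex.I * (Real.pi : ℂ)
    have h4 := congrArg (fun z => (-1 : ℂ) ^ c.N * z) h2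
    norm_num at h4 ⊢
    linear_combination -h4 - (t u * Q Λ 1 (u + y) - c.a u * Q Λ 1 (u + y - c.η) +
      c.d u * Q Λ 1 (u + y + c.η)) * h3

end Chain

end XXZ

/-! ### Translation between the functional and the polynomial Baxter equation -/

namespace XXZ

open Polynomial

/-- For deg q = M the two terms on the right have opposite top coefficients, σ^M σ^(-M) = 1 up to
sign, so τ q loses its leading degree. -/
theorem BaxterData.IsSolution.degree_lt {ι : Type*} [Fintype ι] {b : BaxterData ι} {τ q : ℂ[X]}
    (h : b.IsSolution τ q) (hq : q.Monic) (hdeg : q.natDegree = b.M) :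
    τ.degree < (2 * Fintype.card ι : ℕ) := by
  have hσ := b.σ_ne_zero
  have hl : ∀ s : ℂ, (dilate s q).coeff b.M = s ^ b.M := by
    intro s
    rw [dilate, comp_C_mul_X_coeff, ← hdeg, coeff_natDegree, hq.leadingCoeff, one_mul]
  have h2 := natDegree_dilate (inv_ne_zero hσ) q
  have h3 := natDegree_dilate hσ q
  rw [hdeg] at h2 h3
  have e2 := coeff_mul_add_eq_of_natDegree_le b.natDegree_polyA.le h2.le
  have e3 := coeff_mul_add_eq_of_natDegree_le b.natDegree_polyD.le h3.le
  have hlt : (τ * q).degree < (2 * Fintype.card ι + b.M : ℕ) := by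
    rw [degree_lt_iff_coeff_zero, h]
    intro k hk
    rcases hk.eq_or_lt with rfl | hk
    · rw [coeff_add, coeff_neg, e2, e3, hl, hl, ← b.natDegree_polyA, coeff_natDegree,
        b.natDegree_polyA, ← b.natDegree_polyD, coeff_natDegree, leadingCoeff_polyA,
        leadingCoeff_polyD]
      ring
    · refine coeff_eq_zero_of_natDegree_lt (lt_of_le_of_lt (natDegree_add_le _ _) (max_lt ?_ ?_))
      · rw [natDegree_neg]
        refine natDegree_mul_le.trans_lt ?_
        rwa [b.natDegree_polyA, h2]
      · refine natDegree_mul_le.trans_lt ?_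
        rwa [b.natDegree_polyD, h3]
  rcases eq_or_ne τ 0 with rfl | h0
  · rw [degree_zero]; exact WithBot.bot_lt_coe _
  · rw [degree_eq_natDegree (mul_ne_zero h0 hq.ne_zero), natDegree_mul h0 hq.ne_zero, hdeg,
      Nat.cast_lt] at hlt
    rw [degree_eq_natDegree h0, Nat.cast_lt]
    omega

namespace Chain

variable {c : Chain}

/-- The polynomial Baxter problem attached to a generic chain, in the variable `exp u`. -/
noncomputable def Generic.baxterData (hc : c.Generic) : BaxterData (Fin c.N) where
  σ := Complex.exp c.η
  δ n := Complex.exp (2 * c.xi n 0)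
  m := c.twoS
  pow_ne_one := hc.exp_pow
  σ_ne_zero := Complex.exp_ne_zero _
  δ_ne_zero n := Complex.exp_ne_zero _
  strings_disjoint n n' hn k hk k' hk' h := by
    refine hc.sinh_sep hn hk hk' (exp_two_mul_eq_iff.1 ?_)
    have e : ∀ n k, Complex.exp (2 * c.xi n k) =
        Complex.exp (2 * c.xi n 0) * ((Complex.exp c.η)⁻¹ ^ 2) ^ k := by
      intro n k
      rw [← Complex.exp_neg, ← pow_mul, ← Complex.exp_nat_mul, ← Complex.exp_add, xi, xi]
      congr 1
      push_cast
      ring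
    rw [e n k, h, ← e n' k']

variable (c)

/-- The normalization between `a`, `d` and their polynomial counterparts. -/
noncomputable def normConst : ℂ := ∏ n, Complex.exp (-c.ξ n) / 2

theorem normConst_ne_zero : c.normConst ≠ 0 :=
  Finset.prod_ne_zero_iff.2 fun _ _ => div_ne_zero (Complex.exp_ne_zero _) two_ne_zero

theorem exp_Ns (z : ℂ) : Complex.exp (c.Ns * z) = ∏ n, Complex.exp (c.twoS n * z) := by
  rw [← Complex.exp_sum, Ns, Nat.cast_sum, Finset.sum_mul]

theorem exp_xi (n : Fin c.N) (k : ℕ) :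
    Complex.exp (c.xi n k) = Complex.exp (c.xi n 0) * (Complex.exp c.η)⁻¹ ^ k := by
  rw [← Complex.exp_neg, ← Complex.exp_nat_mul, ← Complex.exp_add, xi, xi]
  congr 1
  push_cast
  ring

theorem sinh_sub_eq (u z : ℂ) : Complex.sinh (u - z) =
    Complex.exp (-u) * (Complex.exp (-z) / 2) * (Complex.exp u ^ 2 - Complex.exp (2 * z)) := by
  rw [Complex.sinh, neg_sub, Complex.exp_sub, Complex.exp_sub, Complex.exp_neg, Complex.exp_neg,
    two_mul, Complex.exp_add]
  have := Complex.exp_ne_zero u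
  have := Complex.exp_ne_zero z
  field_simp

theorem prod_sinh_sub_eq (u : ℂ) (z : Fin c.N → ℂ) : ∏ n, Complex.sinh (u - z n) =
    Complex.exp (-(c.N * u)) * (∏ n, Complex.exp (-z n) / 2) *
      ∏ n, (Complex.exp u ^ 2 - Complex.exp (2 * z n)) := by
  simp only [sinh_sub_eq, Finset.prod_mul_distrib, Finset.prod_const, Finset.card_univ,
    Fintype.card_fin, ← Complex.exp_nat_mul, mul_neg]

namespace Generic

variable {c} (hc : c.Generic)

theorem baxterData_M : hc.baxterData.M = c.Ns := rfl

/-- The factor exp (-N_s η / 2) is split off so that it cancels the half-integer exponential from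
shifting the argument of Q; the compensating power σ^M is built into `polyA`. The analogous split
for d has the opposite signs. -/
theorem a_eq_polyA (u : ℂ) : c.a u = c.normConst * Complex.exp (-(c.N * u)) *
    Complex.exp (-(c.Ns * (c.η / 2))) * hc.baxterData.polyA.eval (Complex.exp u) := by
  have h1 : ∏ n, Complex.exp (-c.xi n (c.twoS n)) / 2 =
      c.normConst * Complex.exp (c.Ns * (c.η / 2)) := by
    rw [exp_Ns, normConst, ← Finset.prod_mul_distrib]
    refine Finset.prod_congr rfl fun n _ => ?_
    rw [div_mul_eq_mul_div, ← Complex.exp_add, xi, s]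
    congr 2
    ring
  rw [a_eq, prod_sinh_sub_eq, h1, BaxterData.polyA, eval_mul, eval_C, eval_prod]
  have h2 : Complex.exp (c.Ns * (c.η / 2)) =
      Complex.exp (-(c.Ns * (c.η / 2))) * hc.baxterData.σ ^ hc.baxterData.M := by
    change _ = _ * Complex.exp c.η ^ c.Ns
    rw [← Complex.exp_nat_mul, ← Complex.exp_add]
    congr 1
    ring
  have h3 : ∀ n, (X ^ 2 - Polynomial.C
      (hc.baxterData.δ n * (hc.baxterData.σ⁻¹ ^ 2) ^ hc.baxterData.m n) : ℂ[X]).eval (Complex.exp u) = Complex.exp u ^ 2 - Complex.exp (2 * c.xi n (c.twoS n)) := by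
    intro n
    rw [eval_sub, eval_pow, eval_X, eval_C, two_mul, Complex.exp_add, exp_xi]
    change _ - Complex.exp (2 * c.xi n 0) * ((Complex.exp c.η)⁻¹ ^ 2) ^ c.twoS n = _
    rw [two_mul, Complex.exp_add]
    ring
  rw [Finset.prod_congr rfl fun n _ => h3 n, h2]
  ring

theorem d_eq_polyD (u : ℂ) : c.d u = c.normConst * Complex.exp (-(c.N * u)) *
    Complex.exp (c.Ns * (c.η / 2)) * hc.baxterData.polyD.eval (Complex.exp u) := by
  have h1 : ∏ n, Complex.exp (-c.xi n 0) / 2 =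
      c.normConst * Complex.exp (c.Ns * -(c.η / 2)) := by
    rw [exp_Ns, normConst, ← Finset.prod_mul_distrib]
    refine Finset.prod_congr rfl fun n _ => ?_
    rw [div_mul_eq_mul_div, ← Complex.exp_add, xi, s]
    congr 2
    push_cast
    ring
  rw [d_eq, prod_sinh_sub_eq, h1, BaxterData.polyD, eval_mul, eval_C, eval_prod]
  have h2 : Complex.exp (c.Ns * -(c.η / 2)) =
      Complex.exp (c.Ns * (c.η / 2)) * hc.baxterData.σ⁻¹ ^ hc.baxterData.M := by
    change _ = _ * (Complex.exp c.η)⁻¹ ^ c.Ns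
    rw [← Complex.exp_neg, ← Complex.exp_nat_mul, ← Complex.exp_add]
    congr 1
    ring
  have h3 : ∀ n, (X ^ 2 - Polynomial.C (hc.baxterData.δ n) : ℂ[X]).eval (Complex.exp u) =
      Complex.exp u ^ 2 - Complex.exp (2 * c.xi n 0) := by
    intro n
    rw [eval_sub, eval_pow, eval_X, eval_C]
    rfl
  rw [Finset.prod_congr rfl fun n _ => h3 n, h2]
  ring

/-- The functional Baxter equation in polynomial form. -/
theorem baxter_iff {Λ : Multiset ℂ} (hΛ : Multiset.card Λ = c.Ns) {u x : ℂ} :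
    c.normConst * Complex.exp (-(c.N * u)) * x * Q Λ 1 u =
      -(c.a u * Q Λ 1 (u - c.η)) + c.d u * Q Λ 1 (u + c.η) ↔
    x * (bethePoly Λ).eval (Complex.exp u) = (-(hc.baxterData.polyA *
      dilate hc.baxterData.σ⁻¹ (bethePoly Λ)) + hc.baxterData.polyD *
      dilate hc.baxterData.σ (bethePoly Λ)).eval (Complex.exp u) := by
  obtain ⟨K, hK, hQ⟩ := bethePoly_eval_eq_Q Λ
  have e1 : Complex.exp (u - c.η) = hc.baxterData.σ⁻¹ * Complex.exp u := by
    change _ = (Complex.exp c.η)⁻¹ * _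
    rw [← Complex.exp_neg, ← Complex.exp_add]
    congr 1
    ring
  have e2 : Complex.exp (u + c.η) = hc.baxterData.σ * Complex.exp u := by
    change _ = Complex.exp c.η * _
    rw [← Complex.exp_add]
    congr 1
    ring
  rw [hc.a_eq_polyA, hc.d_eq_polyD, hQ, hQ, hQ, hΛ, e1, e2, eval_add, eval_neg, eval_mul, eval_mul,
    eval_dilate, eval_dilate,
    show -(c.Ns * (u - c.η) / 2) = c.Ns * (c.η / 2) + -(c.Ns * u / 2) by ring,
    show -(c.Ns * (u + c.η) / 2) = -(c.Ns * (c.η / 2)) + -(c.Ns * u / 2) by ring,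
    Complex.exp_add, Complex.exp_add, Complex.exp_neg (c.Ns * (c.η / 2))]
  have h1 := Complex.exp_ne_zero (c.Ns * (c.η / 2))
  have h2 := mul_ne_zero (mul_ne_zero hK (Complex.exp_ne_zero (-(c.Ns * u / 2))))
    (mul_ne_zero c.normConst_ne_zero (Complex.exp_ne_zero (-(c.N * u))))
  rw [← mul_right_inj' h2 (b := x * _)]
  constructor
  · intro h
    field_simp at h ⊢
    linear_combination h
  · intro h
    field_simp at h ⊢
    linear_combination h

/-- Trigonometric polynomials solve the Bethe equations exactly if the associated polynomials solve
the polynomial Baxter equation. -/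
theorem isEntireBethe_iff_isSolution {Λ : Multiset ℂ} (hΛ : Multiset.card Λ = c.Ns) {t : ℂ → ℂ}
    {τ : ℂ[X]} (ht : ∀ u, t u = c.normConst * Complex.exp (-(c.N * u)) * τ.eval (Complex.exp u)) :
    c.IsEntireBethe Λ t ↔ hc.baxterData.IsSolution τ (bethePoly Λ) := by
  have hd : Differentiable ℂ t := by
    rw [funext ht]
    have : Differentiable ℂ fun u => τ.eval (Complex.exp u) :=
      τ.differentiable.comp Complex.differentiable_exp
    fun_prop
  rw [isEntireBethe_iff, and_iff_right hd, BaxterData.IsSolution]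
  constructor
  · intro h
    refine eq_of_eval_exp fun u => ?_
    rw [eval_mul, ← hc.baxter_iff hΛ, ← h, ht]
  · intro h u
    rw [ht, hc.baxter_iff hΛ, ← h, eval_mul]

include hc in
/-- The polynomial of an entire solution of the Bethe equations. -/
theorem exists_polynomial_of_isEntireBethe {Λ : Multiset ℂ} (hΛ : Multiset.card Λ = c.Ns)
    {t : ℂ → ℂ} (h : c.IsEntireBethe Λ t)
    (hπ : ∀ u, t (u + Complex.I * Real.pi) = (-1 : ℂ) ^ ((c.N : ℤ) - 1) * t u) :
    ∃ τ : ℂ[X], dilate (-1) τ = -τ ∧ τ.degree < (2 * c.N : ℕ) ∧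
      ∀ u, t u = c.normConst * Complex.exp (-(c.N * u)) * τ.eval (Complex.exp u) := by
  have hκ := c.normConst_ne_zero
  have hF : ∀ u, t u = c.normConst * Complex.exp (-(c.N * u)) *
      ((c.normConst * Complex.exp (-(c.N * u)))⁻¹ * t u) := fun u => by
    rw [mul_inv_cancel_left₀ (mul_ne_zero hκ (Complex.exp_ne_zero _))]
  have hcont : Continuous fun u => (c.normConst * Complex.exp (-(c.N * u)))⁻¹ * t u := by
    have := h.1.continuous
    refine Continuous.mul (Continuous.inv₀ (by fun_prop) fun u => ?_) this
    exact mul_ne_zero hκ (Complex.exp_ne_zero _)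
  obtain ⟨τ, hτ, ht⟩ := exists_eval_exp_of_mul_prod hcont Λ (R := -(hc.baxterData.polyA *
      dilate hc.baxterData.σ⁻¹ (bethePoly Λ)) + hc.baxterData.polyD *
      dilate hc.baxterData.σ (bethePoly Λ)) fun u => by
    rw [← bethePoly, ← hc.baxter_iff hΛ, ← hF]
    exact (isEntireBethe_iff.1 h).2 u
  have ht' : ∀ u, t u = c.normConst * Complex.exp (-(c.N * u)) * τ.eval (Complex.exp u) :=
    fun u => by rw [← ht, ← hF]
  have hsol := (hc.isEntireBethe_iff_isSolution hΛ ht').1 h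
  refine ⟨τ, ?_, ?_, ht'⟩
  -- The shift by iπ is w ↦ -w, and the prefactor exp (-N u) contributes (-1)^N, so the
  -- quasi-periodicity of t is oddness of τ.
  · refine eq_of_eval_exp fun u => ?_
    rw [eval_dilate, eval_neg, neg_one_mul]
    have h1 := hπ u
    have e : Complex.exp (-(c.N * (Real.pi * Complex.I))) = (-1) ^ c.N := by
      rw [← mul_neg, Complex.exp_nat_mul, Complex.exp_neg, Complex.exp_pi_mul_I]
      norm_num
    rw [ht', ht', Complex.exp_add, mul_comm Complex.I, Complex.exp_pi_mul_I, mul_neg_one, mul_add,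
      neg_add, Complex.exp_add, e, zpow_sub_one₀ (by norm_num), zpow_natCast] at h1
    have h2 := pow_ne_zero c.N (show (-1 : ℂ) ≠ 0 by norm_num)
    have h3 := Complex.exp_ne_zero (-(c.N * u))
    norm_num at h1
    field_simp at h1
    linear_combination h1
  · have := hsol.degree_lt (bethePoly_monic Λ) (by rw [natDegree_bethePoly, hΛ, baxterData_M])
    rwa [Fintype.card_fin] at this

end Generic

end Chain

end XXZ

/-! ### Bethe roots, completeness and nonvanishing of the eigenvectors -/

namespace XXZ

open Polynomial

/-- The branch of the logarithm with imaginary part in `[0, 2π)`. -/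
noncomputable def stripLog (z : ℂ) : ℂ :=
  if 0 ≤ z.arg then Complex.log z else Complex.log z + 2 * Real.pi * Complex.I

theorem exp_stripLog {z : ℂ} (hz : z ≠ 0) : Complex.exp (stripLog z) = z := by
  rw [stripLog]
  split_ifs
  · exact Complex.exp_log hz
  · rw [Complex.exp_add, Complex.exp_log hz, Complex.exp_two_pi_mul_I, mul_one]

theorem stripLog_im (z : ℂ) : (stripLog z).im ∈ Set.Ico 0 (2 * Real.pi) := by
  have h1 := Complex.neg_pi_lt_arg z
  have h2 := Complex.arg_le_pi z
  have h3 := Real.pi_pos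
  rw [stripLog]
  split_ifs with h
  · rw [Complex.log_im]
    exact ⟨h, by linarith⟩
  · have : (Complex.log z + 2 * Real.pi * Complex.I).im = z.arg + 2 * Real.pi := by
      simp [Complex.log_im]
    rw [this]
    exact ⟨by linarith, by linarith⟩

theorem eq_of_exp_eq_of_im_mem {x y : ℂ} (hx : x.im ∈ Set.Ico 0 (2 * Real.pi))
    (hy : y.im ∈ Set.Ico 0 (2 * Real.pi)) (h : Complex.exp x = Complex.exp y) : x = y := by
  obtain ⟨m, hm⟩ := Complex.exp_eq_exp_iff_exists_int.1 h
  have h1 : x.im = y.im + m * (2 * Real.pi) := by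
    rw [hm]
    simp
  have h3 := Real.pi_pos
  have h4 : m = 0 := by
    have h5 : (m : ℝ) < 1 := by
      by_contra! hle
      nlinarith [hx.1, hx.2, hy.1, hy.2]
    have h6 : (-1 : ℝ) < m := by
      by_contra! hle
      nlinarith [hx.1, hx.2, hy.1, hy.2]
    have h7 : m < 1 := by exact_mod_cast h5
    have h8 : -1 < m := by exact_mod_cast h6
    omega
  simpa [h4] using hm

/-- A nonzero constant term keeps the roots away from 0, so each has a logarithm in the strip;
multiplicities are carried along by the multiset of roots. -/
theorem exists_bethePoly_eq {q : ℂ[X]} (hq : q.Monic) (h0 : q.coeff 0 ≠ 0) :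
    ∃ Λ : Multiset ℂ, bethePoly Λ = q ∧ ∀ μ ∈ Λ, μ.im ∈ Set.Ico 0 (2 * Real.pi) := by
  refine ⟨q.roots.map stripLog, ?_, fun μ hμ => ?_⟩
  · rw [bethePoly, Multiset.map_map]
    conv_rhs => rw [(IsAlgClosed.splits q).eq_prod_roots_of_monic hq]
    refine congrArg _ (Multiset.map_congr rfl fun z hz => ?_)
    rw [Function.comp_apply, exp_stripLog]
    rintro rfl
    rw [mem_roots', IsRoot, ← coeff_zero_eq_eval_zero] at hz
    exact h0 hz.2
  · obtain ⟨z, -, rfl⟩ := Multiset.mem_map.1 hμ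
    exact stripLog_im z

theorem bethePoly_injective {Λ Λ' : Multiset ℂ} (hΛ : ∀ μ ∈ Λ, μ.im ∈ Set.Ico 0 (2 * Real.pi))
    (hΛ' : ∀ μ ∈ Λ', μ.im ∈ Set.Ico 0 (2 * Real.pi)) (h : bethePoly Λ = bethePoly Λ') : Λ = Λ' := by
  have key : ∀ Λ : Multiset ℂ, (∀ μ ∈ Λ, μ.im ∈ Set.Ico 0 (2 * Real.pi)) →
      (bethePoly Λ).roots.map stripLog = Λ := by
    intro Λ hΛ
    have e : bethePoly Λ = ((Λ.map Complex.exp).map fun z => X - C z).prod := by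
      rw [bethePoly, Multiset.map_map]
      rfl
    rw [e, roots_multiset_prod_X_sub_C, Multiset.map_map]
    conv_rhs => rw [← Multiset.map_id Λ]
    exact Multiset.map_congr rfl fun μ hμ => eq_of_exp_eq_of_im_mem (stripLog_im _) (hΛ μ hμ)
      (exp_stripLog (Complex.exp_ne_zero μ))
  rw [← key Λ hΛ, h, key Λ' hΛ']

namespace Chain

namespace Generic

variable {c : Chain} (hc : c.Generic)

/-- The eigenvalue functions give discrete solutions of the polynomial Baxter equation. -/
theorem hasKernels {κ : ℂ} (hκ : κ ≠ 0) {t : ℂ → ℂ} {v : c.Conf → ℂ}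
    (hv : v ∈ c.rightEigenspace κ t) (hv0 : v ≠ 0) {τ : ℂ[X]} (hτ : dilate (-1) τ = -τ)
    (ht : ∀ u, t u = c.normConst * Complex.exp (-(c.N * u)) * τ.eval (Complex.exp u)) :
    hc.baxterData.HasKernels τ := by
  intro n w hw
  obtain ⟨g, hg0, hg⟩ := hc.exists_discrete_solution hκ hv hv0 n
  set ρ : ℂ := Complex.exp (c.Ns * (c.η / 2)) with hρ
  have hρ0 : ρ ≠ 0 := Complex.exp_ne_zero _
  set x : ℕ → ℂ := fun k => Complex.exp (c.xi n k) with hx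
  have h5 : hc.baxterData.polyD.eval (x 0) = 0 := by
    refine hc.baxterData.eval_polyD_top (n := n) ?_
    change Complex.exp (c.xi n 0) ^ 2 = Complex.exp (2 * c.xi n 0)
    rw [← Complex.exp_nat_mul]
    rfl
  have h1 : ∀ k ≤ c.twoS n, τ.eval (x k) * (ρ⁻¹ ^ k * g k) =
      -(hc.baxterData.polyA.eval (x k) * (ρ⁻¹ ^ (k + 1) * g (k + 1))) +
        hc.baxterData.polyD.eval (x k) * (ρ⁻¹ ^ (k - 1) * g (k - 1)) := by
    intro k hk
    have h2 := hg k hk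
    rw [ht, hc.a_eq_polyA, hc.d_eq_polyD, Complex.exp_neg (c.Ns * (c.η / 2)), ← hρ] at h2
    have h3 := c.normConst_ne_zero
    have h4 := Complex.exp_ne_zero (-(c.N * c.xi n k))
    change _ * τ.eval (x k) * _ = -(_ * hc.baxterData.polyA.eval (x k) * _) +
      _ * hc.baxterData.polyD.eval (x k) * _ at h2
    have h6 : τ.eval (x k) * g k = -(ρ⁻¹ * hc.baxterData.polyA.eval (x k) * g (k + 1)) +
        ρ * hc.baxterData.polyD.eval (x k) * g (k - 1) :=
      mul_left_cancel₀ (mul_ne_zero h3 h4) (by linear_combination h2)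
    rcases k with _ | k
    · rw [h5] at h6 ⊢
      linear_combination h6
    · rw [Nat.add_sub_cancel] at h6 ⊢
      linear_combination ρ⁻¹ ^ (k + 1) * h6 +
        ρ⁻¹ ^ k * hc.baxterData.polyD.eval (x (k + 1)) * g k * inv_mul_cancel₀ hρ0
  have hxk : ∀ k, x k = x 0 * hc.baxterData.σ⁻¹ ^ k := c.exp_xi n
  have hw' : w = x 0 ∨ w = -x 0 := by
    refine sq_eq_sq_iff_eq_or_eq_neg.1 ?_
    rw [hw]
    change Complex.exp (2 * c.xi n 0) = Complex.exp (c.xi n 0) ^ 2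
    rw [← Complex.exp_nat_mul]
    rfl
  rcases hw' with rfl | rfl
  · refine ⟨fun k => ρ⁻¹ ^ k * g k, by simpa using hg0, fun k hk => ?_⟩
    rw [← hxk]
    exact h1 k hk
  -- At the opposite square root τ changes sign while A and D do not; an alternating sign in the
  -- solution absorbs this.
  · refine ⟨fun k => (-1) ^ k * (ρ⁻¹ ^ k * g k), by simpa using hg0, fun k hk => ?_⟩
    have hA : ∀ z, hc.baxterData.polyA.eval (-z) = hc.baxterData.polyA.eval z := by
      intro z
      rw [← neg_one_mul, ← eval_dilate, BaxterData.dilate_neg_polyA]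
    have hD : ∀ z, hc.baxterData.polyD.eval (-z) = hc.baxterData.polyD.eval z := by
      intro z
      rw [← neg_one_mul, ← eval_dilate, BaxterData.dilate_neg_polyD]
    rw [neg_mul, ← hxk, eval_neg_of_odd hτ, hA, hD]
    beta_reduce
    have h2 := h1 k hk
    rcases k with _ | k
    · rw [h5] at h2 ⊢
      linear_combination -h2
    · rw [Nat.add_sub_cancel] at h2 ⊢
      linear_combination (-1) ^ k * h2

-- The eigenvector supplies the kernels on the strings, hence a polynomial solution with nonzero
-- constant term. Rescaled to be monic, it has degree N_s, and the logarithms of its roots form Λ.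
-- Admissibility is `not_both_zero` and quasi-periodicity is oddness of τ.
include hc in
theorem exists_bethe_of_mem_spectrum {κ : ℂ} (hκ : κ ≠ 0) {t : ℂ → ℂ} (h : t ∈ c.spectrum κ) :
    ∃ Λ ∈ c.betheSolutions, c.IsEntireBethe Λ t := by
  obtain ⟨v, hv, hv0⟩ := Submodule.exists_mem_ne_zero_of_ne_bot h
  have hT := c.isTrig_of_eigenvector hv0 (c.mem_rightEigenspace.1 hv)
  obtain ⟨τ, hτ, hdeg, ht⟩ := (isTrig_iff_exists_odd c.normConst_ne_zero).1 hT
  have hdeg' : τ.degree < (2 * Fintype.card (Fin c.N) : ℕ) := by rwa [Fintype.card_fin]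
  obtain ⟨q, hq1, hq⟩ := hc.baxterData.exists_isSolution (hc.hasKernels hκ hv hv0 hτ ht) hτ
    (natDegree_le_of_degree_le hdeg'.le)
  have hq0 : q ≠ 0 := by
    rintro rfl
    simp at hq1
  have hl : q.leadingCoeff⁻¹ ≠ 0 := inv_ne_zero (leadingCoeff_ne_zero.2 hq0)
  have hmonic : (q * Polynomial.C q.leadingCoeff⁻¹).Monic := monic_mul_leadingCoeff_inv hq0
  obtain ⟨Λ, hΛ, him⟩ := exists_bethePoly_eq hmonic
    (by rw [mul_coeff_zero, hq1, coeff_C_zero, one_mul]; exact hl)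
  have hsol : hc.baxterData.IsSolution τ (bethePoly Λ) := by
    rw [hΛ]
    unfold BaxterData.IsSolution at *
    simp only [dilate, mul_comp, Polynomial.C_comp] at *
    linear_combination Polynomial.C q.leadingCoeff⁻¹ * hq
  have hcard : Multiset.card Λ = c.Ns := by
    rw [← natDegree_bethePoly, hsol.natDegree_eq hdeg' (bethePoly_monic Λ).ne_zero, baxterData_M]
  have hent := (hc.isEntireBethe_iff_isSolution hcard ht).2 hsol
  refine ⟨Λ, ⟨hcard, him, fun k hk => ?_, t, hent, fun u => ?_⟩, hent⟩
  · have h1 : ∀ u, Q Λ 1 u = 0 → (bethePoly Λ).eval (Complex.exp u) = 0 := by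
      intro u hu
      obtain ⟨K, hK, hQ⟩ := bethePoly_eval_eq_Q Λ
      rw [hQ] at hu
      exact (mul_eq_zero.1 hu).resolve_left (mul_ne_zero hK (Complex.exp_ne_zero _))
    refine hsol.not_both_zero hτ (n := k) (w := Complex.exp (c.xi k 0))
      (hsol.coeff_zero_ne_zero hτ (bethePoly_monic Λ).ne_zero) ?_
      (h1 _ (Q_one_eq_zero_iff.2 (hk (Set.mem_insert _ _)))) ?_
    · change _ = Complex.exp (2 * c.xi k 0)
      rw [← Complex.exp_nat_mul]
      rfl
    · have := h1 _ (Q_one_eq_zero_iff.2 (hk (Set.mem_insert_of_mem _ rfl)))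
      rwa [Complex.exp_add, mul_comm Complex.I, Complex.exp_pi_mul_I, mul_neg_one] at this
  · have e : Complex.exp (-(c.N * (Real.pi * Complex.I))) = (-1) ^ c.N := by
      rw [← mul_neg, Complex.exp_nat_mul, Complex.exp_neg, Complex.exp_pi_mul_I]
      norm_num
    rw [ht, ht, Complex.exp_add, mul_comm Complex.I, Complex.exp_pi_mul_I, mul_neg_one, mul_add,
      neg_add, Complex.exp_add, e, zpow_sub_one₀ (by norm_num), zpow_natCast, eval_neg_of_odd hτ]
    norm_num
    ring

-- A common t gives a common τ, so both families give monic solutions of one Baxter equation; the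
-- strip condition recovers the roots λ from their exponentials.
include hc in
theorem bethe_injective {Λ Λ' : Multiset ℂ} (hΛ : Λ ∈ c.betheSolutions)
    (hΛ' : Λ' ∈ c.betheSolutions) {t : ℂ → ℂ} (h : c.IsEntireBethe Λ t)
    (h' : c.IsEntireBethe Λ' t) : Λ = Λ' := by
  obtain ⟨hcard, him, -, t', ht', hπ⟩ := hΛ
  obtain rfl := h.unique ht'
  obtain ⟨τ, hτ, -, htτ⟩ := hc.exists_polynomial_of_isEntireBethe hcard h hπ
  have h1 := (hc.isEntireBethe_iff_isSolution hcard htτ).1 h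
  have h2 := (hc.isEntireBethe_iff_isSolution hΛ'.1 htτ).1 h'
  exact bethePoly_injective him hΛ'.2.1
    (h1.eq_of_monic hτ h2 (bethePoly_monic _) (bethePoly_monic _))

/-- At k = 0 the truncated index k - 1 is 0 rather than -1, which is harmless because d vanishes at
the top of a string. -/
theorem equation_on_strings {Λ : Multiset ℂ} {t : ℂ → ℂ} (h : c.IsEntireBethe Λ t)
    (hπ : ∀ u, t (u + Complex.I * Real.pi) = (-1 : ℂ) ^ ((c.N : ℤ) - 1) * t u)
    (ε : Fin c.N → ℤˣ) (n : Fin c.N) (k : ℕ) :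
    t (c.xi n k) * Q Λ (ε n) (c.xi n k) = ((ε n : ℤ) : ℂ) *
      (-(c.a (c.xi n k) * Q Λ (ε n) (c.xi n (k + 1))) +
        c.d (c.xi n k) * Q Λ (ε n) (c.xi n (k - 1))) := by
  have e1 : c.xi n k - c.η = c.xi n (k + 1) := by rw [← c.xi_add_one n k]; ring
  rw [h.equation hπ, e1]
  rcases k with _ | k
  · rw [c.d_top, zero_mul, zero_mul]
  · rw [c.xi_add_one, Nat.add_sub_cancel]

include hc

theorem leftVec_mem {κ : ℂ} (hκ : κ ≠ 0) {Λ : Multiset ℂ} (hΛ : Λ ∈ c.betheSolutions)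
    {t : ℂ → ℂ} (h : c.IsEntireBethe Λ t) (ε : Fin c.N → ℤˣ) :
    c.leftVec κ Λ ε ∈ c.leftEigenspace κ t := by
  obtain ⟨hcard, -, -, t', ht', hπ⟩ := hΛ
  obtain rfl := h.unique ht'
  have hT : IsTrig c.N t := (isTrig_iff_exists_odd c.normConst_ne_zero).2
    (hc.exists_polynomial_of_isEntireBethe hcard h hπ)
  exact hc.left_separated_mem hκ hT (q := fun n k => Q Λ (ε n) (c.xi n k))
    fun n k _ => equation_on_strings h hπ ε n k

theorem rightVec_mem {κ : ℂ} (hκ : κ ≠ 0) {Λ : Multiset ℂ} (hΛ : Λ ∈ c.betheSolutions)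
    {t : ℂ → ℂ} (h : c.IsEntireBethe Λ t) (ε : Fin c.N → ℤˣ) :
    c.rightVec κ Λ ε ∈ c.rightEigenspace κ t := by
  obtain ⟨hcard, -, -, t', ht', hπ⟩ := hΛ
  obtain rfl := h.unique ht'
  have hT : IsTrig c.N t := (isTrig_iff_exists_odd c.normConst_ne_zero).2
    (hc.exists_polynomial_of_isEntireBethe hcard h hπ)
  exact hc.right_separated_mem hκ hT (q := fun n k => Q Λ (ε n) (c.xi n k))
    fun n k _ => equation_on_strings h hπ ε n k

/-- The bras are linearly independent, and the coefficient of the reference bra is a product of the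
nonzero values Q(ξ_j^(0)) and a nonzero Vandermonde factor. -/
theorem leftVec_ne_zero (κ : ℂ) {Λ : Multiset ℂ} {ε : Fin c.N → ℤˣ}
    (hε : ∀ j, Q Λ (ε j) (c.xi j 0) ≠ 0) : c.leftVec κ Λ ε ≠ 0 := by
  intro h
  have h1 := Fintype.linearIndependent_iff.1 (hc.separated_bra.linearIndependent hc) _ h 0
  refine mul_ne_zero (Finset.prod_ne_zero_iff.2 fun j _ => ?_) (sinhVandermonde_ne_zero hc 0) h1
  simpa using hε j

theorem rightVec_ne_zero (κ : ℂ) {Λ : Multiset ℂ} {ε : Fin c.N → ℤˣ}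
    (hε : ∀ j, Q Λ (ε j) (c.xi j 0) ≠ 0) : c.rightVec κ Λ ε ≠ 0 := by
  intro h
  have h1 := Fintype.linearIndependent_iff.1 (hc.separated_ket.linearIndependent hc) _ h 0
  refine mul_ne_zero (Finset.prod_ne_zero_iff.2 fun j _ => ?_) (sinhVandermonde_ne_zero hc 0) h1
  simpa using hε j

-- Admissibility says that at each ξ_j^(0) at least one of Q(u) and Q(u + iπ) is nonzero, so a sign
-- can be chosen site by site.
omit hc in
theorem exists_signs {Λ : Multiset ℂ} (hΛ : Λ ∈ c.betheSolutions) :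
    ∃ ε : Fin c.N → ℤˣ, ∀ j, Q Λ (ε j) (c.xi j 0) ≠ 0 := by
  have h : ∀ j, ∃ ε : ℤˣ, Q Λ ε (c.xi j 0) ≠ 0 := by
    intro j
    by_contra! h0
    refine hΛ.2.2.1 j ?_
    rintro z (rfl | rfl)
    · exact Q_one_eq_zero_iff.1 (h0 1)
    · exact Q_one_eq_zero_iff.1 ((Q_neg_one Λ _).symm.trans (h0 (-1)))
  exact ⟨fun j => (h j).choose, fun j => (h j).choose_spec⟩

end Generic

end Chain

end XXZ

/-! ### The bijection and the eigenspaces -/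

theorem corollary5p1 (c : XXZ.Chain)
    -- `q = exp η` is not a root of unity
    (hη : ∀ n : ℕ, 0 < n → Complex.exp c.η ^ n ≠ 1)
    (hξ : ∀ i j : Fin c.N, i ≠ j → Disjoint (c.Xi i) (c.Xi j)) :
    ∃ t : Multiset ℂ → ℂ → ℂ,
      (∀ Λ ∈ c.betheSolutions, c.IsEntireBethe Λ (t Λ)) ∧
      ∀ κ : ℂ, κ ≠ 0 →
        Set.BijOn t c.betheSolutions (c.spectrum κ) ∧
        ∀ Λ ∈ c.betheSolutions,
          Module.finrank ℂ (c.leftEigenspace κ (t Λ)) = 1 ∧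
          Module.finrank ℂ (c.rightEigenspace κ (t Λ)) = 1 ∧
          c.leftEigenspace κ (t Λ) = Submodule.span ℂ (Set.range (c.leftVec κ Λ)) ∧
          c.rightEigenspace κ (t Λ) = Submodule.span ℂ (Set.range (c.rightVec κ Λ)) ∧
          ∀ ε : Fin c.N → ℤˣ, (∀ j, XXZ.Q Λ (ε j) (c.xi j 0) ≠ 0) →
            c.leftEigenspace κ (t Λ) = Submodule.span ℂ {c.leftVec κ Λ ε} ∧
            c.rightEigenspace κ (t Λ) = Submodule.span ℂ {c.rightVec κ Λ ε} := by
  have hc : c.Generic := ⟨hη, hξ⟩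
  -- Outside the Bethe solutions the value of t is irrelevant, and 0 is used; on them it is
  -- determined by `IsEntireBethe.unique`. The choice precedes κ, so one map works for all twists.
  have hex : ∀ Λ, ∃ t, Λ ∈ c.betheSolutions → c.IsEntireBethe Λ t := by
    intro Λ
    by_cases h : Λ ∈ c.betheSolutions
    · obtain ⟨t, ht, -⟩ := h.2.2.2
      exact ⟨t, fun _ => ht⟩
    · exact ⟨0, fun h' => absurd h' h⟩
  choose t ht using hex
  refine ⟨t, ht, fun κ hκ => ⟨⟨?_, ?_, ?_⟩, fun Λ hΛ => ?_⟩⟩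
  · intro Λ hΛ
    obtain ⟨ε, hε⟩ := XXZ.Chain.Generic.exists_signs hΛ
    exact Submodule.ne_bot_iff _ |>.2 ⟨_, hc.rightVec_mem hκ hΛ (ht Λ hΛ) ε,
      hc.rightVec_ne_zero κ hε⟩
  · intro Λ hΛ Λ' hΛ' h
    exact hc.bethe_injective hΛ hΛ' (ht Λ hΛ) (h ▸ ht Λ' hΛ')
  · intro s hs
    obtain ⟨Λ, hΛ, h⟩ := hc.exists_bethe_of_mem_spectrum hκ hs
    exact ⟨Λ, hΛ, (ht Λ hΛ).unique h⟩
  · have hl := hc.leftVec_mem hκ hΛ (ht Λ hΛ)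
    have hr := hc.rightVec_mem hκ hΛ (ht Λ hΛ)
    have hspan : ∀ ε : Fin c.N → ℤˣ, (∀ j, XXZ.Q Λ (ε j) (c.xi j 0) ≠ 0) →
        c.leftEigenspace κ (t Λ) = Submodule.span ℂ {c.leftVec κ Λ ε} ∧
        c.rightEigenspace κ (t Λ) = Submodule.span ℂ {c.rightVec κ Λ ε} := fun ε hε =>
      ⟨hc.left_eq_span hκ (hl ε) (hc.leftVec_ne_zero κ hε),
        hc.right_eq_span hκ (hr ε) (hc.rightVec_ne_zero κ hε)⟩
    obtain ⟨ε, hε⟩ := XXZ.Chain.Generic.exists_signs hΛ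
    refine ⟨?_, ?_, le_antisymm ?_ ?_, le_antisymm ?_ ?_, hspan⟩
    · rw [(hspan ε hε).1]
      exact finrank_span_singleton (hc.leftVec_ne_zero κ hε)
    · rw [(hspan ε hε).2]
      exact finrank_span_singleton (hc.rightVec_ne_zero κ hε)
    -- One admissible sign vector already spans, and the vectors for all other signs, possibly zero,
    -- lie in the same eigenspace.
    · rw [(hspan ε hε).1]
      exact Submodule.span_mono (Set.singleton_subset_iff.2 (Set.mem_range_self ε))
    · exact Submodule.span_le.2 (Set.range_subset_iff.2 hl)
    · rw [(hspan ε hε).2]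
      exact Submodule.span_mono (Set.singleton_subset_iff.2 (Set.mem_range_self ε))
    · exact Submodule.span_le.2 (Set.range_subset_iff.2 hr)
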